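/- **Kim–Pillay style characterisation of stable theories (positive logic).** *Setting.* Fix a (possibly multi-sorted) signature and a set $T$ of h-inductive sentences $\forall x(\varphi(x)\to\psi(x))$, with $\varphi,\psi$ positive formulas, i.e. built from atomic formulas (including equalities) by $\top,\bot,\wedge,\vee,\exists$. "Formula" means positive formula. A model $M$ of $T$ is *positively closed (p.c.)* if whenever $M\not\models\varphi(a)$ there is a formula $\psi(x)$ with $M\models\psi(a)$ and $T\models\neg\exists x(\varphi(x)\wedge\psi(x))$. Assume that any two models of $T$ admit homomorphisms into a common model of $T$, and that $T$ is *thick*: there is a set of formulas $\Theta((x_i)_{i<\omega})$ (for tuples $x_i$ of each length and sort) such that a sequence $(a_i)_{i<\omega}$ in a p.c. model is indiscernible if and only if it satisfies $\Theta$ there. Fix an inaccessible cardinal $\kappa$ larger than the numbers of sorts, function symbols and relation symbols; "small" means of cardinality $<\kappa$. Let $\mathfrak M$ be a monster model of $T$: a p.c. model in which every small set of formulas with parameters, in a small tuple of variables, that is finitely satisfiable in $\mathfrak M$ is satisfiable in $\mathfrak M$, and in which any two small tuples with the same type are conjugate under $\mathrm{Aut}(\mathfrak M)$. Below, all tuples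 $a,b,\dots$ and sets $A,B,C,\dots$ are small and in $\mathfrak M$, all cardinals are small, juxtaposition denotes union, and a tuple is identified with the set it enumerates where a set is expected; $\mathrm{tp}(a/C)$ is the set of formulas over $C$ true of $a$, and $a\equiv_C a'$ means $\mathrm{tp}(a/C)=\mathrm{tp}(a'/C)$. We write $a\equiv^{\mathrm{Ls}}_C a'$ if there are $a=a_0,\dots,a_n=a'$ such that $a_i,a_{i+1}$ lie on an infinite $C$-indiscernible sequence for each $i<n$. *Stability.* $T$ is *stable* if there is an infinite cardinal $\lambda$ such that for every $B$ with $|B|\le\lambda$ and every finite tuple of variables $x$ there are at most $\lambda$ types $\mathrm{tp}(a/B)$ of tuples $a$ matching $x$. *Dividing independence.* $A\perp^d_C B$ means, for tuples $a,b$ enumerating $A,B$ and $p(x,b)=\mathrm{tp}(a/Cb)$, that $p(x,b)$ does not divide over $C$, i.e. there is no $C$-indiscernible sequence $(b_i)_{i<\omega}$ with $b_i\equiv_C b$ for all $i$ such that $\bigcup_{i<\omega}p(x,b_i)$ is inconsistent (not realised in $\mathfrak M$). *Theorem.* $T$ is stable if and only if there is a ternary relation $A\perp_C B$ on small subsets of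 $\mathfrak M$ satisfying, for all $a,b,d,C$: - invariance: $a\perp_C b$ implies $f(a)\perp_{f(C)}f(b)$ for $f\in\mathrm{Aut}(\mathfrak M)$; - monotonicity: $a\perp_C b$ implies $a'\perp_C b'$ for $a'\subseteq a$, $b'\subseteq b$; - normality: $a\perp_C b$ implies $Ca\perp_C Cb$; - existence: $a\perp_C C$; - full existence: there is $b'\equiv_C b$ with $a\perp_C b'$; - base monotonicity: if $C\subseteq C'\subseteq b$ and $a\perp_C b$ then $a\perp_{C'}b$; - extension: if $a\perp_C b$ then there is $d'\equiv_{Cb}d$ with $a\perp_C bd'$; - symmetry: $a\perp_C b$ implies $b\perp_C a$; - transitivity: if $C\subseteq C'$, $a\perp_C C'$ and $a\perp_{C'}b$ then $a\perp_C b$; - finite character: if $a'\perp_C b'$ for all finite $a'\subseteq a$ and $b'\subseteq b$ then $a\perp_C b$; - local character: for every cardinal $\mu$ there is a cardinal $\nu$ such that for all $a$ with $|a|<\mu$ and all $C$ there is $C'\subseteq C$ with $|C'|<\nu$ and $a\perp_{C'}C$; - stationarity: if $C$ is such that $e\equiv_C e'$ implies $e\equiv^{\mathrm{Ls}}_C e'$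 for all tuples $e,e'$, then $a\perp_C b$, $a'\perp_C b$ and $a\equiv_C a'$ imply $a\equiv_{Cb}a'$. Furthermore, every relation $\perp$ satisfying these properties equals $\perp^d$ on small sets. -/

import Mathlib

open Cardinal

universe u

namespace PosLogic

/-- A possibly multi-sorted signature; equality on each sort is always part of the language.
Constant symbols are the function symbols with empty list of argument sorts. -/
structure Signature where
  Srt : Type u
  Fn : Type u
  dom : Fn → List Srt
  cod : Fn → Srt
  Rel : Type u
  arity : Rel → List Srt

variable {L : Signature.{u}}

/-- A structure; (some of) its sorts are allowed to be empty. -/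
structure Str (L : Signature.{u}) where
  carrier : L.Srt → Type u
  fn : ∀ f : L.Fn, (∀ i, carrier ((L.dom f).get i)) → carrier (L.cod f)
  rel : ∀ R : L.Rel, (∀ i, carrier ((L.arity R).get i)) → Prop

/-- Terms in variables `v : V`, where `v` has sort `σ v`. -/
inductive Term {V : Type u} (σ : V → L.Srt) : L.Srt → Type u
  | var (v : V) : Term σ (σ v)
  | app (f : L.Fn) (ts : ∀ i, Term σ ((L.dom f).get i)) : Term σ (L.cod f)

/-- Positive formulas: the free variables are the `v : V` (of sort `σ v`) and the entries of the
list `Γ` of sorts. The existential quantifier binds the head of the list. -/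
inductive PosFormula {V : Type u} (σ : V → L.Srt) : List L.Srt → Type u
  | top {Γ : List L.Srt} : PosFormula σ Γ
  | bot {Γ : List L.Srt} : PosFormula σ Γ
  | eq {Γ : List L.Srt} {s : L.Srt} (t₁ t₂ : Term (Sum.elim σ Γ.get) s) : PosFormula σ Γ
  | rel {Γ : List L.Srt} (R : L.Rel)
      (ts : ∀ i, Term (Sum.elim σ Γ.get) ((L.arity R).get i)) : PosFormula σ Γ
  | and {Γ : List L.Srt} (φ ψ : PosFormula σ Γ) : PosFormula σ Γ
  | or {Γ : List L.Srt} (φ ψ : PosFormula σ Γ) : PosFormula σ Γ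
  | ex {Γ : List L.Srt} {s : L.Srt} (φ : PosFormula σ (s :: Γ)) : PosFormula σ Γ

/-- Formulas in the variables `v : V` only. -/
abbrev Formula {V : Type u} (σ : V → L.Srt) : Type u := PosFormula σ []

/-- Formulas in a finite list of variables of the given sorts. -/
abbrev CtxFormula (Γ : List L.Srt) : Type u :=
  PosFormula (PEmpty.elim : PEmpty.{u + 1} → L.Srt) Γ

namespace Str

/-- Elements of `M`, of any sort. -/
abbrev Elt (M : Str L) : Type u := Σ s, M.carrier s

/-- Tuples in `M`, indexed by `ι`, whose `i`-th entry has sort `σ i`. -/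
abbrev Tuple (M : Str L) {ι : Type u} (σ : ι → L.Srt) : Type u := ∀ i, M.carrier (σ i)

/-- The set enumerated by a tuple. -/
def toSet (M : Str L) {ι : Type u} {σ : ι → L.Srt} (a : M.Tuple σ) : Set M.Elt :=
  Set.range fun i => ⟨σ i, a i⟩

/-- The sorts of the elements of a set. -/
abbrev sorts (M : Str L) (B : Set M.Elt) : B → L.Srt := fun b => b.1.1

/-- A set, as a tuple indexed by itself. -/
def enum (M : Str L) (B : Set M.Elt) : M.Tuple (M.sorts B) := fun b => b.1.2

/-- Concatenation of tuples. -/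
def join (M : Str L) {V W : Type u} {σ : V → L.Srt} {τ : W → L.Srt}
    (a : ∀ i, M.carrier (σ i)) (b : ∀ j, M.carrier (τ j)) :
    ∀ k, M.carrier (Sum.elim σ τ k)
  | .inl i => a i
  | .inr j => b j

end Str

/-- The value of a term under an assignment. -/
def Term.eval (M : Str L) {V : Type u} {σ : V → L.Srt} (a : ∀ v, M.carrier (σ v)) :
    ∀ {s : L.Srt}, Term σ s → M.carrier s
  | _, .var v => a v
  | _, .app f ts => M.fn f fun i => (ts i).eval M a

/-- The assignment to a list of variables with `m` for the head and `x` for the tail. -/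
def Str.push (M : Str L) {s : L.Srt} {Γ : List L.Srt} (m : M.carrier s)
    (x : ∀ i, M.carrier (Γ.get i)) : ∀ i, M.carrier ((s :: Γ).get i)
  | ⟨0, _⟩ => m
  | ⟨i + 1, h⟩ => x ⟨i, Nat.lt_of_succ_lt_succ h⟩

/-- Assignments to a list of variables and to the variables in `V`, taken together. -/
def Str.env (M : Str L) {V : Type u} {σ : V → L.Srt} {Γ : List L.Srt}
    (a : ∀ v, M.carrier (σ v)) (x : ∀ i, M.carrier (Γ.get i)) :
    ∀ k, M.carrier (Sum.elim σ Γ.get k)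
  | .inl v => a v
  | .inr i => x i

/-- Satisfaction of positive formulas. -/
def PosFormula.Realize (M : Str L) {V : Type u} {σ : V → L.Srt} (a : ∀ v, M.carrier (σ v)) :
    ∀ {Γ : List L.Srt}, PosFormula σ Γ → (∀ i, M.carrier (Γ.get i)) → Prop
  | _, .top, _ => True
  | _, .bot, _ => False
  | _, .eq t₁ t₂, x => t₁.eval M (M.env a x) = t₂.eval M (M.env a x)
  | _, .rel R ts, x => M.rel R fun i => (ts i).eval M (M.env a x)
  | _, .and φ ψ, x => φ.Realize M a x ∧ ψ.Realize M a x
  | _, .or φ ψ, x => φ.Realize M a x ∨ ψ.Realize M a x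
  | _, .ex (s := s) φ, x => ∃ m : M.carrier s, φ.Realize M a (M.push m x)

/-- `M ⊨ φ(a)`. -/
def Str.Sat (M : Str L) {V : Type u} {σ : V → L.Srt} (φ : Formula σ) (a : M.Tuple σ) : Prop :=
  φ.Realize M a fun i => i.elim0

/-- `M ⊨ φ(x)` for a formula in a finite list of variables. -/
def Str.SatCtx (M : Str L) {Γ : List L.Srt} (φ : CtxFormula Γ)
    (x : ∀ i, M.carrier (Γ.get i)) : Prop :=
  φ.Realize M (fun v => v.elim) x

/-- The h-inductive sentence `∀ x, (lhs x → rhs x)`. -/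
structure HInductive (L : Signature.{u}) where
  ctx : List L.Srt
  lhs : CtxFormula ctx
  rhs : CtxFormula ctx

/-- A (positive) theory is a set of h-inductive sentences. -/
abbrev Theory (L : Signature.{u}) : Type u := Set (HInductive L)

/-- `M` is a model of `T`. -/
def Str.Models (M : Str L) (T : Theory L) : Prop :=
  ∀ χ ∈ T, ∀ x, M.SatCtx χ.lhs x → M.SatCtx χ.rhs x

/-- `ψ` is an obstruction of `φ`: `T ⊨ ¬ ∃ x, (φ x ∧ ψ x)`. -/
def Theory.Obstruction (T : Theory L) {Γ : List L.Srt} (φ ψ : CtxFormula Γ) : Prop :=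
  ∀ N : Str L, N.Models T → ¬ ∃ x, N.SatCtx φ x ∧ N.SatCtx ψ x

/-- Positively closed models. -/
def Str.IsPC (M : Str L) (T : Theory L) : Prop :=
  M.Models T ∧ ∀ (Γ : List L.Srt) (φ : CtxFormula Γ) (x : ∀ i, M.carrier (Γ.get i)),
    ¬ M.SatCtx φ x → ∃ ψ : CtxFormula Γ, T.Obstruction φ ψ ∧ M.SatCtx ψ x

/-- Homomorphisms. -/
structure Hom (M N : Str L) where
  toFun : ∀ s, M.carrier s → N.carrier s
  map_fn : ∀ f x, toFun _ (M.fn f x) = N.fn f fun i => toFun _ (x i)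
  map_rel : ∀ R x, M.rel R x → N.rel R fun i => toFun _ (x i)

/-- The joint continuation property. -/
def Theory.JCP (T : Theory L) : Prop :=
  ∀ M M' : Str L, M.Models T → M'.Models T →
    ∃ N : Str L, N.Models T ∧ Nonempty (Hom M N) ∧ Nonempty (Hom M' N)

/-- Automorphisms. -/
structure Aut (M : Str L) where
  toEquiv : ∀ s, M.carrier s ≃ M.carrier s
  map_fn : ∀ f x, toEquiv _ (M.fn f x) = M.fn f fun i => toEquiv _ (x i)
  map_rel : ∀ R x, M.rel R x ↔ M.rel R fun i => toEquiv _ (x i)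

/-- The image of a set under an automorphism. -/
def Aut.image {M : Str L} (e : Aut M) (A : Set M.Elt) : Set M.Elt :=
  (fun m : M.Elt => (⟨m.1, e.toEquiv m.1 m.2⟩ : M.Elt)) '' A

namespace Str

variable (M : Str L)

/-- `tp(a/B)`: the formulas with parameters from `B` satisfied by `a`. -/
def tp (B : Set M.Elt) {ι : Type u} {σ : ι → L.Srt} (a : M.Tuple σ) :
    Set (Formula (Sum.elim σ (M.sorts B))) :=
  {φ | M.Sat φ (M.join a (M.enum B))}

/-- `a ≡_B a'`. -/
def EquivOver (B : Set M.Elt) {ι : Type u} {σ : ι → L.Srt} (a a' : M.Tuple σ) : Prop :=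
  M.tp B a = M.tp B a'

/-- The concatenation `a_{f 0} … a_{f (n-1)}` of entries of a sequence of tuples. -/
def subseq {ι : Type u} {σ : ι → L.Srt} {I : Type*} (a : I → M.Tuple σ) {n : ℕ}
    (f : Fin n → I) : M.Tuple (fun p : Fin n × ι => σ p.2) :=
  fun p => a (f p.1) p.2

/-- The sequence `(a_i)_{i ∈ I}` of tuples is indiscernible over `B`
(for infinite index sets `I`). -/
def Indiscernible (B : Set M.Elt) {ι : Type u} {σ : ι → L.Srt} {I : Type*} [LinearOrder I]
    (a : I → M.Tuple σ) : Prop :=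
  ∀ (n : ℕ) (f g : Fin n → I), StrictMono f → StrictMono g →
    M.EquivOver B (M.subseq a f) (M.subseq a g)

end Str

/-- Being an indiscernible sequence (of tuples of any given sorts) is type-definable
in the p.c. models of `T`. -/
def Theory.Thick (T : Theory L) : Prop :=
  ∀ (ι : Type u) (σ : ι → L.Srt), ∃ Θ : Set (Formula (fun p : ℕ × ι => σ p.2)),
    ∀ M : Str L, M.IsPC T → ∀ a : ℕ → M.Tuple σ,
      M.Indiscernible ∅ a ↔ ∀ φ ∈ Θ, M.Sat φ (fun p : ℕ × ι => a p.1 p.2)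

/-- `M` is a monster model of `T`, where "small" means "of cardinality less than `κ`". -/
structure IsMonster (T : Theory L) (κ : Cardinal.{u}) (M : Str L) : Prop where
  pc : M.IsPC T
  homogeneous : ∀ (ι : Type u) (σ : ι → L.Srt) (a b : M.Tuple σ), #ι < κ →
    M.EquivOver ∅ a b → ∃ e : Aut M, ∀ i, e.toEquiv _ (a i) = b i
  saturated : ∀ (ι : Type u) (σ : ι → L.Srt)
    (S : Set (Formula (Sum.elim σ (M.sorts Set.univ)))), #ι < κ → #S < κ →
    (∀ S₀ ⊆ S, S₀.Finite →
      ∃ a : M.Tuple σ, ∀ φ ∈ S₀, M.Sat φ (M.join a (M.enum Set.univ))) →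
    ∃ a : M.Tuple σ, ∀ φ ∈ S, M.Sat φ (M.join a (M.enum Set.univ))

section Monster

variable (κ : Cardinal.{u}) (M : Str L)

/-- `a` and `a'` are on a common (infinite, small) `B`-indiscernible sequence. -/
def OnIndiscernible (B : Set M.Elt) {ι : Type u} {σ : ι → L.Srt} (a a' : M.Tuple σ) : Prop :=
  ∃ (I : Type u) (_ : LinearOrder I) (s : I → M.Tuple σ), Infinite I ∧ #I < κ ∧
    M.Indiscernible B s ∧ (∃ i, s i = a) ∧ ∃ j, s j = a'

/-- Same Lascar strong type over `B`: connected by finitely many steps, each of which joins two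
tuples on a `B`-indiscernible sequence. -/
def LascarEquiv (B : Set M.Elt) {ι : Type u} {σ : ι → L.Srt} (a a' : M.Tuple σ) : Prop :=
  Relation.ReflTransGen (OnIndiscernible κ M B) a a'

/-- The space of types over `B` in variables of sorts `σ`. -/
def TypeSpace (B : Set M.Elt) {ι : Type u} (σ : ι → L.Srt) :
    Set (Set (Formula (Sum.elim σ (M.sorts B)))) :=
  Set.range fun a : M.Tuple σ => M.tp B a

/-- The theory of which `M` is a monster model is `μ`-stable. -/
def IsStableIn (μ : Cardinal.{u}) : Prop :=
  ∀ B : Set M.Elt, #B ≤ μ → ∀ (ι : Type u) (σ : ι → L.Srt), Finite ι → #(TypeSpace M B σ) ≤ μ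

/-- The theory of which `M` is a monster model is stable. -/
def IsStable : Prop :=
  ∃ μ : Cardinal.{u}, ℵ₀ ≤ μ ∧ μ < κ ∧ IsStableIn M μ

/-- The set `S(x, b)` of formulas over `C ∪ b` divides over `C`; here `S` is a set of formulas
`φ(x, y)` with parameters in `C`. -/
def Divides (C : Set M.Elt) {ι η : Type u} {σ : ι → L.Srt} {τ : η → L.Srt}
    (S : Set (Formula (Sum.elim (Sum.elim σ τ) (M.sorts C)))) (b : M.Tuple τ) : Prop :=
  ∃ s : ℕ → M.Tuple τ, M.Indiscernible C s ∧ (∀ n, M.EquivOver C (s n) b) ∧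
    ¬ ∃ x : M.Tuple σ, ∀ n, ∀ φ ∈ S, M.Sat φ (M.join (M.join x (s n)) (M.enum C))

/-- Dividing independence of `A` from `B` over `C`: with `a` and `b` enumerating `A` and `B`,
`tp(a/Cb)` does not divide over `C`. -/
def DividingIndep (A C B : Set M.Elt) : Prop :=
  ¬ Divides M C (M.tp C (M.join (M.enum A) (M.enum B))) (M.enum B)

/-- The properties of an independence relation in the characterisation of stable theories.
`Ind A C B` stands for "`A` is independent from `B` over `C`"; only its values at small sets
are relevant. -/
structure IsStableIndep (Ind : Set M.Elt → Set M.Elt → Set M.Elt → Prop) : Prop where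
  invariance : ∀ (e : Aut M) (A B C : Set M.Elt), #A < κ → #B < κ → #C < κ →
    Ind A C B → Ind (e.image A) (e.image C) (e.image B)
  monotonicity : ∀ A B C A' B' : Set M.Elt, #A < κ → #B < κ → #C < κ →
    A' ⊆ A → B' ⊆ B → Ind A C B → Ind A' C B'
  normality : ∀ A B C : Set M.Elt, #A < κ → #B < κ → #C < κ →
    Ind A C B → Ind (C ∪ A) C (C ∪ B)
  existence : ∀ A C : Set M.Elt, #A < κ → #C < κ → Ind A C C
  full_existence : ∀ (A C : Set M.Elt) (η : Type u) (τ : η → L.Srt) (b : M.Tuple τ),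
    #A < κ → #C < κ → #η < κ →
    ∃ b' : M.Tuple τ, M.EquivOver C b' b ∧ Ind A C (M.toSet b')
  base_monotonicity : ∀ A B C C' : Set M.Elt, #A < κ → #B < κ →
    C ⊆ C' → C' ⊆ B → Ind A C B → Ind A C' B
  extension : ∀ (A B C : Set M.Elt) (η : Type u) (τ : η → L.Srt) (d : M.Tuple τ),
    #A < κ → #B < κ → #C < κ → #η < κ → Ind A C B →
    ∃ d' : M.Tuple τ, M.EquivOver (C ∪ B) d' d ∧ Ind A C (B ∪ M.toSet d')
  symmetry : ∀ A B C : Set M.Elt, #A < κ → #B < κ → #C < κ → Ind A C B → Ind B C A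
  transitivity : ∀ A B C C' : Set M.Elt, #A < κ → #B < κ → #C' < κ →
    C ⊆ C' → Ind A C C' → Ind A C' B → Ind A C B
  finite_character : ∀ A B C : Set M.Elt, #A < κ → #B < κ → #C < κ →
    (∀ A' B' : Set M.Elt, A' ⊆ A → B' ⊆ B → A'.Finite → B'.Finite → Ind A' C B') → Ind A C B
  local_character : ∀ μ : Cardinal.{u}, μ < κ → ∃ ν : Cardinal.{u}, ν < κ ∧
    ∀ A C : Set M.Elt, #A < μ → #C < κ → ∃ C' ⊆ C, #C' < ν ∧ Ind A C' C
  stationarity : ∀ C : Set M.Elt, #C < κ →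
    (∀ (ι : Type u) (σ : ι → L.Srt) (a a' : M.Tuple σ), #ι < κ →
      M.EquivOver C a a' → LascarEquiv κ M C a a') →
    ∀ (ι : Type u) (σ : ι → L.Srt) (a a' : M.Tuple σ) (B : Set M.Elt), #ι < κ → #B < κ →
      Ind (M.toSet a) C B → Ind (M.toSet a') C B → M.EquivOver C a a' →
      M.EquivOver (C ∪ B) a a'

end Monster

end PosLogic

/-!
The theorem is about the automorphism group of the monster model `M` more than about formulas.
Writing `E` for the set of elements of `M` and `G` for the group of permutations of `E` induced by
automorphisms, equality of types over a small set `C` is conjugacy under the pointwise stabiliser of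
`C` (`Conj`), so that indiscernible sequences (`Indisc`), dividing (`ND`, `DI`) and Lascar strong
types (`LStep`) are notions about `G` and untyped tuples of elements of `E`. What remains of
positive logic is collected in `Presentation`: few relations of finite arity, preserved by `G`, for
which homogeneity, saturation, thickness and the existence of obstructions (positive closedness)
hold. The main consequences are compactness for closed conditions (`exists_of_closed`), where both
conjugacy and indiscernibility are closed conditions, and the extraction of indiscernible sequences
from long sequences by the Erdős–Rado theorem (`extraction`). The notions of the theorem are
translated at the end of the file.

*Stable theories.* Let `T` be stable. A single instance of dividing over `C`, given by a finite
tuple and a sequence of countable tuples, is recorded up to conjugacy by a `Label`. Counting types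
over the binary sequences of a suitable length shows that a tuple cannot divide many times in the
same way along a chain (`exists_no_chain`): otherwise compactness would give too many types over a
small set. Taking a greedy maximal pattern of instances of dividing inside the type of `a` over `C`,
and realising it over a larger set `D`, gives a realisation of the type that does not divide with
respect to `D` any more (`exists_conj_nd`). So indiscernible sequences of independent tuples exist
(`exists_morley`); by the same bound on chains they detect dividing (`nd_of_seq`), and extension,
symmetry and transitivity follow. Local character comes from chains of maximal length, one for each
label (`exists_localCharacter`). For stationarity, a tuple `b` that is independent from the first
two entries of a `C`-indiscernible sequence cannot tell them apart, since alternation along an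
indiscernible sequence produces too many types (`conj_of_nd_pair`); independent extensions of a
Lascar path then reduce the general case to this one (`conj_of_lascar`).

*Abstract independence relations.* Let `Ind` be a relation with the listed properties. Over a set
`N` in which enough types of countable tuples over small subsets are realised (`Good`), tuples of
the same type have the same Lascar strong type: two long sequences inside `N` can be continued by
either tuple (`exists_lstep`). So stationarity applies over `N`. Given a `C`-indiscernible sequence
starting at `B`, make it indiscernible over such an `N ⊇ C` and move `A` so that it is independent
from `N` together with the sequence: by stationarity over `N` all entries have the same type over
`A`, so that `Ind` implies dividing independence (`IsIndep.di`). Conversely, if the type of `A` over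
`C ∪ B` does not divide over `C`, then `A` may be assumed to have indiscernible over it a long
`Ind`-independent sequence of copies of `B`; by local character `A` is independent from some entry
over `C` and the earlier ones, and transitivity and symmetry give `Ind A C B` (`IsIndep.of_di`).
Finally, by local character and stationarity every type over a suitably closed set is determined by
its restriction to one of few small subsets, so that there are few types and the theory is stable
(`IsIndep.stable`).
-/

namespace PosLogic

/-! ### Transfinite constructions and the Erdős–Rado theorem -/

/-- Recursion along a well-order, where each value is chosen subject to a condition on the earlier
values. -/
theorem exists_wf_seq {X : Type*} {α : Type*} [LinearOrder X] [WellFoundedLT X]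
    (R : ∀ x : X, ({y // y < x} → α) → α → Prop) (h : ∀ x p, ∃ v, R x p v) :
    ∃ t : X → α, ∀ x, R x (fun y => t y.1) (t x) := by
  choose v hv using h
  let t : X → α := WellFounded.fix (C := fun _ => α) (r := (· < ·)) wellFounded_lt
    (fun x ih => v x (fun y => ih y.1 y.2))
  refine ⟨t, fun x => ?_⟩
  have : t x = v x (fun y => t y.1) := WellFounded.fix_eq _ _ _
  rw [this]
  exact hv _ _

theorem mk_iUnion_le_of_le {ι α : Type u} (f : ι → Set α) {c : Cardinal.{u}} (hc : ℵ₀ ≤ c)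
    (hι : #ι ≤ c) (h : ∀ i, #(f i) ≤ c) : #(⋃ i, f i) ≤ c := by
  refine (mk_iUnion_le_sum_mk).trans ?_
  refine (sum_le_sum _ _ h).trans ?_
  rw [sum_const']
  exact mul_le_of_le hc hι le_rfl

theorem mk_union_le_of_le {α : Type u} {s t : Set α} {c : Cardinal.{u}} (hc : ℵ₀ ≤ c)
    (hs : #s ≤ c) (ht : #t ≤ c) : #(s ∪ t : Set α) ≤ c :=
  (mk_union_le s t).trans (add_le_of_le hc hs ht)

/-- Closing off a set under an operation defined on the subsets of size at most `ρ`. -/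
theorem exists_closed {α : Type u} {ρ τ : Cardinal.{u}} (hρ : ℵ₀ ≤ ρ) (hτ : τ ^ ρ ≤ τ)
    (h2 : 2 ≤ τ) (B : Set α) (hB : #B ≤ τ) (Φ : Set α → Set α)
    (hΦ : ∀ A : Set α, #A ≤ ρ → #(Φ A) ≤ τ) :
    ∃ S : Set α, B ⊆ S ∧ #S ≤ τ ∧ ∀ A ⊆ S, #A ≤ ρ → Φ A ⊆ S := by
  -- The operation is iterated along `succ ρ`, whose cofinality exceeds `ρ`.
  have hρτ : ρ < τ := (cantor ρ).trans_le ((power_le_power_right h2).trans hτ)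
  have hτ0 : ℵ₀ ≤ τ := hρ.trans hρτ.le
  let W := (Order.succ ρ).ord.ToType
  have hW : #W ≤ τ := by rw [mk_ord_toType]; exact Order.succ_le_of_lt hρτ
  obtain ⟨N, hN⟩ := exists_wf_seq (X := W) (α := Set α)
    (fun w p v => v = B ∪ ⋃ y, ⋃ A : {A : Set α // A ⊆ p y ∧ #A ≤ ρ}, Φ A.1)
    (fun _ _ => ⟨_, rfl⟩)
  have hmono : ∀ w w', w ≤ w' → N w ⊆ N w' := by
    intro w w' h
    rw [hN w, hN w']
    refine Set.union_subset_union_right _ (Set.iUnion_subset fun y => ?_)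
    exact Set.subset_iUnion (fun y : {y // y < w'} =>
      ⋃ A : {A : Set α // A ⊆ N y.1 ∧ #A ≤ ρ}, Φ A.1) ⟨y.1, y.2.trans_le h⟩
  have hcard : ∀ w, #(N w) ≤ τ := by
    intro w
    induction w using WellFoundedLT.induction with
    | ind w ih =>
      rw [hN w]
      refine mk_union_le_of_le hτ0 hB (mk_iUnion_le_of_le _ hτ0 ((mk_set_le (Set.Iio w)).trans hW)
        fun y => mk_iUnion_le_of_le _ hτ0 ?_ fun A => hΦ _ A.2.2)
      refine (mk_bounded_subset_le (N y.1) ρ).trans ?_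
      exact (power_le_power_right (max_le (ih _ y.2) hτ0)).trans hτ
  have hcof : Order.cof W = Order.succ ρ := by
    rw [Ordinal.cof_toType, (isRegular_succ hρ).cof_ord]
  have hWne : Nonempty W := by
    rw [← mk_ne_zero_iff, mk_ord_toType]
    exact (succ_pos ρ).ne'
  refine ⟨⋃ w, N w, ?_, mk_iUnion_le_of_le _ hτ0 hW hcard, ?_⟩
  · obtain ⟨w⟩ := hWne
    refine Set.Subset.trans ?_ (Set.subset_iUnion _ w)
    rw [hN w]
    exact Set.subset_union_left
  · intro A hA hAρ
    have : ∀ a : A, ∃ w, (a : α) ∈ N w := fun a => Set.mem_iUnion.1 (hA a.2)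
    choose w hw using this
    have hnc : ¬ IsCofinal (Set.range w) := by
      intro hc
      have := (Order.cof_le hc).trans (mk_range_le.trans hAρ)
      rw [hcof] at this
      exact (Order.lt_succ ρ).not_ge this
    simp only [IsCofinal, not_forall, not_exists, not_and, not_le] at hnc
    obtain ⟨v, hv⟩ := hnc
    have hAv : A ⊆ N v := fun a ha => hmono _ _ (hv _ ⟨⟨a, ha⟩, rfl⟩).le (hw ⟨a, ha⟩)
    have hnc' : ¬ IsCofinal ({v} : Set W) := by
      intro hc
      have := Order.cof_le hc
      rw [hcof, mk_singleton] at this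
      exact (one_lt_aleph0.trans_le (hρ.trans (Order.le_succ ρ))).not_ge this
    simp only [IsCofinal, Set.mem_singleton_iff, exists_eq_left, not_forall, not_le] at hnc'
    obtain ⟨v', hv'⟩ := hnc'
    refine Set.Subset.trans ?_ (Set.subset_iUnion _ v')
    rw [hN v']
    refine Set.Subset.trans ?_ Set.subset_union_right
    refine Set.Subset.trans ?_ (Set.subset_iUnion _ (⟨v, hv'⟩ : {y // y < v'}))
    exact Set.subset_iUnion (fun A : {A : Set α // A ⊆ N v ∧ #A ≤ ρ} => Φ A.1) ⟨A, hAv, hAρ⟩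

/-- A colouring of the increasing `(n + 1)`-tuples of a large well-order is, on a large subset,
independent of the last entry, in the sense that the last entry may be replaced by one fixed
element `z`. Here `z` lies outside a set `S` of size at most `2 ^ ρ` that is closed under taking, for
small `A ⊆ S`, the least elements of the classes of elements above `A` with the same colours over
`A`; the subset consists of least elements with the same colours as `z` over the earlier ones. -/
theorem exists_endHomogeneous {X K : Type u} [LinearOrder X] [WellFoundedLT X]
    {ρ : Cardinal.{u}} (hρ : ℵ₀ ≤ ρ) (hK : #K ≤ ρ) (hX : 2 ^ ρ < #X) {n : ℕ}
    (c : (Fin (n + 1) → X) → K) (W : Type u) [LinearOrder W] [WellFoundedLT W] (hW : #W ≤ ρ) :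
    ∃ (y : W → X) (z : X), StrictMono y ∧ ∀ (f : Fin n → W) (w : W), (∀ i, f i < w) →
      c (Fin.snoc (y ∘ f) (y w)) = c (Fin.snoc (y ∘ f) z) := by
  let above (A : Set X) (x : X) : Set X := {x' | (∀ a ∈ A, a < x') ∧
    ∀ f : Fin n → A, c (Fin.snoc (fun i => (f i : X)) x') = c (Fin.snoc (fun i => (f i : X)) x)}
  let Φ (A : Set X) : Set X := {x | ∃ z, IsLeast (above A z) x}
  have h2ρ : (2 ^ ρ) ^ ρ ≤ (2 ^ ρ : Cardinal.{u}) := by rw [← power_mul, mul_eq_self hρ]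
  obtain ⟨S, -, hS, hcl⟩ := exists_closed hρ h2ρ
    ((natCast_lt_aleph0 (n := 2)).le.trans (hρ.trans (cantor ρ).le)) (∅ : Set X) (by simp) Φ (by
      intro A hA
      have hinj : Function.Injective (fun (x : Φ A) (f : Fin n → A) =>
          c (Fin.snoc (fun i => (f i : X)) x.1)) := by
        rintro ⟨x, z, hx⟩ ⟨x', z', hx'⟩ h
        have h1 := fun f => congrFun h f
        simp only at h1
        apply Subtype.ext
        apply le_antisymm
        · exact hx.2 ⟨hx'.1.1, fun f => (h1 f).symm.trans (hx.1.2 f)⟩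
        · exact hx'.2 ⟨hx.1.1, fun f => (h1 f).trans (hx'.1.2 f)⟩
      refine (mk_le_of_injective hinj).trans ?_
      rw [← power_def]
      refine (power_le_power_right hK).trans ?_
      have h1 : #A ^ #(ULift.{u} (Fin n)) ≤ ρ := by
        rw [mk_uLift, mk_fin, lift_natCast]
        exact (power_le_power_right hA).trans (power_nat_le hρ)
      have h3 : #(Fin n → A) ≤ ρ := by
        refine le_trans (le_of_eq ?_) h1
        rw [mk_uLift, mk_fin, lift_natCast]
        simp
      refine ((power_le_power_right (cantor ρ).le).trans (power_le_power_left ?_ h3)).trans h2ρ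
      exact (power_pos _ two_pos).ne')
  obtain ⟨z, hz⟩ : ∃ z, z ∉ S := by
    by_contra! h
    have : S = Set.univ := Set.eq_univ_of_forall h
    rw [this, mk_univ] at hS
    exact hX.not_ge hS
  obtain ⟨y, hy⟩ := exists_wf_seq (X := W) (α := X)
    (fun w p v => (above (Set.range p) z).Nonempty → IsLeast (above (Set.range p) z) v) (by
      intro w p
      by_cases h : (above (Set.range p) z).Nonempty
      · exact ⟨_, fun _ => ⟨wellFounded_lt.min_mem _ h, fun x hx => not_lt.1 (wellFounded_lt.not_lt_min _ hx)⟩⟩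
      · exact ⟨z, fun h' => absurd h' h⟩)
  have key : ∀ w, IsLeast (above (Set.range fun y' : {w' // w' < w} => y y'.1) z) (y w) ∧
      y w ∈ S ∧ y w < z := by
    intro w
    induction w using WellFoundedLT.induction with
    | ind w ih =>
      have hzm : z ∈ above (Set.range fun y' : {w' // w' < w} => y y'.1) z := by
        refine ⟨?_, fun _ => rfl⟩
        rintro _ ⟨w', rfl⟩
        exact (ih _ w'.2).2.2
      have hl := hy w ⟨z, hzm⟩
      have hmem : y w ∈ S := by
        refine hcl (Set.range fun y' : {w' // w' < w} => y y'.1) ?_ ?_ ⟨z, hl⟩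
        · rintro _ ⟨w', rfl⟩
          exact (ih _ w'.2).2.1
        · exact mk_range_le.trans ((mk_set_le (Set.Iio w)).trans hW)
      exact ⟨hl, hmem, lt_of_le_of_ne (hl.2 hzm) (fun h => hz (h ▸ hmem))⟩
  refine ⟨y, z, fun w w' h => (key w').1.1.1 _ ⟨⟨w, h⟩, rfl⟩, fun f w hf => ?_⟩
  exact (key w).1.1.2 (fun i => ⟨y (f i), ⟨⟨f i, hf i⟩, rfl⟩⟩)

/-- The Erdős–Rado theorem, below a strong limit cardinal: after passing to a subset on which the
colouring is independent of the last entry, the length of the tuples drops by one. -/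
theorem erdosRado {lam : Cardinal.{u}} (hlam : lam.IsStrongLimit) (hω : ℵ₀ < lam) {K : Type u}
    (hK : #K < lam) (n : ℕ) :
    ∀ η < lam, ∃ η' < lam, ∀ (X : Type u) [LinearOrder X] [WellFoundedLT X]
      (c : (Fin n → X) → K), η' ≤ #X → ∃ Y : Set X, η ≤ #Y ∧ ∃ q, ∀ f : Fin n → X,
        StrictMono f → (∀ i, f i ∈ Y) → c f = q := by
  induction n with
  | zero =>
    intro η hη
    refine ⟨η, hη, fun X _ _ c hX => ⟨Set.univ, by rwa [mk_univ], c Fin.elim0, fun f _ _ => ?_⟩⟩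
    congr 1
    exact Subsingleton.elim _ _
  | succ n ih =>
    intro η hη
    obtain ⟨η₁, hη₁, hX₁⟩ := ih η hη
    obtain ⟨ρ, hρl, hρ, hKρ, hηρ⟩ : ∃ ρ < lam, ℵ₀ ≤ ρ ∧ #K ≤ ρ ∧ η₁ ≤ ρ :=
      ⟨max ℵ₀ (max (#K) η₁), max_lt hω (max_lt hK hη₁), le_max_left _ _,
        (le_max_left _ _).trans (le_max_right _ _), (le_max_right _ _).trans (le_max_right _ _)⟩
    refine ⟨Order.succ (2 ^ ρ), hlam.isSuccLimit.succ_lt (hlam.isStrongPrelimit hρl),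
      fun X _ _ c hX => ?_⟩
    obtain ⟨y, z, hy, hyz⟩ := exists_endHomogeneous hρ hKρ (Order.succ_le_iff.1 hX) c
      η₁.ord.ToType (by rwa [mk_ord_toType])
    obtain ⟨Y, hY, q, hq⟩ := hX₁ η₁.ord.ToType (fun f => c (Fin.snoc (y ∘ f) z))
      (by rw [mk_ord_toType])
    refine ⟨y '' Y, by rwa [mk_image_eq hy.injective], q, fun f hf hfY => ?_⟩
    choose g hgY hg using hfY
    have hgm : StrictMono g := fun i j hij => by
      rw [← hy.lt_iff_lt, hg, hg]
      exact hf hij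
    have hfg : f = Fin.snoc (y ∘ (g ∘ Fin.castSucc)) (y (g (Fin.last n))) := by
      funext i
      refine Fin.lastCases ?_ (fun i => ?_) i
      · simp [hg]
      · simp [hg]
    rw [hfg, hyz (g ∘ Fin.castSucc) _ (fun i => hgm (Fin.castSucc_lt_last i))]
    exact hq _ (fun i j hij => hgm (by simpa using hij)) (fun i => hgY _)

/-- A sequence of colourings, one for each length of tuples, has large subsets that are
homogeneous for the first `n` of them, with the same colours for all `n`. -/
theorem erdosRado_coherent {lam : Cardinal.{u}} (hlam : lam.IsStrongLimit) (hω : ℵ₀ < lam)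
    {K : Type u} (hK : #K < lam) (hcof : #K < lam.ord.cof) {X : Type u} [LinearOrder X]
    [WellFoundedLT X] (hX : lam ≤ #X) (c : ∀ n, (Fin n → X) → K) :
    ∃ q : ℕ → K, ∀ n, ∃ Y : Set X, ℵ₀ ≤ #Y ∧ ∀ m < n, ∀ f : Fin m → X, StrictMono f →
      (∀ i, f i ∈ Y) → c m f = q m := by
  -- The colours `q 0, …, q (n - 1)` are attained on homogeneous sets of any size below `lam`.
  let P (n : ℕ) (q : ℕ → K) : Prop := ∀ η < lam, ∃ Y : Set X, η ≤ #Y ∧ ∀ m < n,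
    ∀ f : Fin m → X, StrictMono f → (∀ i, f i ∈ Y) → c m f = q m
  have step : ∀ n q, P n q → ∃ k, P (n + 1) (Function.update q n k) := by
    intro n q hP
    -- If every colour failed for length `n`, one size would exceed all sizes of failure, because there
    -- are fewer colours than the cofinality of `lam`.
    by_contra! hbad
    have : ∀ k, ∃ η < lam, ¬ ∃ Y : Set X, η ≤ #Y ∧ ∀ m < n + 1,
        ∀ f : Fin m → X, StrictMono f → (∀ i, f i ∈ Y) → c m f = Function.update q n k m := by
      intro k
      have := hbad k
      simp only [P, not_forall] at this
      obtain ⟨η, h1, h2⟩ := this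
      exact ⟨η, h1, h2⟩
    choose ηk hηk hno using this
    have hsup : (⨆ k, ηk k) < lam := iSup_lt_of_lt_cof_ord hcof hηk
    obtain ⟨η', hη', her⟩ := erdosRado hlam hω hK n _ hsup
    obtain ⟨Y, hY, hYq⟩ := hP η' hη'
    obtain ⟨Z, hZ, k, hk⟩ := her Y (fun f => c n (fun i => (f i : X))) hY
    refine hno k ⟨Subtype.val '' Z, ?_, fun m hm f hf hfZ => ?_⟩
    · rw [mk_image_eq Subtype.val_injective]
      exact (le_ciSup bddAbove_of_small k).trans hZ
    · choose g hgZ hg using hfZ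
      have hgm : StrictMono g := fun i j hij => by
        rw [← Subtype.coe_lt_coe, hg, hg]
        exact hf hij
      rcases (Nat.lt_succ_iff_lt_or_eq.1 hm) with hm | rfl
      · rw [Function.update_of_ne hm.ne]
        exact hYq m hm f hf (fun i => by rw [← hg i]; exact (g i).2)
      · rw [Function.update_self, ← hk g hgm hgZ]
        congr 1
        funext i
        exact (hg i).symm
  have : Nonempty K := ⟨c 0 Fin.elim0⟩
  choose! k hk using step
  let Q : ℕ → ℕ → K := fun n => Nat.rec (fun _ => c 0 Fin.elim0)
    (fun n q => Function.update q n (k n q)) n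
  have hQ : ∀ n, P n (Q n) := by
    intro n
    induction n with
    | zero => exact fun η hη => ⟨Set.univ, by rw [mk_univ]; exact hη.le.trans hX, by simp⟩
    | succ n ih => exact hk n _ ih
  have hstab : ∀ n m, m < n → Q n m = Q (m + 1) m := by
    intro n m hmn
    induction n, hmn using Nat.le_induction with
    | base => rfl
    | succ n hn ih =>
      rw [← ih]
      exact Function.update_of_ne (Nat.lt_of_succ_le hn).ne _ _
  refine ⟨fun m => Q (m + 1) m, fun n => ?_⟩
  obtain ⟨Y, hY, h⟩ := hQ n _ hω
  exact ⟨Y, hY, fun m hm f hf hfY => by rw [h m hm f hf hfY, hstab n m hm]⟩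

/-- Below an inaccessible cardinal there are strong limit cardinals of large cofinality, namely
values of the beth function at successor cardinals. -/
theorem exists_isStrongLimit_lt {κ : Cardinal.{u}} (hκ : κ.IsInaccessible) {θ : Cardinal.{u}}
    (hθ : θ < κ) : ∃ lam < κ, lam.IsStrongLimit ∧ ℵ₀ < lam ∧ θ < lam ∧ θ < lam.ord.cof := by
  let ρ := max ℵ₀ θ
  have hρ : ρ < κ := max_lt hκ.aleph0_lt hθ
  have hs : Order.succ ρ < κ := hκ.isSuccLimit.succ_lt hρ
  have hreg : (Order.succ ρ).IsRegular := isRegular_succ (le_max_left _ _)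
  have hlim : Order.IsSuccLimit (Order.succ ρ).ord := isSuccLimit_ord hreg.1
  have hl : Order.succ ρ ≤ ℶ_ (Order.succ ρ).ord := le_beth_ord _
  have hθ' : θ < Order.succ ρ := Order.lt_succ_of_le (le_max_right _ _)
  refine ⟨ℶ_ (Order.succ ρ).ord, ?_, isStrongLimit_beth.2 hlim.isSuccPrelimit,
    (Order.lt_succ_of_le (le_max_left _ _)).trans_le hl, hθ'.trans_le hl, ?_⟩
  · rw [← hκ.beth_ord, beth_lt_beth]
    exact ord_lt_ord.2 hs
  · rw [Ordinal.cof_map_of_isNormal (f := fun o => (ℶ_ o).ord)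
      (isNormal_ord.comp isNormal_beth) hlim, hreg.cof_ord]
    exact hθ'

theorem mk_arrow_bool (W : Type u) : #(W → Bool) = 2 ^ #W := by
  rw [mk_arrow, mk_bool, lift_ofNat, lift_uzero]

/-- There is a linear order with more than `μ` elements and an order-dense subset of size at most
`μ`. It consists of the binary sequences of the least length `χ` with `μ < 2 ^ χ`. -/
theorem exists_dense_order {μ : Cardinal.{u}} (hμ : ℵ₀ ≤ μ) :
    ∃ (I : Type u) (_ : LinearOrder I) (J : Set I), #J ≤ μ ∧ μ < #I ∧ #I ≤ 2 ^ μ ∧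
      ∀ i i' : I, i < i' → ∃ j ∈ J, i < j ∧ j ≤ i' := by
  classical
  have hne : {χ : Cardinal.{u} | μ < 2 ^ χ}.Nonempty := ⟨μ, cantor μ⟩
  obtain ⟨χ, hχdef⟩ : ∃ χ, χ = sInf {χ : Cardinal.{u} | μ < 2 ^ χ} := ⟨_, rfl⟩
  have hχ : μ < 2 ^ χ := by rw [hχdef]; exact csInf_mem hne
  have hχμ : χ ≤ μ := by rw [hχdef]; exact csInf_le' (cantor μ)
  have hmin : ∀ ν < χ, 2 ^ ν ≤ μ := fun ν hν => not_lt.1 fun h => by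
    rw [hχdef] at hν
    exact hν.not_ge (csInf_le' h)
  let W := χ.ord.ToType
  have hW : #W = χ := mk_ord_toType χ
  have hI : #(Lex (W → Bool)) = 2 ^ χ := by
    have : #(Lex (W → Bool)) = #(W → Bool) := rfl
    rw [this, mk_arrow_bool, hW]
  have hlt : ∀ i i' : W → Bool, toLex i < toLex i' ↔
      ∃ w, (∀ v < w, i v = i' v) ∧ i w = false ∧ i' w = true := by
    intro i i'
    refine Iff.trans Iff.rfl (exists_congr fun w => and_congr_right fun _ => ?_)
    exact Bool.lt_iff
  let Jw (w : W) : Set (Lex (W → Bool)) := {j | ∀ w', w < w' → ofLex j w' = false}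
  refine ⟨Lex (W → Bool), inferInstance, ⋃ w, Jw w, ?_, by rwa [hI],
    by rw [hI]; exact power_le_power_left two_ne_zero hχμ, ?_⟩
  · refine mk_iUnion_le_of_le _ hμ (hW.trans_le hχμ) fun w => ?_
    have hinj : Function.Injective (fun (j : Jw w) (w' : Set.Iic w) => ofLex j.1 w'.1) := by
      rintro ⟨j, hj⟩ ⟨j', hj'⟩ h
      apply Subtype.ext
      apply ofLex.injective
      funext w'
      rcases le_or_gt w' w with h' | h'
      · exact congrFun h ⟨w', h'⟩
      · rw [hj _ h', hj' _ h']
    refine (mk_le_of_injective hinj).trans ?_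
    rw [mk_arrow_bool]
    have hIic : Set.Iic w = insert w (Set.Iio w) := Set.Iio_insert.symm
    have h1 : #(Set.Iic w) ≤ #(Set.Iio w) + 1 := by rw [hIic]; exact mk_insert_le
    refine (power_le_power_left two_ne_zero h1).trans ?_
    rw [power_add, power_one]
    exact mul_le_of_le hμ (hmin _ ((mk_Iio_lt w (by simp [W])).trans_eq hW))
      ((natCast_lt_aleph0 (n := 2)).le.trans hμ)
  · intro i i' h
    obtain ⟨w, hw, hi, hi'⟩ := (hlt (ofLex i) (ofLex i')).1 h
    let j : W → Bool := fun w' => if w' ≤ w then ofLex i' w' else false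
    refine ⟨toLex j, Set.mem_iUnion.2 ⟨w, fun w' h => if_neg h.not_ge⟩,
      (hlt (ofLex i) j).2 ⟨w, fun v hv => ?_, hi, ?_⟩, le_of_not_gt fun hcon => ?_⟩
    · rw [hw v hv]
      exact (if_pos hv.le).symm
    · exact (if_pos le_rfl).trans hi'
    · obtain ⟨v, -, hv, hv'⟩ := (hlt (ofLex i') j).1 hcon
      by_cases hvw : v ≤ w
      · have : j v = ofLex i' v := if_pos hvw
        rw [hv', hv] at this
        exact Bool.noConfusion this
      · have : j v = false := if_neg hvw
        rw [hv'] at this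
        exact Bool.noConfusion this

/-! ### Conjugacy and indiscernible sequences -/

section Group

variable {E : Type u} {ι η : Type*}

/-- The tuples `a` and `b` are conjugate under the elements of `G` that fix `C` pointwise. For the
automorphism group of a monster model, and small tuples and sets, this is equality of the types
over `C`. -/
def Conj (G : Subgroup (Equiv.Perm E)) (C : Set E) (a b : ι → E) : Prop :=
  ∃ g ∈ G, (∀ c ∈ C, g c = c) ∧ ∀ i, g (a i) = b i

/-- A sequence of tuples, as one long tuple. -/
abbrev flat {I : Type*} (s : I → ι → E) : I × ι → E := fun p => s p.1 p.2

/-- The sequences `s` and `t` have the same finite increasing subsequences, up to conjugacy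
over `C`. -/
def SameEM (G : Subgroup (Equiv.Perm E)) (C : Set E) {I J : Type*} [LinearOrder I] [LinearOrder J]
    (s : I → ι → E) (t : J → ι → E) : Prop :=
  ∀ (n : ℕ) (f : Fin n → I) (g : Fin n → J), StrictMono f → StrictMono g →
    Conj G C (flat fun k => s (f k)) (flat fun k => t (g k))

/-- Indiscernible sequences over `C`. -/
def Indisc (G : Subgroup (Equiv.Perm E)) (C : Set E) {I : Type*} [LinearOrder I]
    (s : I → ι → E) : Prop :=
  SameEM G C s s

variable {G : Subgroup (Equiv.Perm E)} {C D : Set E}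

theorem Conj.refl (a : ι → E) : Conj G C a a :=
  ⟨1, G.one_mem, fun _ _ => rfl, fun _ => rfl⟩

theorem Conj.symm {a b : ι → E} (h : Conj G C a b) : Conj G C b a := by
  obtain ⟨g, hg, hC, h⟩ := h
  refine ⟨g⁻¹, G.inv_mem hg, fun c hc => ?_, fun i => ?_⟩
  · rw [Equiv.Perm.inv_eq_iff_eq, hC c hc]
  · rw [Equiv.Perm.inv_eq_iff_eq, h]

theorem Conj.trans {a b c : ι → E} (h : Conj G C a b) (h' : Conj G C b c) : Conj G C a c := by
  obtain ⟨g, hg, hC, h⟩ := h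
  obtain ⟨g', hg', hC', h'⟩ := h'
  refine ⟨g' * g, G.mul_mem hg' hg, fun c hc => ?_, fun i => ?_⟩
  · rw [Equiv.Perm.mul_apply, hC c hc, hC' c hc]
  · rw [Equiv.Perm.mul_apply, h, h']

theorem Conj.comp {a b : ι → E} (h : Conj G C a b) (f : η → ι) :
    Conj G C (fun i => a (f i)) (fun i => b (f i)) := by
  obtain ⟨g, hg, hC, h⟩ := h
  exact ⟨g, hg, hC, fun i => h _⟩

theorem Conj.mono {a b : ι → E} (h : Conj G C a b) (hD : D ⊆ C) : Conj G D a b := by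
  obtain ⟨g, hg, hC, h⟩ := h
  exact ⟨g, hg, fun c hc => hC c (hD hc), h⟩

/-- Any tuple may be added to one side of a pair of conjugate tuples. -/
theorem Conj.exists_extend {a b : ι → E} (h : Conj G C a b) (d : η → E) :
    ∃ d' : η → E, Conj G C (Sum.elim a d) (Sum.elim b d') := by
  obtain ⟨g, hg, hC, h⟩ := h
  refine ⟨fun j => g (d j), g, hg, hC, ?_⟩
  rintro (i | j)
  · exact h i
  · rfl

theorem Conj.inl {a b : ι → E} {a' b' : η → E} (h : Conj G C (Sum.elim a a') (Sum.elim b b')) :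
    Conj G C a b := h.comp Sum.inl

theorem Conj.inr {a b : ι → E} {a' b' : η → E} (h : Conj G C (Sum.elim a a') (Sum.elim b b')) :
    Conj G C a' b' := h.comp Sum.inr

theorem conj_sum_iff {a b : ι → E} {d : η → E} :
    Conj G C (Sum.elim a d) (Sum.elim b d) ↔ Conj G (C ∪ Set.range d) a b := by
  constructor
  · rintro ⟨g, hg, hC, h⟩
    refine ⟨g, hg, ?_, fun i => h (Sum.inl i)⟩
    rintro c (hc | ⟨j, rfl⟩)
    · exact hC c hc
    · exact h (Sum.inr j)
  · rintro ⟨g, hg, hC, h⟩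
    refine ⟨g, hg, fun c hc => hC c (Or.inl hc), ?_⟩
    rintro (i | j)
    · exact h i
    · exact hC _ (Or.inr ⟨j, rfl⟩)

theorem conj_sum_iff' {a b : ι → E} {d : η → E} :
    Conj G C (Sum.elim d a) (Sum.elim d b) ↔ Conj G (C ∪ Set.range d) a b := by
  rw [← conj_sum_iff]
  constructor
  · intro h
    have := h.comp (Sum.swap : ι ⊕ η → η ⊕ ι)
    convert this using 2 <;> · rename_i x; rcases x <;> rfl
  · intro h
    have := h.comp (Sum.swap : η ⊕ ι → ι ⊕ η)
    convert this using 2 <;> · rename_i x; rcases x <;> rfl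

/-- Conjugate sets of parameters impose corresponding conditions. -/
theorem Conj.smul {a b : ι → E} (h : Conj G C a b) {g : Equiv.Perm E} (hg : g ∈ G) :
    Conj G (g '' C) (fun i => g (a i)) (fun i => g (b i)) := by
  obtain ⟨k, hk, hC, h⟩ := h
  refine ⟨g * k * g⁻¹, G.mul_mem (G.mul_mem hg hk) (G.inv_mem hg), ?_, fun i => ?_⟩
  · rintro _ ⟨c, hc, rfl⟩
    simp [hC c hc]
  · simp [h]

section Seq

variable {I J : Type*} [LinearOrder I] [LinearOrder J]

theorem SameEM.symm {s : I → ι → E} {t : J → ι → E} (h : SameEM G C s t) : SameEM G C t s :=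
  fun n f g hf hg => (h n g f hg hf).symm

theorem SameEM.mono {s : I → ι → E} {t : J → ι → E} (h : SameEM G C s t) (hD : D ⊆ C) :
    SameEM G D s t :=
  fun n f g hf hg => (h n f g hf hg).mono hD

theorem SameEM.comp {s : I → ι → E} {t : J → ι → E} (h : SameEM G C s t) (e : η → ι) :
    SameEM G C (fun i j => s i (e j)) (fun i j => t i (e j)) :=
  fun n f g hf hg => (h n f g hf hg).comp (fun p : Fin n × η => (p.1, e p.2))

theorem Indisc.mono {s : I → ι → E} (h : Indisc G C s) (hD : D ⊆ C) : Indisc G D s :=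
  SameEM.mono h hD

theorem Indisc.comp {s : I → ι → E} (h : Indisc G C s) (e : η → ι) :
    Indisc G C (fun i j => s i (e j)) :=
  SameEM.comp h e

theorem Indisc.reindex {s : I → ι → E} (h : Indisc G C s) {e : J → I} (he : StrictMono e) :
    Indisc G C (fun j => s (e j)) :=
  fun n f g hf hg => h n (fun k => e (f k)) (fun k => e (g k)) (he.comp hf) (he.comp hg)

theorem Indisc.conj {s : I → ι → E} (h : Indisc G C s) (i j : I) : Conj G C (s i) (s j) :=
  (h 1 (fun _ => i) (fun _ => j) (Subsingleton.strictMono _) (Subsingleton.strictMono _)).comp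
    (fun k => ((0 : Fin 1), k))

theorem Indisc.smul {s : I → ι → E} (h : Indisc G C s) {g : Equiv.Perm E} (hg : g ∈ G) :
    Indisc G (g '' C) (fun i j => g (s i j)) :=
  fun n f f' hf hf' => (h n f f' hf hf').smul hg

theorem Indisc.smul_fix {s : I → ι → E} (h : Indisc G C s) {g : Equiv.Perm E} (hg : g ∈ G)
    (hC : ∀ c ∈ C, g c = c) : Indisc G C (fun i j => g (s i j)) := by
  have := h.smul hg
  rwa [Set.EqOn.image_eq (f₂ := id) (fun c hc => hC c hc), Set.image_id] at this

/-- A sequence is indiscernible over `C` if and only if the sequence of its entries, with `C`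
attached to each of them, is indiscernible over the empty set. -/
theorem indisc_sum_iff {s : I → ι → E} {c : η → E} :
    Indisc G C (fun i => Sum.elim (s i) c) ↔ Indisc G (C ∪ Set.range c) s := by
  constructor
  · intro h n f g hf hg
    rcases n with _ | n
    · exact ⟨1, G.one_mem, fun _ _ => rfl, fun p => p.1.elim0⟩
    · obtain ⟨k, hk, hC, h⟩ := h _ f g hf hg
      refine ⟨k, hk, ?_, fun p => h (p.1, Sum.inl p.2)⟩
      rintro x (hx | ⟨j, rfl⟩)
      · exact hC x hx
      · exact h (0, Sum.inr j)
  · intro h n f g hf hg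
    obtain ⟨k, hk, hC, h⟩ := h _ f g hf hg
    refine ⟨k, hk, fun x hx => hC x (Or.inl hx), ?_⟩
    rintro ⟨p, i | j⟩
    · exact h (p, i)
    · exact hC _ (Or.inr ⟨j, rfl⟩)

theorem SameEM.trans {K : Type*} [LinearOrder K] [Infinite J] {s : I → ι → E} {t : J → ι → E}
    {r : K → ι → E} (h : SameEM G C s t) (h' : SameEM G C t r) : SameEM G C s r := by
  intro n f g hf hg
  obtain ⟨S, hS⟩ := Infinite.exists_subset_card_eq J n
  let e := S.orderEmbOfFin hS
  exact (h n f e hf e.strictMono).trans (h' n e g e.strictMono hg)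

end Seq

end Group

/-- A presentation of the permutation group `G`, as the automorphism group of a `κ`-monster model:
a family of relations of finite arity that is preserved by `G`. The relations play the role of the
positive formulas, and `srt` that of the sorts. -/
structure Presentation {E : Type u} (G : Subgroup (Equiv.Perm E)) (κ : Cardinal.{u}) where
  /-- The formulas. -/
  F : Type u
  /-- The number of free variables. -/
  ar : F → ℕ
  /-- Satisfaction. -/
  holds : ∀ φ, (Fin (ar φ) → E) → Prop
  /-- The type of sorts. -/
  S : Type u
  /-- The sort of an element. -/
  srt : E → S
  inacc : κ.IsInaccessible
  card_F : #F < κ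
  holds_smul : ∀ g ∈ G, ∀ φ a, holds φ a → holds φ (fun i => g (a i))
  srt_smul : ∀ g ∈ G, ∀ x, srt (g x) = srt x
  /-- Homogeneity. -/
  hom : ∀ (ι : Type u) (a b : ι → E), #ι < κ →
    (∀ φ (f : Fin (ar φ) → ι), holds φ (fun i => a (f i)) ↔ holds φ (fun i => b (f i))) →
    ∃ g ∈ G, ∀ i, g (a i) = b i
  /-- Positive closedness: the failure of a formula is witnessed by another formula that contradicts
  it. -/
  obstruct : ∀ φ a, ¬ holds φ a → ∃ (ψ : F) (f : Fin (ar ψ) → Fin (ar φ)),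
    holds ψ (fun i => a (f i)) ∧ ∀ b, holds φ b → ¬ holds ψ (fun i => b (f i))
  /-- Saturation. -/
  compact : ∀ (ι : Type u), #ι < κ → ∀ S : Set (Σ φ : F, (Fin (ar φ) → ι ⊕ E)), #S < κ →
    (∀ S₀ ⊆ S, S₀.Finite → ∃ a : ι → E, ∀ p ∈ S₀, holds p.1 fun k => Sum.elim a id (p.2 k)) →
    ∃ a : ι → E, ∀ p ∈ S, holds p.1 fun k => Sum.elim a id (p.2 k)
  /-- Thickness: a set of formulas defines the indiscernible sequences of tuples of given sorts, the
  latter being those of a tuple `s₀`. -/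
  thick : ∀ (ι : Type u), #ι < κ → ∀ s₀ : ι → E, ∃ Θ : Set (Σ φ : F, (Fin (ar φ) → ℕ × ι)),
    ∀ s : ℕ → ι → E, (∀ p ∈ Θ, holds p.1 fun k => flat s (p.2 k)) ↔
      (Indisc G ∅ s ∧ ∀ i, srt (s 0 i) = srt (s₀ i))

namespace Presentation

variable {E : Type u} {G : Subgroup (Equiv.Perm E)} {κ : Cardinal.{u}} (U : Presentation G κ)
include U

/-! ### Types and compactness -/

theorem aleph0_lt : ℵ₀ < κ := U.inacc.aleph0_lt

theorem max_lt' {a b : Cardinal.{u}} (ha : a < κ) (hb : b < κ) : max ℵ₀ (max a b) < κ :=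
  max_lt U.aleph0_lt (max_lt ha hb)

theorem mk_sum_lt {α β : Type u} (hα : #α < κ) (hβ : #β < κ) : #(α ⊕ β) < κ := by
  rw [mk_sum, lift_id, lift_id]
  exact add_lt_of_lt U.aleph0_lt.le hα hβ

theorem mk_union_lt {s t : Set E} (hs : #s < κ) (ht : #t < κ) : #(s ∪ t : Set E) < κ :=
  (mk_union_le s t).trans_lt (add_lt_of_lt U.aleph0_lt.le hs ht)

omit U in
theorem mk_range_lt {ι : Type u} (hι : #ι < κ) (a : ι → E) : #(Set.range a) < κ :=
  mk_range_le.trans_lt hι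

theorem mk_sigma_lt {α : Type u} {β : α → Type u} (hα : #α < κ) (hβ : ∀ a, #(β a) < κ) :
    #(Σ a, β a) < κ := by
  rw [mk_sigma]
  exact sum_lt_of_isRegular U.inacc.isRegular hα hβ

theorem mk_prod_lt {α β : Type u} (hα : #α < κ) (hβ : #β < κ) : #(α × β) < κ := by
  rw [mk_prod, lift_id, lift_id]
  exact mul_lt_of_lt U.aleph0_lt.le hα hβ

theorem mk_nat_prod_lt {β : Type u} (hβ : #β < κ) : #(ℕ × β) < κ := by
  rw [mk_prod, mk_nat, lift_aleph0, lift_uzero]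
  exact mul_lt_of_lt U.aleph0_lt.le U.aleph0_lt hβ

theorem mk_fin_prod_lt {β : Type u} (n : ℕ) (hβ : #β < κ) : #(Fin n × β) < κ := by
  rw [mk_prod, mk_fin, lift_natCast, lift_uzero]
  exact mul_lt_of_lt U.aleph0_lt.le (U.inacc.nat_lt n) hβ

theorem mk_finset_lt {α : Type u} (hα : #α < κ) : #(Finset α) < κ := by
  classical
  exact (mk_le_of_surjective List.toFinset_surjective).trans_lt
    ((mk_list_le_max α).trans_lt (max_lt U.aleph0_lt hα))

theorem two_power_lt {σ : Cardinal.{u}} (hσ : σ < κ) : 2 ^ σ < κ :=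
  U.inacc.isStrongPrelimit hσ

/-- The formulas with variables replaced by elements of `W`. -/
abbrev Inst (W : Type u) : Type u := Σ φ : U.F, (Fin (U.ar φ) → W)

theorem mk_inst_le (W : Type u) : #(U.Inst W) ≤ max ℵ₀ (max #U.F #W) := by
  rw [mk_sigma]
  have hb : ∀ φ : U.F, #(Fin (U.ar φ) → W) ≤ max ℵ₀ (max #U.F #W) := by
    intro φ
    rw [mk_arrow, mk_fin, lift_natCast, lift_uzero]
    refine (power_le_power_right (c := ((U.ar φ : ℕ) : Cardinal.{u}))
      ((le_max_right _ _).trans (le_max_right ℵ₀ (max #U.F #W)))).trans ?_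
    exact power_nat_le (le_max_left _ _)
  refine (sum_le_sum _ _ hb).trans ?_
  rw [sum_const']
  exact mul_le_of_le (le_max_left _ _) ((le_max_left _ _).trans (le_max_right _ _)) le_rfl

theorem mk_inst_lt {W : Type u} (hW : #W < κ) : #(U.Inst W) < κ :=
  (U.mk_inst_le W).trans_lt (U.max_lt' U.card_F hW)

theorem holds_iff {g : Equiv.Perm E} (hg : g ∈ G) (φ : U.F) (a : Fin (U.ar φ) → E) :
    U.holds φ (fun i => g (a i)) ↔ U.holds φ a := by
  refine ⟨fun h => ?_, U.holds_smul g hg φ a⟩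
  have := U.holds_smul _ (G.inv_mem hg) φ _ h
  simpa using this

/-- The type of a tuple over `C`. -/
def tpOver (C : Set E) {ι : Type u} (a : ι → E) : Set (U.Inst (ι ⊕ C)) :=
  {p | U.holds p.1 fun k => Sum.elim a Subtype.val (p.2 k)}

/-- Types over small sets are maximal: one inclusion between the types of small tuples makes the
tuples conjugate. -/
theorem conj_of_tpOver_subset {C : Set E} {ι : Type u} {a b : ι → E} (hC : #C < κ) (hι : #ι < κ)
    (h : U.tpOver C a ⊆ U.tpOver C b) : Conj G C a b := by
  obtain ⟨g, hg, h⟩ := U.hom (ι ⊕ C) (Sum.elim a Subtype.val) (Sum.elim b Subtype.val)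
    (U.mk_sum_lt hι hC) (by
      intro φ f
      refine ⟨fun h' => h (a := ⟨φ, f⟩) h', fun hb => ?_⟩
      by_contra ha
      obtain ⟨ψ, e, hψ, hno⟩ := U.obstruct φ _ ha
      exact hno _ hb (h (a := ⟨ψ, fun k => f (e k)⟩) hψ))
  exact ⟨g, hg, fun c hc => h (Sum.inr ⟨c, hc⟩), fun i => h (Sum.inl i)⟩

theorem tpOver_eq_of_conj {C : Set E} {ι : Type u} {a b : ι → E} (h : Conj G C a b) :
    U.tpOver C a = U.tpOver C b := by
  obtain ⟨g, hg, hC, h⟩ := h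
  ext ⟨φ, f⟩
  have : (fun k => Sum.elim b (Subtype.val : C → E) (f k)) =
      fun k => g (Sum.elim a Subtype.val (f k)) := by
    funext k
    rcases f k with i | c
    · exact (h i).symm
    · exact (hC c c.2).symm
  change U.holds φ _ ↔ U.holds φ (fun k => Sum.elim b (Subtype.val : C → E) (f k))
  rw [this, U.holds_iff hg]

theorem conj_iff_tpOver {C : Set E} {ι : Type u} {a b : ι → E} (hC : #C < κ) (hι : #ι < κ) :
    Conj G C a b ↔ U.tpOver C a = U.tpOver C b :=
  ⟨U.tpOver_eq_of_conj, fun h => U.conj_of_tpOver_subset hC hι h.subset⟩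

theorem srt_eq_of_conj {C : Set E} {ι : Type*} {a b : ι → E} (h : Conj G C a b) (i : ι) :
    U.srt (a i) = U.srt (b i) := by
  obtain ⟨g, hg, -, h⟩ := h
  rw [← h i, U.srt_smul g hg]

/-- Conjugacy has finite character. -/
theorem conj_of_finite {C : Set E} {ι : Type u} {a b : ι → E} (hC : #C < κ) (hι : #ι < κ)
    (h : ∀ F : Set ι, F.Finite → ∀ C₀ ⊆ C, C₀.Finite →
      Conj G C₀ (fun i : F => a i) (fun i : F => b i)) : Conj G C a b := by
  refine U.conj_of_tpOver_subset hC hι ?_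
  rintro ⟨φ, f⟩ hf
  have hF : {i | ∃ k, f k = Sum.inl i}.Finite := by
    refine (Set.finite_range f).preimage (f := Sum.inl) Sum.inl_injective.injOn |>.subset ?_
    rintro i ⟨k, hk⟩
    exact ⟨k, hk⟩
  have hC₀ : {c : C | ∃ k, f k = Sum.inr c}.Finite := by
    refine (Set.finite_range f).preimage (f := Sum.inr) Sum.inr_injective.injOn |>.subset ?_
    rintro i ⟨k, hk⟩
    exact ⟨k, hk⟩
  obtain ⟨g, hg, hgC, hga⟩ := h _ hF (Subtype.val '' {c : C | ∃ k, f k = Sum.inr c})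
    (by rintro _ ⟨c, -, rfl⟩; exact c.2) (hC₀.image _)
  have : (fun k => Sum.elim b (Subtype.val : C → E) (f k)) =
      fun k => g (Sum.elim a Subtype.val (f k)) := by
    funext k
    rcases hk : f k with i | c
    · exact (hga ⟨i, k, hk⟩).symm
    · exact (hgC c ⟨c, ⟨k, hk⟩, rfl⟩).symm
  change U.holds φ (fun k => Sum.elim b (Subtype.val : C → E) (f k))
  rw [this, U.holds_iff hg]
  exact hf

/-- The sets of tuples that are defined by small sets of formulas with parameters. -/
def Closed {V : Type u} (P : (V → E) → Prop) : Prop :=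
  ∃ S : Set (U.Inst (V ⊕ E)), #S < κ ∧
    ∀ x, P x ↔ ∀ p ∈ S, U.holds p.1 fun k => Sum.elim x id (p.2 k)

/-- Compactness: a small family of closed conditions with the finite intersection property has a
common solution. -/
theorem exists_of_closed {V J : Type u} (hV : #V < κ) (hJ : #J < κ) {P : J → (V → E) → Prop}
    (hP : ∀ j, U.Closed (P j)) (hfip : ∀ J₀ : Finset J, ∃ x, ∀ j ∈ J₀, P j x) :
    ∃ x, ∀ j, P j x := by
  classical
  choose S hS hSP using hP
  obtain ⟨x, hx⟩ := U.compact V hV (⋃ j, S j)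
    (mk_iUnion_le_sum_mk.trans_lt (sum_lt_of_isRegular U.inacc.isRegular hJ hS)) (by
      intro S₀ hS₀ hfin
      have : ∀ p : S₀, ∃ j, (p : U.Inst (V ⊕ E)) ∈ S j := fun p => Set.mem_iUnion.1 (hS₀ p.2)
      choose j hj using this
      have := hfin.to_subtype
      have := Fintype.ofFinite S₀
      obtain ⟨x, hx⟩ := hfip (Finset.univ.image j)
      exact ⟨x, fun p hp => (hSP _ x).1
        (hx (j ⟨p, hp⟩) (Finset.mem_image_of_mem _ (Finset.mem_univ _))) p (hj ⟨p, hp⟩)⟩)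
  exact ⟨x, fun j => (hSP j x).2 fun p hp => hx p (Set.mem_iUnion.2 ⟨j, hp⟩)⟩

/-- Conjugacy with a given tuple, over a small set, is a closed condition. -/
theorem closed_conj {V : Type u} {C : Set E} {ι : Type u} (hC : #C < κ) (hι : #ι < κ) (a : ι → E)
    {t : (V → E) → ι → E} (f : ι → V ⊕ E) (hf : ∀ x i, t x i = Sum.elim x id (f i)) :
    U.Closed (fun x => Conj G C (t x) a) := by
  let e : ι ⊕ C → V ⊕ E := Sum.elim f fun c => Sum.inr c
  have he : ∀ x w, Sum.elim x id (e w) = Sum.elim (t x) Subtype.val w := by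
    rintro x (i | c)
    · exact (hf x i).symm
    · rfl
  refine ⟨(fun p : U.Inst (ι ⊕ C) => (⟨p.1, fun k => e (p.2 k)⟩ : U.Inst (V ⊕ E))) ''
    U.tpOver C a, mk_image_le.trans_lt ((mk_set_le _).trans_lt (U.mk_inst_lt (U.mk_sum_lt hι hC))),
    fun x => ?_⟩
  rw [Set.forall_mem_image]
  simp only [he]
  constructor
  · intro h p hp
    rw [← U.tpOver_eq_of_conj h] at hp
    exact hp
  · intro h
    exact (U.conj_of_tpOver_subset hC hι fun p hp => h hp).symm

/-- By thickness, being an indiscernible sequence over a small set is a closed condition. -/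
theorem closed_indisc {V : Type u} {C : Set E} {ι : Type u} (hC : #C < κ) (hι : #ι < κ)
    (s₀ : ι → E) {t : (V → E) → ℕ → ι → E} (f : ℕ × ι → V ⊕ E)
    (hf : ∀ x n i, t x n i = Sum.elim x id (f (n, i))) :
    U.Closed (fun x => Indisc G C (t x) ∧ ∀ i, U.srt (t x 0 i) = U.srt (s₀ i)) := by
  obtain ⟨Θ, hΘ⟩ := U.thick (ι ⊕ C) (U.mk_sum_lt hι hC) (Sum.elim s₀ Subtype.val)
  let e : ℕ × (ι ⊕ C) → V ⊕ E := fun p => Sum.elim (fun i => f (p.1, i)) (fun c => Sum.inr c) p.2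
  have he : ∀ x w, Sum.elim x id (e w) = flat (fun n => Sum.elim (t x n) (Subtype.val : C → E)) w := by
    rintro x ⟨n, i | c⟩
    · exact (hf x n i).symm
    · rfl
  refine ⟨(fun p : U.Inst (ℕ × (ι ⊕ C)) => (⟨p.1, fun k => e (p.2 k)⟩ : U.Inst (V ⊕ E))) '' Θ,
    mk_image_le.trans_lt ((mk_set_le _).trans_lt
      (U.mk_inst_lt (U.mk_nat_prod_lt (U.mk_sum_lt hι hC)))), fun x => ?_⟩
  rw [Set.forall_mem_image]
  simp only [he]
  have := hΘ (fun n => Sum.elim (t x n) (Subtype.val : C → E))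
  rw [indisc_sum_iff, Subtype.range_val, Set.empty_union] at this
  refine Iff.trans ?_ (this.symm.trans ?_)
  · refine and_congr_right fun _ => ⟨fun h => ?_, fun h i => h (Sum.inl i)⟩
    rintro (i | c)
    · exact h i
    · rfl
  · rfl

/-! ### Extraction of indiscernible sequences -/

/-- Conjugacy of infinite sequences from conjugacy of their initial segments. -/
theorem conj_flat {C : Set E} {ι : Type u} (hC : #C < κ) (hι : #ι < κ) {s t : ℕ → ι → E}
    (h : ∀ n, Conj G C (flat fun k : Fin n => s k) (flat fun k : Fin n => t k)) :
    Conj G C (flat s) (flat t) := by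
  refine U.conj_of_finite hC (U.mk_nat_prod_lt hι) fun F hF C₀ hC₀ _ => ?_
  obtain ⟨N, hN⟩ : ∃ N, ∀ p ∈ F, p.1 < N := by
    obtain ⟨N, hN⟩ := (hF.image Prod.fst).bddAbove
    exact ⟨N + 1, fun p hp => Nat.lt_succ_of_le (hN ⟨p, hp, rfl⟩)⟩
  exact ((h N).mono hC₀).comp (fun p : F => ((⟨p.1.1, hN p p.2⟩ : Fin N), p.1.2))

/-- Every sufficiently long sequence gives rise to an indiscernible sequence, whose finite parts
have types that occur in the long sequence. -/
theorem extraction {σ : Cardinal.{u}} (hσ : σ < κ) :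
    ∃ lam < κ, ∀ (C : Set E) (ι : Type u), #C ≤ σ → #ι ≤ σ → ∀ (X : Type u) [LinearOrder X]
      [WellFoundedLT X], lam ≤ #X → ∀ t : X → ι → E, ∃ s : ℕ → ι → E, Indisc G C s ∧
        ∀ n, ∃ f : Fin n → X, StrictMono f ∧
          Conj G C (flat fun k : Fin n => s k) (flat fun k => t (f k)) := by
  classical
  let θ : Cardinal.{u} := 2 ^ max ℵ₀ (max #U.F σ)
  obtain ⟨lam, hlam, hsl, hω, hθ, hcof⟩ :=
    exists_isStrongLimit_lt U.inacc (θ := θ) (U.two_power_lt (U.max_lt' U.card_F hσ))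
  refine ⟨lam, hlam, fun C ι hC hι X _ _ hX t => ?_⟩
  have hCκ := hC.trans_lt hσ
  have hικ := hι.trans_lt hσ
  -- The colour of an increasing tuple of indices is the type of the subsequence, with the
  -- variables indexed in a way that does not depend on the length.
  let e (n : ℕ) : (Fin n × ι) ⊕ C → (ℕ × ι) ⊕ C := Sum.map (Prod.map Fin.val id) id
  have he : ∀ n, Function.Injective (e n) := fun n =>
    Sum.map_injective.2 ⟨Fin.val_injective.prodMap Function.injective_id,
      Function.injective_id⟩
  let E' (n : ℕ) : U.Inst ((Fin n × ι) ⊕ C) → U.Inst ((ℕ × ι) ⊕ C) :=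
    fun p => ⟨p.1, fun k => e n (p.2 k)⟩
  have hE' : ∀ n, Function.Injective (E' n) := by
    rintro n ⟨φ, f⟩ ⟨φ', f'⟩ h
    simp only [E', Sigma.mk.injEq] at h
    obtain ⟨rfl, h⟩ := h
    have h := eq_of_heq h
    congr 1
    funext k
    exact he n (congrFun h k)
  let c : ∀ n, (Fin n → X) → Set (U.Inst ((ℕ × ι) ⊕ C)) := fun n f =>
    E' n '' U.tpOver C (flat fun k => t (f k))
  have hc : ∀ n (f g : Fin n → X), c n f = c n g →
      Conj G C (flat fun k => t (f k)) (flat fun k => t (g k)) := by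
    intro n f g h
    rw [U.conj_iff_tpOver hCκ (U.mk_fin_prod_lt n hικ)]
    exact (hE' n).image_injective h
  have hK : #(Set (U.Inst ((ℕ × ι) ⊕ C))) ≤ θ := by
    rw [mk_set]
    refine power_le_power_left two_ne_zero ((U.mk_inst_le _).trans ?_)
    refine max_le (le_max_left _ _) (max_le ((le_max_left _ _).trans (le_max_right _ _)) ?_)
    rw [mk_sum, lift_id, lift_id, mk_prod, mk_nat, lift_aleph0, lift_uzero]
    have hσ' : σ ≤ max ℵ₀ (max #U.F σ) := (le_max_right _ _).trans (le_max_right _ _)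
    exact add_le_of_le (le_max_left _ _)
      (mul_le_of_le (le_max_left _ _) (le_max_left _ _) (hι.trans hσ')) (hC.trans hσ')
  obtain ⟨q, hq⟩ := erdosRado_coherent hsl hω (hK.trans_lt hθ) (hK.trans_lt hcof) hX c
  have hf : ∀ n, ∃ f : Fin n → X, StrictMono f ∧ ∀ m ≤ n, ∀ g : Fin m → Fin n, StrictMono g →
      c m (fun k => f (g k)) = q m := by
    intro n
    obtain ⟨Y, hY, h⟩ := hq (n + 1)
    have : Y.Infinite := Set.infinite_coe_iff.1 (infinite_iff.2 hY)
    obtain ⟨S, hSY, hS⟩ := this.exists_subset_card_eq n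
    refine ⟨S.orderEmbOfFin hS, (S.orderEmbOfFin hS).strictMono, fun m hm g hg => ?_⟩
    exact h m (Nat.lt_succ_of_le hm) _ ((S.orderEmbOfFin hS).strictMono.comp hg)
      fun i => hSY (S.orderEmbOfFin_mem hS _)
  choose f hfm hfq using hf
  have hX0 : Nonempty X := by
    rw [← mk_ne_zero_iff]
    exact (aleph0_pos.trans (hω.trans_le hX)).ne'
  obtain ⟨x₀⟩ := hX0
  obtain ⟨x, hx⟩ := U.exists_of_closed (V := ℕ × ι) (J := ULift.{u} ℕ) (U.mk_nat_prod_lt hικ)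
    (by rw [mk_uLift, mk_nat, lift_aleph0]; exact U.aleph0_lt)
    (P := fun n x => Conj G C (fun p : Fin n.down × ι => x (p.1, p.2)) (flat fun k => t (f n.down k)))
    (fun n => U.closed_conj hCκ (U.mk_fin_prod_lt _ hικ) _ (fun p => Sum.inl (p.1, p.2))
      (fun _ _ => rfl)) (by
      intro J₀
      obtain ⟨N, hN⟩ : ∃ N, ∀ n ∈ J₀, n.down ≤ N :=
        ⟨J₀.sup ULift.down, fun n hn => Finset.le_sup (f := ULift.down) hn⟩
      refine ⟨fun p => if h : p.1 < N then t (f N ⟨p.1, h⟩) p.2 else t x₀ p.2, fun n hn => ?_⟩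
      have h1 := hc n.down (fun k => f N (Fin.castLE (hN n hn) k)) (f n.down) (by
        rw [hfq N _ (hN n hn) _ (Fin.strictMono_castLE _)]
        exact (hfq n.down _ le_rfl id strictMono_id).symm)
      convert h1 using 2 with p
      exact dif_pos (p.1.2.trans_le (hN n hn)))
  have hs : ∀ n, Conj G C (fun p : Fin n × ι => x (p.1, p.2)) (flat fun k => t (f n k)) :=
    fun n => hx ⟨n⟩
  refine ⟨fun n i => x (n, i), fun n g g' hg hg' => ?_, fun n => ⟨f n, hfm n, hs n⟩⟩
  obtain ⟨N, hnN, hgN, hg'N⟩ : ∃ N, n ≤ N ∧ (∀ k, g k < N) ∧ ∀ k, g' k < N := by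
    refine ⟨n + (∑ k, g k) + (∑ k, g' k) + 1, by omega, fun k => ?_, fun k => ?_⟩
    · have := Finset.single_le_sum (f := g) (fun _ _ => Nat.zero_le _) (Finset.mem_univ k)
      omega
    · have := Finset.single_le_sum (f := g') (fun _ _ => Nat.zero_le _) (Finset.mem_univ k)
      omega
  have key : ∀ (g : Fin n → ℕ) (_ : StrictMono g) (hgN : ∀ k, g k < N),
      Conj G C (flat fun k => fun i => x (g k, i))
        (flat fun k => t (f N ⟨g k, hgN k⟩)) := fun g _ hgN =>
    (hs N).comp (fun p : Fin n × ι => ((⟨g p.1, hgN p.1⟩ : Fin N), p.2))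
  refine ((key g hg hgN).trans (hc n _ _ ?_)).trans (key g' hg' hg'N).symm
  rw [hfq N n hnN (fun k => ⟨g k, hgN k⟩) (fun i j hij => hg hij),
    hfq N n hnN (fun k => ⟨g' k, hg'N k⟩) (fun i j hij => hg' hij)]

/-- Indiscernible sequences may be stretched to any small index order. -/
theorem stretch {C : Set E} {ι : Type u} (hC : #C < κ) (hι : #ι < κ) {I : Type*} [LinearOrder I]
    [Infinite I] {s : I → ι → E} (hs : Indisc G C s) (J : Type u) [LinearOrder J] (hJ : #J < κ) :
    ∃ t : J → ι → E, SameEM G C t s := by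
  classical
  have hr : ∀ n, ∃ g : Fin n → I, StrictMono g := by
    intro n
    obtain ⟨S, hS⟩ := Infinite.exists_subset_card_eq I n
    exact ⟨S.orderEmbOfFin hS, (S.orderEmbOfFin hS).strictMono⟩
  choose r hr using hr
  obtain ⟨x, hx⟩ := U.exists_of_closed (V := J × ι) (J := Finset J) (U.mk_prod_lt hJ hι)
    (U.mk_finset_lt hJ)
    (P := fun D x => Conj G C (fun p : Fin D.card × ι => x (D.orderEmbOfFin rfl p.1, p.2))
      (flat fun k => s (r D.card k)))
    (fun D => U.closed_conj hC (U.mk_fin_prod_lt _ hι) _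
      (fun p => Sum.inl (D.orderEmbOfFin rfl p.1, p.2)) (fun _ _ => rfl)) (by
      intro J₀
      let D : Finset J := J₀.sup id
      have hD : ∀ D' ∈ J₀, D' ⊆ D := fun D' h => Finset.le_sup (f := id) h
      let e := D.orderIsoOfFin rfl
      obtain ⟨i₀⟩ : Nonempty I := inferInstance
      refine ⟨fun p => if h : p.1 ∈ D then s (r D.card (e.symm ⟨p.1, h⟩)) p.2 else s i₀ p.2,
        fun D' hD' => ?_⟩
      have hmem : ∀ k, D'.orderEmbOfFin rfl k ∈ D := fun k => hD D' hD' (D'.orderEmbOfFin_mem rfl k)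
      have := hs D'.card (fun k => r D.card (e.symm ⟨D'.orderEmbOfFin rfl k, hmem k⟩))
        (r D'.card) (fun k l hkl => hr _ (e.symm.strictMono
          (show (⟨_, hmem k⟩ : {x // x ∈ D}) < ⟨_, hmem l⟩ from
            (D'.orderEmbOfFin rfl).strictMono hkl))) (hr _)
      convert this using 2 with p
      exact dif_pos (hmem p.1))
  refine ⟨fun j i => x (j, i), fun n f g hf hg => ?_⟩
  let D : Finset J := Finset.univ.image f
  have hDn : D.card = n := by
    rw [Finset.card_image_of_injective _ hf.injective, Finset.card_univ, Fintype.card_fin]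
  have hfD : f = D.orderEmbOfFin hDn :=
    Finset.orderEmbOfFin_unique hDn (fun k => Finset.mem_image_of_mem _ (Finset.mem_univ _)) hf
  have := hx D
  clear_value D
  subst hDn
  rw [hfD]
  exact Conj.trans this (hs _ _ _ (hr _) hg)

/-- An indiscernible sequence over `C` has a `C`-conjugate that is indiscernible over a larger
set: it is extracted from a long stretch of the sequence. -/
theorem exists_indisc_union {C D : Set E} {ι : Type u} (hC : #C < κ) (hD : #D < κ) (hι : #ι < κ)
    {s : ℕ → ι → E} (hs : Indisc G C s) :
    ∃ t : ℕ → ι → E, Conj G C (flat t) (flat s) ∧ Indisc G (C ∪ D) t := by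
  obtain ⟨lam, hlam, hex⟩ := U.extraction (σ := max #(C ∪ D : Set E) #ι)
    (max_lt (U.mk_union_lt hC hD) hι)
  obtain ⟨r, hr⟩ := U.stretch hC hι hs lam.ord.ToType (by rwa [mk_ord_toType])
  obtain ⟨t, ht, htr⟩ := hex (C ∪ D) ι (le_max_left _ _) (le_max_right _ _) lam.ord.ToType
    (by rw [mk_ord_toType]) r
  refine ⟨t, U.conj_flat hC hι fun n => ?_, ht⟩
  obtain ⟨f, hf, h⟩ := htr n
  exact (h.mono Set.subset_union_left).trans (hr n f _ hf Fin.val_strictMono)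

end Presentation

/-! ### Dividing -/

section Dividing

variable {E : Type u} {ι η θ : Type*} {G : Subgroup (Equiv.Perm E)} {C D : Set E}

/-- The type of `a` over `C` and `b` does not divide over `C`. -/
def ND (G : Subgroup (Equiv.Perm E)) (C : Set E) (a : ι → E) (b : η → E) : Prop :=
  ∀ s : ℕ → η → E, Indisc G C s → (∀ n, Conj G C (s n) b) →
    ∃ x : ι → E, ∀ n, Conj G C (Sum.elim x (s n)) (Sum.elim a b)

/-- Dividing independence, as a relation between sets. -/
def DI (G : Subgroup (Equiv.Perm E)) (A C B : Set E) : Prop :=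
  ND G C (Subtype.val : A → E) (Subtype.val : B → E)

theorem Conj.sum_map {ι' η' : Type*} {a b : ι → E} {a' b' : η → E}
    (h : Conj G C (Sum.elim a a') (Sum.elim b b')) (f : ι' → ι) (f' : η' → η) :
    Conj G C (Sum.elim (fun i => a (f i)) fun i => a' (f' i))
      (Sum.elim (fun i => b (f i)) fun i => b' (f' i)) := by
  obtain ⟨g, hg, hC, h⟩ := h
  refine ⟨g, hg, hC, ?_⟩
  rintro (i | i)
  · exact h (Sum.inl _)
  · exact h (Sum.inr _)

theorem conj_sum_elim {g : Equiv.Perm E} (hg : g ∈ G) (hC : ∀ c ∈ C, g c = c) (a : ι → E)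
    (b : η → E) : Conj G C (Sum.elim a b) (Sum.elim (fun i => g (a i)) fun i => g (b i)) := by
  refine ⟨g, hg, hC, ?_⟩
  rintro (i | i) <;> rfl

theorem ND.comp_left {a : ι → E} {b : η → E} (h : ND G C a b) (f : θ → ι) :
    ND G C (fun i => a (f i)) b := by
  intro s hs hsb
  obtain ⟨x, hx⟩ := h s hs hsb
  exact ⟨fun i => x (f i), fun n => (hx n).sum_map f id⟩

theorem ND.of_conj {a a' : ι → E} {b b' : η → E} (h : ND G C a b)
    (hc : Conj G C (Sum.elim a b) (Sum.elim a' b')) : ND G C a' b' := by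
  intro s hs hsb
  obtain ⟨x, hx⟩ := h s hs fun n => (hsb n).trans hc.inr.symm
  exact ⟨x, fun n => (hx n).trans hc⟩

theorem ND.smul {a : ι → E} {b : η → E} (h : ND G C a b) {g : Equiv.Perm E} (hg : g ∈ G) :
    ND G (g '' C) (fun i => g (a i)) (fun i => g (b i)) := by
  intro s hs hsb
  have hinv : ⇑(g⁻¹) '' (g '' C) = C := by
    rw [Set.image_image]
    simp
  have hs' := hs.smul (G.inv_mem hg)
  rw [hinv] at hs'
  obtain ⟨x, hx⟩ := h _ hs' (fun n => by
    have := (hsb n).smul (G.inv_mem hg)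
    rw [hinv] at this
    simpa using this)
  refine ⟨fun i => g (x i), fun n => ?_⟩
  have := (hx n).smul hg
  convert this using 2 with i i
  · rcases i with i | i <;> simp
  · rcases i with i | i <;> simp

/-- Base monotonicity. -/
theorem ND.union_base {a : ι → E} {b : η → E} (h : ND G C a b) (hD : D ⊆ Set.range b) :
    ND G (C ∪ D) a b := by
  intro s hs hsb
  obtain ⟨x, hx⟩ := h s (hs.mono Set.subset_union_left) fun n =>
    (hsb n).mono Set.subset_union_left
  refine ⟨x, fun n => ?_⟩
  obtain ⟨g, hg, hC, hgx⟩ := hx n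
  refine ⟨g, hg, ?_, hgx⟩
  rintro d (hd | hd)
  · exact hC d hd
  · obtain ⟨j, rfl⟩ := hD hd
    obtain ⟨k, hk, hkC, hks⟩ := hsb n
    have : s n j = b j := k.injective ((hks j).trans (hkC _ (Or.inr hd)).symm)
    have h2 := hgx (Sum.inr j)
    simp only [Sum.elim_inr] at h2
    rw [← this, h2, this]

theorem ND.normal {a : ι → E} {b : η → E} (h : ND G C a b) {c : θ → E} (hc : Set.range c ⊆ C) :
    ND G C (Sum.elim c a) (Sum.elim c b) := by
  intro s hs hsb
  obtain ⟨x, hx⟩ := h _ (hs.comp Sum.inr) (fun n => (hsb n).comp Sum.inr)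
  refine ⟨Sum.elim c x, fun n => ?_⟩
  obtain ⟨g, hg, hC, hgx⟩ := hx n
  refine ⟨g, hg, hC, ?_⟩
  have hcs : ∀ j, s n (Sum.inl j) = c j := by
    intro j
    obtain ⟨k, hk, hkC, hks⟩ := hsb n
    exact k.injective ((hks (Sum.inl j)).trans (hkC _ (hc ⟨j, rfl⟩)).symm)
  rintro ((j | i) | (j | i))
  · exact hC _ (hc ⟨j, rfl⟩)
  · exact hgx (Sum.inl i)
  · simp only [Sum.elim_inr, Sum.elim_inl, hcs]
    exact hC _ (hc ⟨j, rfl⟩)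
  · exact hgx (Sum.inr i)

theorem nd_self {a : ι → E} {b : η → E} (hb : Set.range b ⊆ C) : ND G C a b := by
  intro s hs hsb
  refine ⟨a, fun n => ?_⟩
  have : s n = b := by
    funext j
    obtain ⟨k, hk, hkC, hks⟩ := hsb n
    exact k.injective ((hks j).trans (hkC _ (hb ⟨j, rfl⟩)).symm)
  rw [this]
  exact Conj.refl _

/-- A sufficient condition for non-dividing: every indiscernible sequence starting with `b` is
indiscernible over a conjugate of `a`. -/
theorem nd_of_forall {a : ι → E} {b : η → E}
    (h : ∀ s : ℕ → η → E, Indisc G C s → s 0 = b →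
      ∃ a' : ι → E, Conj G C (Sum.elim a' b) (Sum.elim a b) ∧ Indisc G (C ∪ Set.range a') s) :
    ND G C a b := by
  intro s hs hsb
  obtain ⟨g, hg, hC, hgs⟩ := hsb 0
  obtain ⟨a', ha', hi⟩ := h (fun n j => g (s n j)) (hs.smul_fix hg hC) (funext hgs)
  refine ⟨fun i => g⁻¹ (a' i), fun n => ?_⟩
  refine Conj.trans (conj_sum_elim hg hC _ _) ?_
  simp only [Equiv.Perm.coe_inv, Equiv.apply_symm_apply]
  refine Conj.trans ?_ ha'
  refine conj_sum_iff'.2 ((hi.conj n 0).trans ?_)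
  simp only [hgs]
  exact Conj.refl _

end Dividing

namespace Presentation

variable {E : Type u} {G : Subgroup (Equiv.Perm E)} {κ : Cardinal.{u}} (U : Presentation G κ)
variable {ι η θ : Type u} {C D : Set E}
include U

/-- If the type of `a` over the first entry of an indiscernible sequence (or over a part of it)
does not divide over `C`, then the sequence is indiscernible over a conjugate of `a`. -/
theorem ND.exists_indisc (hC : #C < κ) (hι : #ι < κ) (hη : #η < κ) (hθ : #θ < κ) {a : ι → E}
    {s : ℕ → η → E} (f : θ → η) (hs : Indisc G C s) (h : ND G C a fun i => s 0 (f i)) :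
    ∃ a' : ι → E, Conj G C (Sum.elim a' fun i => s 0 (f i)) (Sum.elim a fun i => s 0 (f i)) ∧
      Indisc G (C ∪ Set.range a') s := by
  obtain ⟨lam, hlam, hex⟩ := U.extraction (σ := max (#C + #ι) #η)
    (max_lt (add_lt_of_lt U.aleph0_lt.le hC hι) hη)
  -- Stretch the sequence and find a realisation `x` of the type of `a` over all of its entries; then
  -- extract a sequence that is indiscernible over `x`.
  let X := lam.ord.ToType
  have hX : #X = lam := mk_ord_toType _
  obtain ⟨t, ht⟩ := U.stretch hC hη hs X (by rwa [hX])
  obtain ⟨x, hx⟩ := U.exists_of_closed (V := ι) (J := X) hι (by rwa [hX])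
    (P := fun i x => Conj G C (Sum.elim x fun j => t i (f j)) (Sum.elim a fun i => s 0 (f i)))
    (fun i => U.closed_conj hC (U.mk_sum_lt hι hθ) _
      (Sum.elim Sum.inl fun j => Sum.inr (t i (f j))) (by rintro x (i | j) <;> rfl)) (by
      intro J₀
      obtain ⟨x₀, hx₀⟩ := h _ (hs.comp f) fun n => (hs.conj n 0).comp f
      obtain ⟨g, hg, hgC, hgt⟩ := ht J₀.card (J₀.orderEmbOfFin rfl) Fin.val
        (J₀.orderEmbOfFin rfl).strictMono Fin.val_strictMono
      refine ⟨fun i => g⁻¹ (x₀ i), fun j hj => ?_⟩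
      obtain ⟨k, rfl⟩ : ∃ k, J₀.orderEmbOfFin rfl k = j := by
        have : j ∈ Set.range (J₀.orderEmbOfFin rfl) := by simpa using hj
        exact this
      refine Conj.trans (conj_sum_elim hg hgC _ _) ?_
      simp only [Equiv.Perm.coe_inv, Equiv.apply_symm_apply]
      have : (fun i => g (t (J₀.orderEmbOfFin rfl k) (f i))) = fun i => s k (f i) :=
        funext fun i => hgt (k, f i)
      rw [this]
      exact hx₀ k)
  obtain ⟨r, hr, hrt⟩ := hex (C ∪ Set.range x) η
    ((mk_union_le _ _).trans ((add_le_add le_rfl mk_range_le).trans (le_max_left _ _)))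
    (le_max_right _ _) X hX.ge t
  obtain ⟨g, hg, hgC, hgr⟩ := U.conj_flat (s := r) (t := s) hC hη fun n => by
    obtain ⟨e, he, h⟩ := hrt n
    exact (h.mono Set.subset_union_left).trans (ht n e _ he Fin.val_strictMono)
  have hgr' : ∀ n j, g (r n j) = s n j := fun n j => hgr (n, j)
  refine ⟨fun i => g (x i), ?_, ?_⟩
  · obtain ⟨e, he, h⟩ := hrt 1
    have h1 : Conj G (C ∪ Set.range x) (fun j => r 0 (f j)) (fun j => t (e 0) (f j)) :=
      h.comp (fun j => ((0 : Fin 1), f j))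
    have h2 := (conj_sum_iff'.2 h1).trans (hx (e 0))
    refine Conj.trans (Conj.symm ?_) h2
    simpa only [hgr'] using conj_sum_elim (C := C) hg hgC x fun j => r 0 (f j)
  · have := hr.smul hg
    simp only [hgr'] at this
    rwa [Set.image_union, Set.EqOn.image_eq (f₂ := id) (fun c hc => hgC c hc), Set.image_id,
      ← Set.range_comp] at this

theorem ND.exists_indisc' (hC : #C < κ) (hι : #ι < κ) (hη : #η < κ) {a : ι → E}
    {b : η → E} {s : ℕ → η → E} (hs : Indisc G C s) (hb : s 0 = b) (h : ND G C a b) :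
    ∃ a' : ι → E, Conj G C (Sum.elim a' b) (Sum.elim a b) ∧ Indisc G (C ∪ Set.range a') s := by
  subst hb
  exact ND.exists_indisc U hC hι hη hη id hs h

/-- Left transitivity of non-dividing. -/
theorem ND.left_trans (hC : #C < κ) (hι : #ι < κ) (hη : #η < κ) (hθ : #θ < κ) {a : ι → E}
    {a' : θ → E} {b : η → E} (h : ND G C a b) (h' : ND G (C ∪ Set.range a) a' b) :
    ND G C (Sum.elim a a') b := by
  refine nd_of_forall fun s hs hs0 => ?_
  obtain ⟨a₁, ⟨g, hg, hgC, hga⟩, hi⟩ := ND.exists_indisc' U hC hι hη hs hs0 h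
  -- Move the sequence so that it becomes indiscernible over `a` itself.
  have hi' := hi.smul hg
  rw [Set.image_union, Set.EqOn.image_eq (f₂ := id) (fun c hc => hgC c hc), Set.image_id,
    ← Set.range_comp, show g ∘ a₁ = a from funext fun i => hga (Sum.inl i)] at hi'
  obtain ⟨a₂, h₂, hi₂⟩ := ND.exists_indisc' U (U.mk_union_lt hC (mk_range_lt hι a)) hθ hη hi'
    (b := b) (by funext j; rw [hs0]; exact hga (Sum.inr j)) h'
  have hinv : ∀ c ∈ C, g⁻¹ c = c := fun c hc => by rw [Equiv.Perm.inv_eq_iff_eq, hgC c hc]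
  refine ⟨Sum.elim a₁ fun i => g⁻¹ (a₂ i), ?_, ?_⟩
  · have h1 : Conj G C (Sum.elim (Sum.elim a₁ fun i => g⁻¹ (a₂ i)) b)
        (Sum.elim (Sum.elim a a₂) b) := by
      refine ⟨g, hg, hgC, ?_⟩
      rintro ((i | i) | i)
      · exact hga (Sum.inl i)
      · simp
      · exact hga (Sum.inr i)
    refine h1.trans ?_
    have h2 := conj_sum_iff.2 h₂
    obtain ⟨k, hk, hkC, hka⟩ := h2
    refine ⟨k, hk, hkC, ?_⟩
    rintro ((i | i) | i)
    · exact hka (Sum.inr i)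
    · exact hka (Sum.inl (Sum.inl i))
    · exact hka (Sum.inl (Sum.inr i))
  · have := hi₂.smul (G.inv_mem hg)
    rw [Set.image_union, Set.image_union, Set.EqOn.image_eq (f₂ := id) (fun c hc => hinv c hc),
      Set.image_id, ← Set.range_comp, ← Set.range_comp, Set.union_assoc] at this
    convert this using 2
    · rw [Set.Sum.elim_range]
      congr 2
      funext i
      simp only [Function.comp]
      rw [eq_comm, Equiv.Perm.inv_eq_iff_eq]
      exact (hga (Sum.inl i)).symm
    · simp

/-- Monotonicity on the right. A long stretch of a sequence in the type of the smaller tuple is filled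
up to a sequence of larger tuples, from which an indiscernible sequence is extracted. -/
theorem ND.comp_right (hC : #C < κ) (hη : #η < κ) (hθ : #θ < κ) {a : ι → E} {b : η → E}
    (h : ND G C a b) (f : θ → η) : ND G C a fun i => b (f i) := by
  intro s' hs' hsb
  obtain ⟨lam, hlam, hex⟩ := U.extraction (σ := max #C #η) (max_lt hC hη)
  let X := lam.ord.ToType
  have hX : #X = lam := mk_ord_toType _
  obtain ⟨t', ht'⟩ := U.stretch hC hθ hs' X (by rwa [hX])
  have : ∀ i, ∃ t : η → E, Conj G C b t ∧ ∀ j, t (f j) = t' i j := by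
    intro i
    have h1 : Conj G C (t' i) (s' 0) := (ht' 1 (fun _ => i) (fun _ => 0)
      (Subsingleton.strictMono _) (Subsingleton.strictMono _)).comp (fun j => ((0 : Fin 1), j))
    obtain ⟨g, hg, hgC, hgb⟩ := (h1.trans (hsb 0)).symm
    exact ⟨fun j => g (b j), ⟨g, hg, hgC, fun _ => rfl⟩, hgb⟩
  choose t htb htf using this
  obtain ⟨r, hr, hrt⟩ := hex C η (le_max_left _ _) (le_max_right _ _) X hX.ge t
  obtain ⟨g, hg, hgC, hgr⟩ := U.conj_flat (s := fun n j => r n (f j)) (t := s') hC hθ fun n => by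
    obtain ⟨e, he, h⟩ := hrt n
    have h1 : Conj G C (flat fun k : Fin n => fun j => r k (f j)) (flat fun k => t' (e k)) := by
      have := h.comp (fun p : Fin n × θ => (p.1, f p.2))
      simp only [flat, htf] at this
      exact this
    exact h1.trans (ht' n e _ he Fin.val_strictMono)
  obtain ⟨x, hx⟩ := h (fun n j => g (r n j)) (hr.smul_fix hg hgC) (fun n => by
    have h0 : Conj G C (r 0) b := by
      obtain ⟨e, he, h⟩ := hrt 1
      exact Conj.trans (b := t (e 0)) (h.comp (fun j => ((0 : Fin 1), j))) (htb _).symm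
    exact Conj.trans (Conj.symm ⟨g, hg, hgC, fun _ => rfl⟩) ((hr.conj n 0).trans h0))
  refine ⟨x, fun n => ?_⟩
  have := (hx n).sum_map id f
  simp only [show ∀ i, g (r n (f i)) = s' n i from fun i => hgr (n, i)] at this
  exact this

theorem ND.mono (hC : #C < κ) {ι' η' : Type u} (hη : #η < κ) (hη' : #η' < κ) {a : ι → E}
    {b : η → E} {a' : ι' → E} {b' : η' → E} (h : ND G C a b) (ha : Set.range a' ⊆ Set.range a)
    (hb : Set.range b' ⊆ Set.range b) : ND G C a' b' := by
  choose f hf using fun i => ha ⟨i, rfl⟩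
  choose e he using fun i => hb ⟨i, rfl⟩
  have := (ND.comp_right U hC hη hη' h e).comp_left f
  simpa only [hf, he] using this

theorem nd_iff (hC : #C < κ) (hη : #η < κ) {a : ι → E} {b : η → E} :
    ND G C a b ↔ DI G (Set.range a) C (Set.range b) :=
  ⟨fun h => ND.mono U hC hη (mk_range_lt hη b) h Subtype.range_val.subset Subtype.range_val.subset,
    fun h => ND.mono U hC (mk_range_lt hη b) hη h Subtype.range_val.superset
      Subtype.range_val.superset⟩

theorem DI.mono {A B A' B' : Set E} (hC : #C < κ) (hB : #B < κ) (h : DI G A C B) (hA' : A' ⊆ A)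
    (hB' : B' ⊆ B) : DI G A' C B' :=
  ND.mono U hC hB ((mk_le_mk_of_subset hB').trans_lt hB) h (by simpa) (by simpa)

omit U in
theorem DI.smul {A B : Set E} (h : DI G A C B) {g : Equiv.Perm E} (hg : g ∈ G) :
    DI G (g '' A) (g '' C) (g '' B) := by
  have key : ∀ S : Set E, ∀ x : g '' S, g⁻¹ x.1 ∈ S := by
    rintro S ⟨_, x, hx, rfl⟩
    simpa using hx
  have := ND.smul h hg
  intro s hs hsb
  obtain ⟨x, hx⟩ := this (fun n j => s n ⟨g j.1, j.1, j.2, rfl⟩) (hs.comp _)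
    (fun n => (hsb n).comp (fun j : B => (⟨g j.1, j.1, j.2, rfl⟩ : g '' B)))
  refine ⟨fun i => x ⟨g⁻¹ i.1, key A i⟩, fun n => ?_⟩
  have := (hx n).sum_map (fun i : g '' A => (⟨g⁻¹ i.1, key A i⟩ : A))
    (fun i : g '' B => (⟨g⁻¹ i.1, key B i⟩ : B))
  simpa using this

omit U in
theorem DI.base {A B C' : Set E} (h : DI G A C B) (hC : C ⊆ C') (hC' : C' ⊆ C ∪ B) :
    DI G A C' B := by
  have : C' = C ∪ C' ∩ B := by
    ext x
    constructor
    · intro hx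
      rcases hC' hx with h | h
      · exact Or.inl h
      · exact Or.inr ⟨hx, h⟩
    · rintro (h | h)
      · exact hC h
      · exact h.1
  rw [this]
  exact ND.union_base h (by simp)

theorem DI.left_trans {A A' B : Set E} (hC : #C < κ) (hA : #A < κ) (hA' : #A' < κ) (hB : #B < κ)
    (h : DI G A C B) (h' : DI G A' (C ∪ A) B) : DI G (A ∪ A') C B := by
  have := ND.left_trans U hC hA hB hA' h (a' := (Subtype.val : A' → E)) (by
    rw [Subtype.range_val]
    exact h')
  rw [U.nd_iff hC hB] at this
  simpa using this

theorem DI.normal {A B : Set E} (hC : #C < κ) (hB : #B < κ) (h : DI G A C B) :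
    DI G (C ∪ A) C (C ∪ B) := by
  have := ND.normal h (c := (Subtype.val : C → E)) (by simp)
  rw [U.nd_iff hC (U.mk_sum_lt hC hB)] at this
  simpa using this

/-- Realising a type over a sequence, from its realisation on finite parts. -/
theorem exists_conj_seq (hC : #C < κ) (hι : #ι < κ) (hη : #η < κ) {a : ι → E} {b : η → E}
    {s : ℕ → η → E} (h : ∀ (F : Finset ι) (H : Finset η), ∃ x : F → E, ∀ n,
      Conj G C (Sum.elim x fun j : H => s n j) (Sum.elim (fun i : F => a i) fun j : H => b j)) :
    ∃ x : ι → E, ∀ n, Conj G C (Sum.elim x (s n)) (Sum.elim a b) := by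
  classical
  obtain ⟨x, hx⟩ := U.exists_of_closed (V := ι) (J := ℕ × Finset ι × Finset η) hι
    (U.mk_nat_prod_lt (U.mk_prod_lt (U.mk_finset_lt hι) (U.mk_finset_lt hη)))
    (P := fun j x => Conj G C (Sum.elim (fun i : j.2.1 => x i) fun k : j.2.2 => s j.1 k)
      (Sum.elim (fun i : j.2.1 => a i) fun k : j.2.2 => b k))
    (fun j => U.closed_conj hC (U.mk_sum_lt ((mk_subtype_le _).trans_lt hι)
      ((mk_subtype_le _).trans_lt hη)) _
      (Sum.elim (fun i => Sum.inl i.1) fun k => Sum.inr (s j.1 k))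
      (by rintro x (i | k) <;> rfl)) (by
      intro J₀
      obtain ⟨x, hx⟩ := h (J₀.sup fun j => j.2.1) (J₀.sup fun j => j.2.2)
      refine ⟨fun i => if h : i ∈ J₀.sup fun j => j.2.1 then x ⟨i, h⟩ else a i, fun j hj => ?_⟩
      have h1 : ∀ i ∈ j.2.1, i ∈ J₀.sup fun j => j.2.1 := fun i hi =>
        Finset.le_sup (f := fun j : ℕ × Finset ι × Finset η => j.2.1) hj hi
      have h2 : ∀ i ∈ j.2.2, i ∈ J₀.sup fun j => j.2.2 := fun i hi =>
        Finset.le_sup (f := fun j : ℕ × Finset ι × Finset η => j.2.2) hj hi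
      have := (hx j.1).sum_map (fun i : j.2.1 => (⟨i.1, h1 i i.2⟩ : {x // x ∈ J₀.sup fun j => j.2.1}))
        (fun i : j.2.2 => (⟨i.1, h2 i i.2⟩ : {x // x ∈ J₀.sup fun j => j.2.2}))
      convert this using 3 with i
      exact dif_pos (h1 i i.2))
  refine ⟨x, fun n => U.conj_of_finite hC (U.mk_sum_lt hι hη) fun F hF C₀ hC₀ _ => ?_⟩
  let F₁ : Finset ι := (hF.preimage (f := Sum.inl) Sum.inl_injective.injOn).toFinset
  let F₂ : Finset η := (hF.preimage (f := Sum.inr) Sum.inr_injective.injOn).toFinset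
  have := ((hx (n, F₁, F₂)).mono hC₀).comp (fun p : F => match p with
    | ⟨Sum.inl i, h⟩ => Sum.inl (⟨i, by simpa [F₁] using h⟩ : F₁)
    | ⟨Sum.inr i, h⟩ => Sum.inr (⟨i, by simpa [F₂] using h⟩ : F₂))
  convert this using 2 <;> · rename_i p; obtain ⟨p | p, hp⟩ := p <;> rfl

/-- Non-dividing has finite character. -/
theorem nd_of_finite (hC : #C < κ) (hι : #ι < κ) (hη : #η < κ) {a : ι → E} {b : η → E}
    (h : ∀ (F : Finset ι) (H : Finset η), ND G C (fun i : F => a i) (fun j : H => b j)) :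
    ND G C a b := fun _ hs hsb => U.exists_conj_seq hC hι hη fun F H =>
  h F H _ (hs.comp _) fun n => (hsb n).comp _

/-- A witness of dividing that involves only finitely many entries of `a`, countably many entries
of `b`, and no parameters. -/
theorem exists_witness (hι : #ι < κ) (hη : #η < κ) {a : ι → E} {b : η → E}
    (hCb : C ⊆ Set.range b) (h : ¬ ND G C a b) :
    ∃ (n : ℕ) (F : Fin n → ι) (H : ULift.{u} ℕ → η) (s : ℕ → ULift.{u} ℕ → E), Indisc G C s ∧
      (∀ j, s 0 j = b (H j)) ∧ ¬ ∃ x : Fin n → E, ∀ k,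
        Conj G ∅ (Sum.elim x (s k)) (Sum.elim (fun i => a (F i)) (s 0)) := by
  classical
  by_contra! hcon
  refine h fun s hs hsb => ?_
  suffices ∃ x : ι → E, ∀ n, Conj G ∅ (Sum.elim x (s n)) (Sum.elim a b) by
    obtain ⟨x, hx⟩ := this
    refine ⟨x, fun n => ?_⟩
    obtain ⟨g, hg, -, hgx⟩ := hx n
    refine ⟨g, hg, fun c hc => ?_, hgx⟩
    obtain ⟨j, rfl⟩ := hCb hc
    obtain ⟨k, hk, hkC, hks⟩ := hsb n
    have hsj : s n j = b j := k.injective ((hks j).trans (hkC _ hc).symm)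
    have h2 := hgx (Sum.inr j)
    simp only [Sum.elim_inr] at h2
    rwa [hsj] at h2
  rcases isEmpty_or_nonempty η with hη0 | ⟨⟨j₀⟩⟩
  · exact ⟨a, fun n => by rw [Subsingleton.elim (s n) b]; exact Conj.refl _⟩
  obtain ⟨g, hg, hgC, hgs⟩ := hsb 0
  refine U.exists_conj_seq (by simpa using U.inacc.pos) hι hη fun F H => ?_
  obtain ⟨e', he'⟩ := (H.countable_toSet.insert j₀).exists_eq_range ⟨j₀, Set.mem_insert _ _⟩
  let e : ULift.{u} ℕ → η := fun k => e' k.down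
  have he : insert j₀ (H : Set η) = Set.range e :=
    he'.trans (Equiv.ulift.surjective.range_comp e').symm
  have hHe : ∀ j : H, ∃ k, e k = j := fun j => by
    have : (j : η) ∈ Set.range e := he ▸ Set.mem_insert_of_mem _ j.2
    exact this
  choose r hr using hHe
  obtain ⟨x, hx⟩ := hcon F.card (fun i => (F.equivFin.symm i : ι)) e (fun n j => g (s n (e j)))
    ((hs.smul_fix hg hgC).comp e) (fun j => hgs _)
  refine ⟨fun i => g⁻¹ (x (F.equivFin i)), fun n => ?_⟩
  refine Conj.trans (conj_sum_elim hg (by simp) _ _) ?_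
  have := (hx n).sum_map (fun i : F => F.equivFin i) r
  simpa [hr, hgs] using this

end Presentation

/-! ### Consequences of stability -/

/-- Tuples of indices in the same order position have conjugate subsequences. -/
theorem Indisc.conj_of_le_iff {E : Type u} {ι : Type*} {G : Subgroup (Equiv.Perm E)} {C : Set E}
    {I : Type*} [LinearOrder I] {s : I → ι → E} (hs : Indisc G C s) {Z : Type*} [Finite Z]
    {p q : Z → I} (h : ∀ z z', p z ≤ p z' ↔ q z ≤ q z') :
    Conj G C (flat fun z => s (p z)) (flat fun z => s (q z)) := by
  classical
  have := Fintype.ofFinite Z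
  let D := Finset.univ.image p
  let f := D.orderEmbOfFin rfl
  have hf : ∀ k, ∃ z, p z = f k := fun k => by
    obtain ⟨z, -, hz⟩ := Finset.mem_image.1 (D.orderEmbOfFin_mem rfl k)
    exact ⟨z, hz⟩
  choose z hz using hf
  have hk : ∀ z', ∃ k, f k = p z' := fun z' => by
    have : p z' ∈ Set.range f := by
      rw [Finset.range_orderEmbOfFin]
      simp [D]
    exact this
  choose k hk using hk
  have hg : StrictMono fun l => q (z l) := by
    intro l l' hl
    rw [← not_le, ← h, hz, hz, not_le]
    exact f.strictMono hl
  have hkq : ∀ z', q (z (k z')) = q z' := by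
    intro z'
    have h1 : p (z (k z')) = p z' := by rw [hz, hk]
    exact le_antisymm ((h _ _).1 h1.le) ((h _ _).1 h1.ge)
  have := (hs _ f (fun l => q (z l)) f.strictMono hg).comp (fun w : Z × ι => (k w.1, w.2))
  simpa only [flat, hk, hkq] using this

namespace Presentation

variable {E : Type u} {G : Subgroup (Equiv.Perm E)} {κ : Cardinal.{u}} (U : Presentation G κ)

/-- Over sets of size at most `μ` there are at most `μ` types of finite tuples of given sorts. -/
def StableIn (μ : Cardinal.{u}) : Prop :=
  ∀ B : Set E, #B ≤ μ → ∀ (n : ℕ) (X : Type u) (a : X → Fin n → E),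
    (∀ x y i, U.srt (a x i) = U.srt (a y i)) → (∀ x y, Conj G B (a x) (a y) → x = y) → #X ≤ μ

/-- Stability. -/
def Stable : Prop := ∃ μ, ℵ₀ ≤ μ ∧ μ < κ ∧ U.StableIn μ

variable {U}

theorem Closed.and {V : Type u} {P Q : (V → E) → Prop} (hP : U.Closed P) (hQ : U.Closed Q) :
    U.Closed fun x => P x ∧ Q x := by
  obtain ⟨S, hS, hP⟩ := hP
  obtain ⟨T, hT, hQ⟩ := hQ
  refine ⟨S ∪ T, (mk_union_le _ _).trans_lt (add_lt_of_lt U.aleph0_lt.le hS hT), fun x => ?_⟩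
  change P x ∧ Q x ↔ _
  rw [hP, hQ]
  simp only [Set.mem_union, or_imp, forall_and]

theorem Closed.imp {V : Type u} {P : (V → E) → Prop} (p : Prop) (hP : U.Closed P) :
    U.Closed fun x => p → P x := by
  by_cases hp : p
  · simpa [hp] using hP
  · exact ⟨∅, by simpa using U.inacc.pos, by simp [hp]⟩

variable (U)
include U

theorem mk_omega_lt : #(ULift.{u} ℕ) < κ := by
  rw [mk_uLift, mk_nat, lift_aleph0]
  exact U.aleph0_lt

theorem mk_empty_lt : #(∅ : Set E) < κ := by simpa using U.inacc.pos

theorem mk_fin_lt {n : ℕ} : #(ULift.{u} (Fin n)) < κ := by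
  rw [mk_uLift, mk_fin, lift_natCast]
  exact U.inacc.nat_lt n

/-- One step in the realignment of a dividing chain: the next indiscernible sequence of the chain
may be chosen indiscernible over any further small set `D`. -/
theorem exists_realign {η : Type u} {J : Type*} {C D : Set E} (hC : #C < κ) (hD : #D < κ)
    (hη : #η < κ) {t t' : J → E} (ht' : #(Set.range t') < κ) (h : Conj G C t t') {r : ℕ → η → E}
    (hr : Indisc G (C ∪ Set.range t) r) :
    ∃ r' : ℕ → η → E, Conj G C (Sum.elim t (flat r)) (Sum.elim t' (flat r')) ∧
      Indisc G (C ∪ Set.range t' ∪ D) r' := by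
  obtain ⟨g, hg, hgC, hgt⟩ := h
  have h1 := hr.smul hg
  rw [Set.image_union, Set.EqOn.image_eq (f₂ := id) (fun c hc => hgC c hc), Set.image_id,
    ← Set.range_comp, show g ∘ t = t' from funext hgt] at h1
  obtain ⟨r', hr', hi⟩ := U.exists_indisc_union (U.mk_union_lt hC ht') hD hη h1
  refine ⟨r', ?_, hi⟩
  have h2 := conj_sum_elim (C := C) hg hgC t (flat r)
  simp only [hgt] at h2
  exact h2.trans (conj_sum_iff'.2 hr'.symm)

/-- In a dividing chain of length `N` one may add tuples `a i` that satisfy only the first formulas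
of the chain, and over which the later sequences of the chain are indiscernible. -/
theorem exists_ladder {n : ℕ} {x : Fin n → E} {N : ℕ}
    {s : ℕ → ℕ → ULift.{u} ℕ → E}
    (hs : ∀ i < N, Indisc G (Set.range fun p : Fin i × ULift.{u} ℕ => s p.1 0 p.2) (s i)) :
    ∃ (s' : ℕ → ℕ → ULift.{u} ℕ → E) (a : ℕ → Fin n → E),
      (∀ i < N, Conj G ∅ (flat (s i)) (flat (s' i))) ∧
      (∀ j < N, ∀ i < j, Indisc G (Set.range (a i)) (s' j)) ∧
      ∀ i < N, ∀ j ≤ i, Conj G ∅ (Sum.elim x (s j 0)) (Sum.elim (a i) (s' j 0)) := by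
  suffices ∀ m ≤ N, ∃ (s' : ℕ → ℕ → ULift.{u} ℕ → E) (a : ℕ → Fin n → E),
      Conj G ∅ (fun p : Fin m × ULift.{u} ℕ => s p.1 0 p.2)
        (fun p : Fin m × ULift.{u} ℕ => s' p.1 0 p.2) ∧
      (∀ i < m, Conj G ∅ (flat (s i)) (flat (s' i))) ∧
      (∀ j < m, ∀ i < j, Indisc G (Set.range (a i)) (s' j)) ∧
      ∀ i < m, ∀ j ≤ i, Conj G ∅ (Sum.elim x (s j 0)) (Sum.elim (a i) (s' j 0)) by
    obtain ⟨s', a, -, h⟩ := this N le_rfl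
    exact ⟨s', a, h⟩
  intro m
  induction m with
  | zero => exact fun _ => ⟨s, fun _ => x, Conj.refl _, by simp, by simp, by simp⟩
  | succ m ih =>
    intro hm
    obtain ⟨s', a, h1, h2, h3, h4⟩ := ih (Nat.le_of_succ_le hm)
    obtain ⟨r', hr', hi⟩ := U.exists_realign (η := ULift.{u} ℕ) (C := ∅)
      (D := Set.range fun p : Fin m × ULift.{u} (Fin n) => a p.1 p.2.down) U.mk_empty_lt
      (mk_range_lt (U.mk_fin_prod_lt m U.mk_fin_lt) _) U.mk_omega_lt
      (mk_range_lt (U.mk_fin_prod_lt m U.mk_omega_lt) _) h1 (r := s m)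
      (by rw [Set.empty_union]; exact hs m hm)
    have h1' : Conj G ∅ (fun p : Fin (m + 1) × ULift.{u} ℕ => s p.1 0 p.2)
        (fun p => Function.update s' m r' p.1 0 p.2) := by
      have := hr'.comp (fun p : Fin (m + 1) × ULift.{u} ℕ =>
        if h : p.1.1 < m then Sum.inl ((⟨p.1, h⟩ : Fin m), p.2) else Sum.inr (0, p.2))
      convert this using 2 with p p
      · by_cases h : p.1.1 < m
        · simp [h]
        · have : p.1.1 = m := by omega
          simp [this, flat]
      · by_cases h : p.1.1 < m
        · simp [h, Function.update_of_ne h.ne]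
        · have : p.1.1 = m := by omega
          simp [this, flat]
    obtain ⟨g, hg, hgC, hgs⟩ := h1'
    refine ⟨Function.update s' m r', Function.update a m fun k => g (x k), ⟨g, hg, hgC, hgs⟩,
      fun i hi => ?_, fun j hj i hij => ?_, fun i hi j hj => ?_⟩
    · rcases Nat.lt_succ_iff_lt_or_eq.1 hi with h | rfl
      · rw [Function.update_of_ne h.ne]
        exact h2 i h
      · rw [Function.update_self]
        exact hr'.inr
    · have him : i < m := by omega
      rw [Function.update_of_ne him.ne]
      rcases Nat.lt_succ_iff_lt_or_eq.1 hj with h | rfl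
      · rw [Function.update_of_ne h.ne]
        exact h3 j h i hij
      · rw [Function.update_self]
        refine hi.mono ?_
        rintro _ ⟨k, rfl⟩
        exact Or.inr ⟨(⟨i, him⟩, ⟨k⟩), rfl⟩
    · rcases Nat.lt_succ_iff_lt_or_eq.1 hi with h | rfl
      · rw [Function.update_of_ne h.ne, Function.update_of_ne (hj.trans_lt h).ne]
        exact h4 i h j hj
      · rw [Function.update_self]
        refine ⟨g, hg, hgC, ?_⟩
        rintro (k | k)
        · rfl
        · exact hgs (⟨j, by omega⟩, k)

/-- In a stable theory the chains that witness repeated dividing in the same way have bounded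
length. If they were arbitrarily long, compactness would give a chain along a linear order with a
small dense subset `J`, together with a tuple at each cut, and the tuples would have distinct types
over the sequences with index in `J`. -/
theorem exists_no_chain (hU : U.Stable) {n : ℕ} {a : Fin n → E} {r : ℕ → ULift.{u} ℕ → E}
    (hr : ¬ ∃ x : Fin n → E, ∀ k, Conj G ∅ (Sum.elim x (r k)) (Sum.elim a (r 0))) :
    ∃ N, ¬ ∃ (x : Fin n → E) (s : ℕ → ℕ → ULift.{u} ℕ → E), ∀ i < N,
      Conj G ∅ (Sum.elim x (s i 0)) (Sum.elim a (r 0)) ∧ Conj G ∅ (flat (s i)) (flat r) ∧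
      Indisc G (Set.range fun p : Fin i × ULift.{u} ℕ => s p.1 0 p.2) (s i) := by
  classical
  by_contra! hcon
  obtain ⟨μ, hμ, hμκ, hst⟩ := hU
  obtain ⟨I, _, J, hJ, hI, hI', hd⟩ := exists_dense_order hμ
  have hIκ : #I < κ := hI'.trans_lt (U.two_power_lt hμκ)
  let Om := ULift.{u} ℕ
  have hOm : #Om < κ := U.mk_omega_lt
  let tA (x : (I × ULift.{u} (Fin n)) ⊕ (I × ℕ × Om) → E) (i : I) : Fin n → E :=
    fun k => x (Sum.inl (i, ⟨k⟩))
  let tS (x : (I × ULift.{u} (Fin n)) ⊕ (I × ℕ × Om) → E) (j : I) : ℕ → Om → E :=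
    fun l e => x (Sum.inr (j, l, e))
  have hfinOm : #(Fin n ⊕ Om) < κ := by
    rw [mk_sum, mk_fin, lift_natCast, lift_uzero]
    exact add_lt_of_lt U.aleph0_lt.le (U.inacc.nat_lt n) hOm
  have hOmfin : #(Om ⊕ Fin n) < κ := by
    rw [mk_sum, mk_fin, lift_natCast, lift_uzero]
    exact add_lt_of_lt U.aleph0_lt.le hOm (U.inacc.nat_lt n)
  obtain ⟨x, hx⟩ := U.exists_of_closed (V := (I × ULift.{u} (Fin n)) ⊕ (I × ℕ × Om)) (J := I × I)
    (U.mk_sum_lt (U.mk_prod_lt hIκ U.mk_fin_lt) (U.mk_prod_lt hIκ (U.mk_nat_prod_lt hOm)))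
    (U.mk_prod_lt hIκ hIκ)
    (P := fun ij x =>
      (ij.2 ≤ ij.1 → Conj G ∅ (Sum.elim (tA x ij.1) (tS x ij.2 0)) (Sum.elim a (r 0))) ∧
      (ij.1 < ij.2 → Indisc G ∅ (fun l => Sum.elim (tS x ij.2 l) (tA x ij.1)) ∧
        ∀ k, U.srt (Sum.elim (tS x ij.2 0) (tA x ij.1) k) = U.srt (Sum.elim (r 0) a k)) ∧
      Conj G ∅ (flat (tS x ij.2)) (flat r))
    (fun ij => (Closed.imp _ (U.closed_conj U.mk_empty_lt hfinOm _
        (Sum.elim (fun k => Sum.inl (Sum.inl (ij.1, ⟨k⟩))) fun e => Sum.inl (Sum.inr (ij.2, 0, e)))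
        (by rintro x (k | k) <;> rfl))).and
      ((Closed.imp _ (U.closed_indisc U.mk_empty_lt hOmfin (Sum.elim (r 0) a)
        (fun p => Sum.elim (fun e => Sum.inl (Sum.inr (ij.2, p.1, e)))
          (fun k => Sum.inl (Sum.inl (ij.1, ⟨k⟩))) p.2)
        (by rintro x l (k | k) <;> rfl))).and
      (U.closed_conj U.mk_empty_lt (U.mk_nat_prod_lt hOm) _
        (fun p => Sum.inl (Sum.inr (ij.2, p.1, p.2))) (fun _ _ => rfl)))) (by
      intro J₀
      let D : Finset I := J₀.image Prod.fst ∪ J₀.image Prod.snd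
      obtain ⟨x, s, hxs⟩ := hcon D.card
      obtain ⟨s', b, h1, h2, h3⟩ := U.exists_ladder (x := x) fun i hi => (hxs i hi).2.2
      let e := D.orderIsoOfFin rfl
      refine ⟨Sum.elim (fun p => if h : p.1 ∈ D then b (e.symm ⟨p.1, h⟩) p.2.down else a p.2.down)
        (fun p => if h : p.1 ∈ D then s' (e.symm ⟨p.1, h⟩) p.2.1 p.2.2 else r p.2.1 p.2.2),
        ?_⟩
      rintro ⟨i, j⟩ hij
      have hi : i ∈ D := Finset.mem_union_left _ (Finset.mem_image_of_mem _ hij)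
      have hj : j ∈ D := Finset.mem_union_right _ (Finset.mem_image_of_mem _ hij)
      obtain ⟨i', hi'⟩ : ∃ i', e.symm ⟨i, hi⟩ = i' := ⟨_, rfl⟩
      obtain ⟨j', hj'⟩ : ∃ j', e.symm ⟨j, hj⟩ = j' := ⟨_, rfl⟩
      generalize hy : Sum.elim (fun p : I × ULift.{u} (Fin n) => if h : p.1 ∈ D then
        b (e.symm ⟨p.1, h⟩) p.2.down else a p.2.down) (fun p : I × ℕ × Om => if h : p.1 ∈ D then
        s' (e.symm ⟨p.1, h⟩) p.2.1 p.2.2 else r p.2.1 p.2.2) = y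
      have hyA : tA y i = b i' := by
        funext k
        rw [← hy, ← hi']
        exact dif_pos hi
      have hyS : tS y j = s' j' := by
        funext l k
        rw [← hy, ← hj']
        exact dif_pos hj
      have hle : j ≤ i ↔ j'.1 ≤ i'.1 := by
        rw [← hi', ← hj', Fin.val_fin_le, e.symm.le_iff_le]
        rfl
      have hlt : i < j ↔ i'.1 < j'.1 := by rw [← not_le, hle, not_le]
      rw [hle, hlt, hyA, hyS]
      have hsj : Conj G ∅ (flat (s' j')) (flat r) := (h1 j' j'.2).symm.trans (hxs j' j'.2).2.1
      have hbi : Conj G ∅ (Sum.elim (b i') (s' i' 0)) (Sum.elim a (r 0)) :=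
        (h3 i' i'.2 i' le_rfl).symm.trans (hxs i' i'.2).1
      refine ⟨fun h => (h3 i' i'.2 j' h).symm.trans (hxs j' j'.2).1, fun h => ⟨?_, ?_⟩, hsj⟩
      · rw [indisc_sum_iff, Set.empty_union]
        exact h2 j' j'.2 i' h
      · rintro (k | k)
        · exact U.srt_eq_of_conj hsj (0, k)
        · exact U.srt_eq_of_conj hbi.inl k)
  have hx1 : ∀ i j, j ≤ i → Conj G ∅ (Sum.elim (tA x i) (tS x j 0)) (Sum.elim a (r 0)) :=
    fun i j => (hx (i, j)).1
  have hx2 : ∀ i j, i < j → Indisc G (Set.range (tA x i)) (tS x j) := fun i j h => by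
    have := ((hx (i, j)).2.1 h).1
    rwa [indisc_sum_iff, Set.empty_union] at this
  have hx3 : ∀ j, Conj G ∅ (flat (tS x j)) (flat r) := fun j => (hx (j, j)).2.2
  let B : Set E := Set.range fun p : J × ℕ × Om => tS x p.1 p.2.1 p.2.2
  have hB : #B ≤ μ := by
    refine mk_range_le.trans ?_
    rw [mk_prod, mk_prod, mk_uLift, mk_nat]
    simp only [lift_id, lift_aleph0, lift_uzero]
    exact mul_le_of_le hμ hJ (mul_le_of_le hμ hμ hμ)
  refine hI.not_ge (hst B hB n I (tA x) (fun i i' k => ?_) ?_)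
  · rw [U.srt_eq_of_conj (hx1 i i le_rfl).inl k, U.srt_eq_of_conj (hx1 i' i' le_rfl).inl k]
  -- The sequence attached to an index between `i` and `i'` is indiscernible over one of the
  -- tuples, but not over the other.
  have key : ∀ i i', i < i' → ¬ Conj G B (tA x i) (tA x i') := by
    intro i i' hii' hc
    obtain ⟨j, hjJ, hij, hji'⟩ := hd i i' hii'
    have hB' : ∀ l, Conj G ∅ (Sum.elim (tA x i) (tS x j l)) (Sum.elim (tA x i') (tS x j l)) := by
      intro l
      refine conj_sum_iff.2 (hc.mono ?_)
      rw [Set.empty_union]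
      rintro _ ⟨e, rfl⟩
      exact ⟨(⟨j, hjJ⟩, l, e), rfl⟩
    have hB'' : ∀ l, Conj G ∅ (Sum.elim (tA x i') (tS x j l)) (Sum.elim a (r 0)) := by
      intro l
      refine (hB' l).symm.trans (Conj.trans ?_ ((hB' 0).trans (hx1 i' j hji')))
      refine conj_sum_iff'.2 ?_
      rw [Set.empty_union]
      exact (hx2 i j hij).conj l 0
    obtain ⟨g, hg, hg0, hgr⟩ := hx3 j
    -- All entries of the sequence have the same type over the second tuple, against `hr`.
    refine hr ⟨fun k => g (tA x i' k), fun l => Conj.trans (Conj.symm ?_) (hB'' l)⟩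
    have h5 := conj_sum_elim (C := ∅) hg hg0 (tA x i') (tS x j l)
    simp only [show ∀ e, g (tS x j l e) = r l e from fun e => hgr (l, e)] at h5
    exact h5
  intro i i' h
  rcases lt_trichotomy i i' with hlt | heq | hlt
  · exact absurd h (key i i' hlt)
  · exact heq
  · exact absurd h.symm (key i' i hlt)

/-- In a stable theory a finite tuple does not alternate infinitely often along an indiscernible
sequence. Otherwise every binary colouring of a stretched sequence would be induced by a tuple. -/
theorem conj_of_alternating (hU : U.Stable) {β η : Type u} [Finite β] [Finite η] {b : β → E}
    {t : ℕ → η → E} (ht : Indisc G ∅ t)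
    (h0 : ∀ k, Conj G ∅ (Sum.elim b (t (2 * k))) (Sum.elim b (t 0)))
    (h1 : ∀ k, Conj G ∅ (Sum.elim b (t (2 * k + 1))) (Sum.elim b (t 1))) :
    Conj G ∅ (Sum.elim b (t 0)) (Sum.elim b (t 1)) := by
  classical
  by_contra hne
  obtain ⟨μ, hμ, hμκ, hst⟩ := hU
  let W := μ.ord.ToType
  have hW : #W = μ := mk_ord_toType μ
  have hη : #η < κ := (lt_aleph0_of_finite η).trans U.aleph0_lt
  have hβ : #β < κ := (lt_aleph0_of_finite β).trans U.aleph0_lt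
  obtain ⟨T, hT⟩ := U.stretch U.mk_empty_lt hη ht W (by rwa [hW])
  have : ∀ ε : W → Bool, ∃ x : β → E, ∀ w,
      Conj G ∅ (Sum.elim x (T w)) (Sum.elim b (t (ε w).toNat)) := by
    intro ε
    refine U.exists_of_closed (V := β) (J := W) hβ (by rwa [hW])
      (fun w => U.closed_conj U.mk_empty_lt (U.mk_sum_lt hβ hη) _
        (Sum.elim Sum.inl fun j => Sum.inr (T w j)) (by rintro x (i | j) <;> rfl)) fun J₀ => ?_
    let f := J₀.orderEmbOfFin rfl
    obtain ⟨g, hg, hg0, hgT⟩ := hT J₀.card f (fun k => 2 * k + (ε (f k)).toNat) f.strictMono (by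
      intro k l hkl
      have : k.1 < l.1 := hkl
      have := Bool.toNat_le (ε (f k))
      simp only
      omega)
    refine ⟨fun i => g⁻¹ (b i), fun w hw => ?_⟩
    obtain ⟨k, rfl⟩ : ∃ k, f k = w := by
      have : w ∈ Set.range f := by simpa [f] using hw
      exact this
    refine Conj.trans (conj_sum_elim hg hg0 _ _) ?_
    simp only [Equiv.Perm.coe_inv, Equiv.apply_symm_apply]
    rw [show (fun i => g (T (f k) i)) = t (2 * k + (ε (f k)).toNat) from
      funext fun i => hgT (k, i)]
    cases ε (f k)
    · exact h0 k
    · exact h1 k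
  choose x hx using this
  let e := Finite.equivFin β
  have hcard := hst (Set.range (flat T)) (by
    refine mk_range_le.trans ?_
    rw [mk_prod, lift_id, lift_id, hW]
    exact mul_le_of_le hμ le_rfl ((lt_aleph0_of_finite η).le.trans hμ)) (Nat.card β) (W → Bool)
    (fun ε i => x ε (e.symm i)) (fun ε ε' i => by
      rcases isEmpty_or_nonempty W with hW0 | ⟨⟨w⟩⟩
      · rw [Subsingleton.elim ε ε']
      · rw [U.srt_eq_of_conj (hx ε w).inl, U.srt_eq_of_conj (hx ε' w).inl]) (by
      intro ε ε' hc
      by_contra hεε'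
      obtain ⟨w, hw⟩ := Function.ne_iff.1 hεε'
      have h2 : Conj G (Set.range (flat T)) (x ε) (x ε') := by
        simpa using hc.comp e
      have h3 : Conj G ∅ (Sum.elim (x ε) (T w)) (Sum.elim (x ε') (T w)) := by
        refine conj_sum_iff.2 (h2.mono ?_)
        rw [Set.empty_union]
        rintro _ ⟨j, rfl⟩
        exact ⟨(w, j), rfl⟩
      have h4 := (hx ε w).symm.trans (h3.trans (hx ε' w))
      cases h5 : ε w <;> cases h6 : ε' w <;> rw [h5, h6] at h4
      · exact hw (h5.trans h6.symm)
      · exact hne h4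
      · exact hne h4.symm
      · exact hw (h5.trans h6.symm))
  rw [mk_arrow_bool, hW] at hcard
  exact (cantor μ).not_ge hcard

/-- In a stable theory the first two entries of an indiscernible sequence over `C` have the same
type over every tuple that is independent from them. Consecutive pairs form an indiscernible
sequence, which may be taken to be indiscernible over a copy of the tuple; if the two types were
different, they would alternate. -/
theorem conj_of_nd_pair (hU : U.Stable) {ι η : Type u} {C : Set E} (hC : #C < κ) (hι : #ι < κ)
    (hη : #η < κ) {s : ℕ → ι → E} (hs : Indisc G C s) {b : η → E}
    (h : ND G C b (Sum.elim (s 0) (s 1))) : Conj G (C ∪ Set.range b) (s 0) (s 1) := by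
  classical
  let v : ℕ → ι ⊕ ι → E := fun k => Sum.elim (s (2 * k)) (s (2 * k + 1))
  have hv : Indisc G C v := by
    intro n f g hf hg
    have := (hs.conj_of_le_iff (Z := Fin n × Bool) (p := fun z => 2 * f z.1 + z.2.toNat)
      (q := fun z => 2 * g z.1 + z.2.toNat) (by
        rintro ⟨k, ε⟩ ⟨k', ε'⟩
        have := Bool.toNat_le ε
        have := Bool.toNat_le ε'
        simp only
        rcases lt_trichotomy k k' with hk | rfl | hk
        · have := hf hk
          have := hg hk
          omega
        · omega
        · have := hf hk
          have := hg hk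
          omega)).comp (fun p : Fin n × (ι ⊕ ι) => Sum.elim (fun i => ((p.1, false), i))
            (fun i => ((p.1, true), i)) p.2)
    convert this using 2 <;> · rename_i p; obtain ⟨p, i | i⟩ := p <;> rfl
  obtain ⟨b', hb', hi⟩ := ND.exists_indisc' U hC hη (U.mk_sum_lt hι hι) hv (b := v 0) rfl h
  have hbC : ∀ k, Conj G (C ∪ Set.range b') (v k) (v 0) := fun k => hi.conj k 0
  suffices hmain : Conj G C (Sum.elim b' (s 0)) (Sum.elim b' (s 1)) by
    have e0 : Conj G C (Sum.elim b' (s 0)) (Sum.elim b (s 0)) := hb'.sum_map id Sum.inl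
    have e1 : Conj G C (Sum.elim b' (s 1)) (Sum.elim b (s 1)) := hb'.sum_map id Sum.inr
    exact conj_sum_iff'.1 ((e0.symm.trans hmain).trans e1)
  refine U.conj_of_finite hC (U.mk_sum_lt hη hι) fun F hF C₀ hC₀ hC₀f => ?_
  let F₁ : Set η := Sum.inl ⁻¹' F
  let F₂ : Set ι := Sum.inr ⁻¹' F
  have hF₁ : Finite F₁ := (hF.preimage Sum.inl_injective.injOn).to_subtype
  have hF₂ : Finite F₂ := (hF.preimage Sum.inr_injective.injOn).to_subtype
  have hC₀' : Finite C₀ := hC₀f.to_subtype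
  have hstep : ∀ k l (f : ι → ι ⊕ ι), Conj G ∅
      (Sum.elim (fun i : F₁ => b' i)
        (Sum.elim (fun i : F₂ => v k (f i)) (Subtype.val : C₀ → E)))
      (Sum.elim (fun i : F₁ => b' i)
        (Sum.elim (fun i : F₂ => v l (f i)) (Subtype.val : C₀ → E))) := by
    intro k l f
    obtain ⟨g, hg, hgC, hgv⟩ := (hbC k).trans (hbC l).symm
    refine ⟨g, hg, by simp, ?_⟩
    rintro (i | i | c)
    · exact hgC _ (Or.inr ⟨i, rfl⟩)
    · exact hgv (f i)
    · exact hgC _ (Or.inl (hC₀ c.2))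
  have hfin := U.conj_of_alternating hU (b := fun i : F₁ => b' i)
    (t := fun k => Sum.elim (fun i : F₂ => s k i) (Subtype.val : C₀ → E))
    (indisc_sum_iff.2 ((hs.comp _).mono (by simpa using hC₀)))
    (fun k => hstep k 0 Sum.inl) (fun k => hstep k 0 Sum.inr)
  obtain ⟨g, hg, -, hgx⟩ := hfin
  refine ⟨g, hg, fun c hc => hgx (Sum.inr (Sum.inr ⟨c, hc⟩)), ?_⟩
  rintro ⟨i | i, hi⟩
  · exact hgx (Sum.inl ⟨i, hi⟩)
  · exact hgx (Sum.inr (Sum.inl ⟨i, hi⟩))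

end Presentation

/-! ### Extending the base of a type -/

/-- The data of an instance of dividing for a tuple indexed by `ι`: a finite part `F` of the
tuple, and representatives `A` and `r` of the type of this part over the first entry of a
sequence, and of the type of the sequence. -/
structure Label (ι E : Type u) where
  /-- The size of the finite part. -/
  n : ℕ
  /-- The finite part. -/
  F : Fin n → ι
  /-- A representative of the finite part. -/
  A : Fin n → E
  /-- A representative of the sequence. -/
  r : ℕ → ULift.{u} ℕ → E

namespace Label

variable {E ι : Type u} (G : Subgroup (Equiv.Perm E))

/-- The label describes an instance of dividing. -/
def Bad (ℓ : Label ι E) : Prop :=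
  ¬ ∃ x : Fin ℓ.n → E, ∀ k, Conj G ∅ (Sum.elim x (ℓ.r k)) (Sum.elim ℓ.A (ℓ.r 0))

/-- The tuple `x` and the sequence `s` are as the label says. -/
def Fits (ℓ : Label ι E) (x : ι → E) (s : ℕ → ULift.{u} ℕ → E) : Prop :=
  Conj G ∅ (Sum.elim (fun i => x (ℓ.F i)) (s 0)) (Sum.elim ℓ.A (ℓ.r 0)) ∧
    Conj G ∅ (flat s) (flat ℓ.r)

end Label

namespace Presentation

variable {E : Type u} {G : Subgroup (Equiv.Perm E)} {κ : Cardinal.{u}} (U : Presentation G κ)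

/-- The invariants that determine which tuples and sequences fit a label. -/
def code {ι : Type u} (ℓ : Label ι E) : Σ n : ULift.{u} ℕ, (Fin n.down → ι) ×
    Set (U.Inst ((Fin n.down ⊕ (ℕ × ULift.{u} ℕ)) ⊕ (∅ : Set E))) :=
  ⟨⟨ℓ.n⟩, ℓ.F, U.tpOver ∅ (Sum.elim ℓ.A (flat ℓ.r))⟩

include U

theorem fits_of_code {ι : Type u} {ℓ ℓ' : Label ι E} (h : U.code ℓ = U.code ℓ') {x : ι → E}
    {s : ℕ → ULift.{u} ℕ → E} (hs : ℓ.Fits G x s) : ℓ'.Fits G x s := by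
  obtain ⟨n, F, A, r⟩ := ℓ
  obtain ⟨n', F', A', r'⟩ := ℓ'
  simp only [code] at h
  obtain ⟨h1, h2⟩ := Sigma.mk.inj_iff.1 h
  obtain rfl : n = n' := congrArg ULift.down h1
  obtain ⟨rfl, h3⟩ := Prod.ext_iff.1 (eq_of_heq h2)
  have h4 := (U.conj_iff_tpOver U.mk_empty_lt ((mk_sum (Fin n) _).trans_lt (by
    rw [mk_fin, lift_natCast, lift_uzero]
    exact add_lt_of_lt U.aleph0_lt.le (U.inacc.nat_lt n) (U.mk_nat_prod_lt U.mk_omega_lt)))).2 h3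
  exact ⟨hs.1.trans (h4.sum_map id fun j => (0, j)), hs.2.trans h4.inr⟩

/-- There are few labels, up to conjugacy. -/
theorem exists_labels {μ : Cardinal.{u}} (hμ : μ < κ) : ∃ ν < κ, ∀ ι : Type u, #ι ≤ μ →
    ∃ (Ξ : Type u) (lab : Ξ → Label ι E), #Ξ ≤ ν ∧ (∀ ξ, (lab ξ).Bad G) ∧
      ∀ (x : ι → E) (s : ℕ → ULift.{u} ℕ → E) (n : ℕ) (F : Fin n → ι),
        (¬ ∃ x' : Fin n → E, ∀ k,
          Conj G ∅ (Sum.elim x' (s k)) (Sum.elim (fun i => x (F i)) (s 0))) →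
        ∃ ξ, (lab ξ).Fits G x s := by
  let T (ι : Type u) := Σ n : ULift.{u} ℕ, (Fin n.down → ι) ×
    Set (U.Inst ((Fin n.down ⊕ (ℕ × ULift.{u} ℕ)) ⊕ (∅ : Set E)))
  refine ⟨#(T μ.out), U.mk_sigma_lt U.mk_omega_lt fun n => U.mk_prod_lt ?_ ?_, ?_⟩
  · rw [mk_arrow, mk_fin, lift_natCast, lift_uzero, mk_out]
    exact (power_nat_le_max).trans_lt (max_lt hμ U.aleph0_lt)
  · rw [mk_set]
    refine U.two_power_lt (U.mk_inst_lt (U.mk_sum_lt ?_ U.mk_empty_lt))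
    rw [mk_sum, mk_fin, lift_natCast, lift_uzero]
    exact add_lt_of_lt U.aleph0_lt.le (U.inacc.nat_lt _) (U.mk_nat_prod_lt U.mk_omega_lt)
  intro ι hι
  obtain ⟨e⟩ : Nonempty (ι ↪ μ.out) := by rwa [← Cardinal.le_def, mk_out]
  let Ξ := {t : T ι // ∃ ℓ : Label ι E, ℓ.Bad G ∧ U.code ℓ = t}
  choose lab hbad hcode using fun ξ : Ξ => ξ.2
  refine ⟨Ξ, lab, ?_, hbad, fun x s n F h => ?_⟩
  · refine (mk_subtype_le _).trans (mk_le_of_injective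
      (f := fun t : T ι => (⟨t.1, fun i => e (t.2.1 i), t.2.2⟩ : T μ.out)) ?_)
    rintro ⟨n, F, t⟩ ⟨n', F', t'⟩ htt
    obtain ⟨rfl, h2⟩ := Sigma.mk.inj_iff.1 htt
    obtain ⟨h3, rfl⟩ := Prod.ext_iff.1 (eq_of_heq h2)
    rw [show F = F' from funext fun i => e.injective (congrFun h3 i)]
  · let ℓ : Label ι E := ⟨n, F, fun i => x (F i), s⟩
    exact ⟨⟨U.code ℓ, ℓ, h, rfl⟩, U.fits_of_code (ℓ := ℓ)
      (hcode ⟨U.code ℓ, ℓ, h, rfl⟩).symm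
      ⟨Conj.refl _, Conj.refl _⟩⟩

/-- Chains of instances of dividing with the same label are short. -/
theorem Label.exists_no_chain (hU : U.Stable) {ι : Type u} {ℓ : Label ι E} (hℓ : ℓ.Bad G) :
    ∃ N, ¬ ∃ (x : ι → E) (s : ℕ → ℕ → ULift.{u} ℕ → E), ∀ i < N, ℓ.Fits G x (s i) ∧
      Indisc G (Set.range fun p : Fin i × ULift.{u} ℕ => s p.1 0 p.2) (s i) := by
  obtain ⟨N, hN⟩ := U.exists_no_chain hU hℓ
  exact ⟨N, fun ⟨x, s, h⟩ => hN ⟨fun i => x (ℓ.F i), s, fun i hi =>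
    ⟨(h i hi).1.1, (h i hi).1.2, (h i hi).2⟩⟩⟩

omit U in
/-- A pattern of instances of dividing, for a conjugate of `a` over `C`: for the indices in `S`
there are sequences with the given labels, each indiscernible over `B` and over the first entries
of the sequences with larger index. -/
def Pattern (G : Subgroup (Equiv.Perm E)) {ι X : Type u} [LinearOrder X] (a : ι → E) (C : Set E)
    (lab : X → Label ι E) (B : Set E) (S : Set X) : Prop :=
  ∃ (x : ι → E) (s : X → ℕ → ULift.{u} ℕ → E), Conj G C x a ∧ ∀ i ∈ S, (lab i).Fits G x (s i) ∧
    ∀ J : Finset X, (∀ j ∈ J, j ∈ S ∧ i < j) →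
      Indisc G (B ∪ Set.range fun p : J × ULift.{u} ℕ => s p.1 0 p.2) (s i)

omit U in
theorem Pattern.mono {ι X : Type u} [LinearOrder X] {a : ι → E} {C B : Set E}
    {lab : X → Label ι E} {S S' : Set X} (h : Pattern G a C lab B S) (hS : S' ⊆ S) :
    Pattern G a C lab B S' := by
  obtain ⟨x, s, hx, hs⟩ := h
  exact ⟨x, s, hx, fun i hi => ⟨(hs i (hS hi)).1, fun J hJ =>
    (hs i (hS hi)).2 J fun j hj => ⟨hS (hJ j hj).1, (hJ j hj).2⟩⟩⟩

/-- Compactness for patterns. -/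
theorem Pattern.of_finite {ι X : Type u} [LinearOrder X] {a : ι → E} {C B : Set E} (hC : #C < κ)
    (hB : #B < κ) (hι : #ι < κ) (hX : #X < κ) {lab : X → Label ι E} {S : Set X}
    (h : ∀ S₀ : Finset X, ↑S₀ ⊆ S → Pattern G a C lab B S₀) : Pattern G a C lab B S := by
  classical
  let Om := ULift.{u} ℕ
  have hOm : #Om < κ := U.mk_omega_lt
  let tS (x : ι ⊕ (X × ℕ × Om) → E) (j : X) : ℕ → Om → E := fun l e => x (Sum.inr (j, l, e))
  rcases isEmpty_or_nonempty X with hX0 | hX0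
  · exact (h ∅ (by simp)).mono fun i => isEmptyElim i
  obtain ⟨y, hy⟩ := U.exists_of_closed (V := ι ⊕ (X × ℕ × Om)) (J := X × Finset X)
    (U.mk_sum_lt hι (U.mk_prod_lt hX (U.mk_nat_prod_lt hOm)))
    (U.mk_prod_lt hX (U.mk_finset_lt hX))
    (P := fun j x => Conj G C (fun i => x (Sum.inl i)) a ∧ (j.1 ∈ S →
      Conj G ∅ (Sum.elim (fun i => x (Sum.inl ((lab j.1).F i))) (tS x j.1 0))
        (Sum.elim (lab j.1).A ((lab j.1).r 0)) ∧
      Conj G ∅ (flat (tS x j.1)) (flat (lab j.1).r) ∧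
      ((∀ k ∈ j.2, k ∈ S ∧ j.1 < k) →
        Indisc G B (fun l => Sum.elim (tS x j.1 l) fun p : j.2 × Om => tS x p.1 0 p.2) ∧
        ∀ k, U.srt (Sum.elim (tS x j.1 0) (fun p : j.2 × Om => tS x p.1 0 p.2) k) =
          U.srt (Sum.elim ((lab j.1).r 0) (fun p : j.2 × Om => (lab p.1).r 0 p.2) k))))
    (fun j => (U.closed_conj hC hι _ (fun i => Sum.inl (Sum.inl i)) fun _ _ => rfl).and
      (Closed.imp _ ((U.closed_conj U.mk_empty_lt (by
          rw [mk_sum, mk_fin, lift_natCast, lift_uzero]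
          exact add_lt_of_lt U.aleph0_lt.le (U.inacc.nat_lt _) hOm) _
        (Sum.elim (fun i => Sum.inl (Sum.inl ((lab j.1).F i)))
          fun e => Sum.inl (Sum.inr (j.1, 0, e)))
        (by rintro x (i | i) <;> rfl)).and
        ((U.closed_conj U.mk_empty_lt (U.mk_nat_prod_lt hOm) _
          (fun p => Sum.inl (Sum.inr (j.1, p.1, p.2))) (fun _ _ => rfl)).and
        (Closed.imp _ (U.closed_indisc hB (U.mk_sum_lt hOm (U.mk_prod_lt
            ((mk_subtype_le _).trans_lt hX) hOm)) (Sum.elim ((lab j.1).r 0)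
              (fun p : j.2 × Om => (lab p.1).r 0 p.2))
          (fun q => Sum.elim (fun e => Sum.inl (Sum.inr (j.1, q.1, e)))
            (fun p => Sum.inl (Sum.inr (p.1, 0, p.2))) q.2)
          (by rintro x l (i | i) <;> rfl))))))) (by
      intro J₀
      let S₀ : Finset X := (J₀.biUnion fun j => insert j.1 j.2).filter (· ∈ S)
      obtain ⟨x, s, hx, hs⟩ := h S₀ fun i hi => by simpa using (Finset.mem_filter.1 hi).2
      refine ⟨Sum.elim x fun p => s p.1 p.2.1 p.2.2, fun j hj => ⟨hx, fun hjS => ?_⟩⟩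
      have hjS₀ : ∀ k ∈ insert j.1 j.2, k ∈ S → k ∈ S₀ := fun k hk hkS =>
        Finset.mem_filter.2 ⟨Finset.mem_biUnion.2 ⟨j, hj, hk⟩, hkS⟩
      obtain ⟨hf, hi⟩ := hs j.1 (hjS₀ _ (Finset.mem_insert_self _ _) hjS)
      refine ⟨hf.1, hf.2, fun hk => ⟨indisc_sum_iff.2 (hi j.2 fun k hk' =>
        ⟨hjS₀ k (Finset.mem_insert_of_mem hk') (hk k hk').1, (hk k hk').2⟩), ?_⟩⟩
      rintro (e | ⟨k, e⟩)
      · exact U.srt_eq_of_conj hf.2 (0, e)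
      · exact U.srt_eq_of_conj (hs k.1 (hjS₀ k (Finset.mem_insert_of_mem k.2)
          (hk k k.2).1)).1.2 (0, e))
  refine ⟨fun i => y (Sum.inl i), tS y, (hy (Classical.arbitrary X, ∅)).1,
    fun i hi => ⟨?_, fun J hJ => ?_⟩⟩
  · exact ⟨((hy (i, ∅)).2 hi).1, ((hy (i, ∅)).2 hi).2.1⟩
  · exact indisc_sum_iff.1 ((((hy (i, J)).2 hi).2.2 hJ).1)

/-- A finite pattern over `C` can be moved to a pattern over `C ∪ D`, by realigning its sequences one
after the other, starting with the largest index. -/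
theorem Pattern.union {ι X : Type u} [LinearOrder X] {a : ι → E} {C D : Set E} (hC : #C < κ)
    (hD : #D < κ) {lab : X → Label ι E} {S : Finset X} (h : Pattern G a C lab C S) :
    Pattern G a C lab (C ∪ D) S := by
  classical
  let Om := ULift.{u} ℕ
  have key : ∀ s : X → ℕ → Om → E, (∀ i ∈ S, ∀ J : Finset X, (∀ j ∈ J, j ∈ S ∧ i < j) →
        Indisc G (C ∪ Set.range fun p : J × Om => s p.1 0 p.2) (s i)) →
      ∃ s' : X → ℕ → Om → E,
        Conj G C (fun p : S × Om => s p.1 0 p.2) (fun p : S × Om => s' p.1 0 p.2) ∧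
        ∀ i ∈ S, Conj G ∅ (flat (s i)) (flat (s' i)) ∧
          ∀ J : Finset X, (∀ j ∈ J, j ∈ S ∧ i < j) →
            Indisc G (C ∪ D ∪ Set.range fun p : J × Om => s' p.1 0 p.2) (s' i) := by
    clear h
    induction S using Finset.induction_on_min with
    | empty => exact fun s _ => ⟨s, Conj.refl _, by simp⟩
    | insert a S ha ih =>
      intro s hs
      obtain ⟨s', h1, h2⟩ := ih s fun i hi J hJ => hs i (Finset.mem_insert_of_mem hi) J
        fun j hj => ⟨Finset.mem_insert_of_mem (hJ j hj).1, (hJ j hj).2⟩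
      obtain ⟨r', hr', hi⟩ := U.exists_realign (D := D) hC hD U.mk_omega_lt
        (mk_range_lt (U.mk_prod_lt ((Finset.finite_toSet S).lt_aleph0.trans U.aleph0_lt)
          U.mk_omega_lt) _) h1 (hs a (Finset.mem_insert_self _ _) S
          fun j hj => ⟨Finset.mem_insert_of_mem hj, ha j hj⟩)
      have hne : ∀ j ∈ S, Function.update s' a r' j = s' j := fun j hj =>
        Function.update_of_ne (ha j hj).ne' _ _
      refine ⟨Function.update s' a r', ?_, fun i hiS => ?_⟩
      · have := hr'.comp (fun p : ↥(insert a S) × Om =>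
          if h : p.1.1 ∈ S then Sum.inl ((⟨p.1, h⟩ : S), p.2) else Sum.inr (0, p.2))
        convert this using 2 with p p
        · by_cases h : p.1.1 ∈ S
          · simp [h]
          · have : p.1.1 = a := (Finset.mem_insert.1 p.1.2).resolve_right h
            rw [dif_neg h, this]
            rfl
        · by_cases h : p.1.1 ∈ S
          · simp [h, hne _ h]
          · have : p.1.1 = a := (Finset.mem_insert.1 p.1.2).resolve_right h
            rw [dif_neg h, this, Function.update_self]
            rfl
      · have hJS : ∀ J : Finset X, (∀ j ∈ J, j ∈ insert a S ∧ i < j) → ∀ j ∈ J, j ∈ S := by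
          intro J hJ j hj
          refine (Finset.mem_insert.1 (hJ j hj).1).resolve_left fun h => ?_
          rcases Finset.mem_insert.1 hiS with h' | h'
          · exact (hJ j hj).2.ne (h'.trans h.symm)
          · exact ((ha i h').trans (hJ j hj).2).ne h.symm
        have hrange : ∀ J : Finset X, (∀ j ∈ J, j ∈ insert a S ∧ i < j) →
            (fun p : J × Om => Function.update s' a r' p.1 0 p.2) =
              fun p : J × Om => s' p.1 0 p.2 := by
          intro J hJ
          funext p
          rw [hne _ (hJS J hJ p.1 p.1.2)]
        rcases Finset.mem_insert.1 hiS with rfl | h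
        · rw [Function.update_self]
          refine ⟨hr'.inr.mono (Set.empty_subset _), fun J hJ => hi.mono ?_⟩
          rw [hrange J hJ, Set.union_right_comm]
          refine Set.union_subset_union_left _ (Set.union_subset_union_right _ ?_)
          rintro _ ⟨p, rfl⟩
          exact ⟨(⟨p.1, hJS J hJ _ p.1.2⟩, p.2), rfl⟩
        · rw [hne i h]
          refine ⟨(h2 i h).1, fun J hJ => ?_⟩
          rw [hrange J hJ]
          exact (h2 i h).2 J fun j hj => ⟨hJS J hJ j hj, (hJ j hj).2⟩
  obtain ⟨x, s, hx, hs⟩ := h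
  obtain ⟨s', ⟨g, hg, hgC, hgs⟩, h2⟩ := key s fun i hi => (hs i hi).2
  refine ⟨fun i => g (x i), s', Conj.trans (Conj.symm ⟨g, hg, hgC, fun _ => rfl⟩) hx,
    fun i hi => ⟨⟨Conj.trans (Conj.symm ⟨g, hg, by simp, ?_⟩) (hs i hi).1.1,
      (h2 i hi).1.symm.trans (hs i hi).1.2⟩, (h2 i hi).2⟩⟩
  rintro (k | k)
  · rfl
  · exact hgs (⟨i, hi⟩, k)

omit U in
/-- A set of indices chosen greedily: an index is taken whenever this is compatible with the
smaller indices that have been taken. -/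
theorem exists_greedy {X : Type u} [LinearOrder X] [WellFoundedLT X] (P : Set X → Prop) :
    ∃ 𝒢 : Set X, ∀ y, y ∈ 𝒢 ↔ P ({z | z ∈ 𝒢 ∧ z < y} ∪ {y}) := by
  obtain ⟨t, ht⟩ := exists_wf_seq (X := X) (α := Prop)
    (fun y p v => v = P ({z | ∃ h : z < y, p ⟨z, h⟩} ∪ {y})) (fun _ _ => ⟨_, rfl⟩)
  refine ⟨{y | t y}, fun y => ?_⟩
  rw [Set.mem_ofPred_eq, ht y]
  simp only [Set.mem_ofPred_eq, exists_prop, and_comm]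

/-- In a stable theory every type over `C` extends to a type over a larger set that does not divide
over `C`. The extension is realised by the tuple of a greedily chosen pattern of instances of dividing
that lives over the larger set: one more instance of dividing could be added to the pattern, at an
index that the greedy choice has rejected. -/
theorem exists_conj_nd (hU : U.Stable) {ι η : Type u} {C : Set E} (hC : #C < κ) (hι : #ι < κ)
    (hη : #η < κ) (a : ι → E) (b : η → E) : ∃ a' : ι → E, Conj G C a' a ∧ ND G C a' b := by
  classical
  wlog hCb : C ⊆ Set.range b generalizing η
  · obtain ⟨a', ha', h⟩ := this (U.mk_sum_lt hC hη) (Sum.elim (Subtype.val : C → E) b) (by simp)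
    exact ⟨a', ha', ND.comp_right U hC (U.mk_sum_lt hC hη) hη h Sum.inr⟩
  obtain ⟨ν, hν, hlab⟩ := U.exists_labels hι
  obtain ⟨Ξ, lab₀, hΞ, hbad, hfit⟩ := hlab ι le_rfl
  -- Every label occurs infinitely often.
  let X := Ξ × ULift.{u} ℕ
  have hX : #X < κ := U.mk_prod_lt (hΞ.trans_lt hν) U.mk_omega_lt
  let lab : X → Label ι E := fun i => lab₀ i.1
  let : LinearOrder X := linearOrderOfSTO WellOrderingRel
  have : WellFoundedLT X := ⟨(WellOrderingRel.isWellOrder (α := X)).wf⟩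
  obtain ⟨𝒢, h𝒢⟩ := exists_greedy (Pattern G a C lab C)
  have hfin : ∀ S₀ : Finset X, ↑S₀ ⊆ 𝒢 → Pattern G a C lab C S₀ := by
    intro S₀ hS₀
    rcases S₀.eq_empty_or_nonempty with rfl | hne
    · exact ⟨a, fun i => (lab i).r, Conj.refl _, by simp⟩
    · refine ((h𝒢 _).1 (hS₀ (S₀.max'_mem hne))).mono fun i hi => ?_
      rcases (S₀.le_max' i hi).lt_or_eq with h | h
      · exact Or.inl ⟨hS₀ hi, h⟩
      · exact Or.inr h
  obtain ⟨x, s, hx, hs⟩ := Pattern.of_finite U (B := C ∪ Set.range b) hC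
    (U.mk_union_lt hC (mk_range_lt hη b)) hι hX fun S₀ hS₀ =>
      Pattern.union U hC (mk_range_lt hη b) (hfin S₀ hS₀)
  refine ⟨x, hx, by_contra fun hnd => ?_⟩
  obtain ⟨n, F, H, s', hs', hs'0, hno⟩ := U.exists_witness hι hη hCb hnd
  obtain ⟨ξ, hξ⟩ := hfit x s' n F hno
  -- The label `ξ` is taken only finitely often.
  have hξfin : ∃ k, (ξ, k) ∉ 𝒢 := by
    by_contra! hall
    obtain ⟨N, hN⟩ := Label.exists_no_chain U hU (hbad ξ)
    let S : Finset X := (Finset.range N).image fun k => (ξ, ⟨k⟩)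
    have hS : S.card = N := by
      rw [Finset.card_image_of_injective _ (fun k l h => congrArg (fun q : X => q.2.down) h), Finset.card_range]
    let f : Fin N → X := fun k => S.orderEmbOfFin hS k.rev
    have hf : ∀ k l, k < l → f l < f k := fun k l h => by simpa [f] using h
    have hfξ : ∀ k, (f k).1 = ξ := fun k => by
      obtain ⟨l, -, hl⟩ := Finset.mem_image.1 (S.orderEmbOfFin_mem hS k.rev)
      exact congrArg Prod.fst hl.symm
    have hf𝒢 : ∀ k, f k ∈ 𝒢 := fun k => by
      have := hall (f k).2
      rwa [← hfξ k] at this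
    refine hN ⟨x, fun i => if h : i < N then s (f ⟨i, h⟩) else s', fun i hi => ?_⟩
    simp only [dif_pos hi]
    obtain ⟨hfit, hind⟩ := hs _ (hf𝒢 ⟨i, hi⟩)
    refine ⟨?_, (hind (Finset.univ.image fun l : Fin i => f ⟨l, l.2.trans hi⟩) ?_).mono ?_⟩
    · have : lab (f ⟨i, hi⟩) = lab₀ ξ := congrArg lab₀ (hfξ _)
      rwa [this] at hfit
    · intro j hj
      obtain ⟨l, -, rfl⟩ := Finset.mem_image.1 hj
      exact ⟨hf𝒢 _, hf _ _ l.2⟩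
    · rintro _ ⟨⟨l, m⟩, rfl⟩
      refine Or.inr ⟨(⟨f ⟨l, l.2.trans hi⟩, Finset.mem_image_of_mem _ (Finset.mem_univ l)⟩, m), ?_⟩
      simp only [dif_pos (l.2.trans hi)]
  obtain ⟨k, hk⟩ := hξfin
  -- The new instance of dividing fits into the pattern below a rejected index `(ξ, k)`, since the
  -- sequences of the pattern are indiscernible over `b`.
  refine hk ((h𝒢 _).2 ⟨x, Function.update s (ξ, k) s', hx, fun i hi => ?_⟩)
  have hlt : ∀ j ∈ {z | z ∈ 𝒢 ∧ z < (ξ, k)} ∪ {(ξ, k)}, j ≤ (ξ, k) := by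
    rintro j (hj | rfl)
    · exact hj.2.le
    · exact le_rfl
  rcases hi with ⟨hi𝒢, hik⟩ | rfl
  · rw [Function.update_of_ne hik.ne]
    refine ⟨(hs i hi𝒢).1, fun J hJ => ((hs i hi𝒢).2 (J.erase (ξ, k)) fun j hj => ?_).mono ?_⟩
    · obtain ⟨hjk, hjJ⟩ := Finset.mem_erase.1 hj
      exact ⟨((hJ j hjJ).1.resolve_right hjk).1, (hJ j hjJ).2⟩
    · rintro _ (hc | ⟨⟨⟨j, hj⟩, m⟩, rfl⟩)
      · exact Or.inl (Or.inl hc)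
      · by_cases hjk : j = (ξ, k)
        · subst hjk
          exact Or.inl (Or.inr ⟨H m, by simp only [Function.update_self, hs'0]⟩)
        · exact Or.inr ⟨(⟨j, Finset.mem_erase.2 ⟨hjk, hj⟩⟩, m), by
            simp only [Function.update_of_ne hjk]⟩
  · rw [Function.update_self]
    refine ⟨hξ, fun J hJ => hs'.mono ?_⟩
    rintro _ (hc | ⟨⟨⟨j, hj⟩, m⟩, rfl⟩)
    · exact hc
    · exact absurd (hJ j hj).2 (hlt j (hJ j hj).1).not_gt

end Presentation

/-! ### Independence in stable theories -/

/-- The tuples `a` and `a'` are the first two entries of an indiscernible sequence over `C`. -/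
def LStep {E ι : Type u} (G : Subgroup (Equiv.Perm E)) (C : Set E) (a a' : ι → E) : Prop :=
  ∃ s : ℕ → ι → E, Indisc G C s ∧ s 0 = a ∧ s 1 = a'

theorem LStep.conj {E ι : Type u} {G : Subgroup (Equiv.Perm E)} {C : Set E} {a a' b b' : ι → E}
    (h : LStep G C a a') (hc : Conj G C (Sum.elim a a') (Sum.elim b b')) : LStep G C b b' := by
  obtain ⟨s, hs, rfl, rfl⟩ := h
  obtain ⟨g, hg, hgC, hgs⟩ := hc
  exact ⟨fun n i => g (s n i), hs.smul_fix hg hgC, funext fun i => hgs (Sum.inl i),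
    funext fun i => hgs (Sum.inr i)⟩

/-- Equivalent points are joined by a path. -/
theorem exists_path {α : Type*} {r : α → α → Prop} {a b : α} (h : Relation.EqvGen r a b) :
    ∃ (n : ℕ) (p : ℕ → α), p 0 = a ∧ p n = b ∧ ∀ i < n, r (p i) (p (i + 1)) ∨ r (p (i + 1)) (p i) := by
  have h' : Relation.ReflTransGen (fun x y => r x y ∨ r y x) a b := by
    induction h with
    | rel x y h => exact Relation.ReflTransGen.single (Or.inl h)
    | refl x => exact Relation.ReflTransGen.refl
    | symm x y _ ih =>
      have : Std.Symm fun x y => r x y ∨ r y x := ⟨fun _ _ h => h.symm⟩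
      exact symm ih
    | trans x y z _ _ h1 h2 => exact h1.trans h2
  clear h
  induction h' with
  | refl => exact ⟨0, fun _ => a, rfl, rfl, by simp⟩
  | @tail b c _ hbc ih =>
    obtain ⟨n, p, h0, hn, hp⟩ := ih
    refine ⟨n + 1, fun i => if i ≤ n then p i else c, by simp [h0], by simp, fun i hi => ?_⟩
    rcases Nat.lt_succ_iff_lt_or_eq.1 hi with h | rfl
    · simp only [h.le, if_true, Nat.succ_le_iff.2 h]
      exact hp i h
    · simp [hn, hbc]

namespace Presentation

variable {E : Type u} {G : Subgroup (Equiv.Perm E)} {κ : Cardinal.{u}} (U : Presentation G κ)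
variable {ι η θ : Type u} {C D : Set E}
include U

/-- If every entry of a sequence is independent from the earlier ones, then the later entries are
independent from each entry. -/
theorem nd_tail (hC : #C < κ) (hη : #η < κ) {s : ℕ → η → E}
    (h : ∀ n, ND G C (s n) (flat fun k : Fin n => s k)) (n : ℕ) :
    ND G C (flat fun k => s (n + 1 + k)) (s n) := by
  have hfin : ∀ m, ND G C (flat fun k : Fin m => s (n + 1 + k)) (s n) := by
    intro m
    induction m with
    | zero =>
      intro t _ ht
      refine ⟨fun p => p.1.elim0, fun k => ?_⟩
      obtain ⟨g, hg, hgC, hgt⟩ := ht k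
      exact ⟨g, hg, hgC, Sum.rec (fun p => p.1.elim0) hgt⟩
    | succ m ih =>
      have h1 : ND G (C ∪ Set.range (flat fun k : Fin m => s (n + 1 + k))) (s (n + 1 + m))
          (s n) := by
        refine ND.mono U (U.mk_union_lt hC (mk_range_lt (U.mk_fin_prod_lt m hη) _))
          (U.mk_fin_prod_lt (n + 1 + m) hη) hη ((h (n + 1 + m)).union_base ?_) subset_rfl ?_
        · rintro _ ⟨p, rfl⟩
          exact ⟨(⟨n + 1 + p.1, by omega⟩, p.2), rfl⟩
        · rintro _ ⟨i, rfl⟩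
          exact ⟨(⟨n, by omega⟩, i), rfl⟩
      refine ND.mono U hC hη hη
        (ND.left_trans U hC (U.mk_fin_prod_lt m hη) hη hη ih h1) ?_ subset_rfl
      rintro _ ⟨⟨k, i⟩, rfl⟩
      rcases Nat.lt_succ_iff_lt_or_eq.1 k.2 with hk | hk
      · exact ⟨Sum.inl (⟨k, hk⟩, i), rfl⟩
      · exact ⟨Sum.inr i, by simp [flat, hk]⟩
  refine U.nd_of_finite hC (U.mk_nat_prod_lt hη) hη fun F H => ?_
  obtain ⟨N, hN⟩ : ∃ N, ∀ p ∈ F, p.1 < N := by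
    classical
    exact ⟨F.sup (fun p => p.1 + 1), fun p hp => Finset.le_sup (f := fun p => p.1 + 1) hp⟩
  refine ND.mono U hC hη ((mk_subtype_le _).trans_lt hη) (hfin N) ?_ ?_
  · rintro _ ⟨p, rfl⟩
    exact ⟨(⟨p.1.1, hN p p.2⟩, p.1.2), rfl⟩
  · rintro _ ⟨p, rfl⟩
    exact ⟨p.1, rfl⟩

/-- In a stable theory independence may be tested along a single independent sequence: if `x` has
over each entry the type of `a` over `b`, then `a` is independent from `b`. Otherwise copies of a
witness of dividing over the entries, in reverse order, form arbitrarily long chains. -/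
theorem nd_of_seq (hU : U.Stable) (hC : #C < κ) (hι : #ι < κ) (hη : #η < κ) {s : ℕ → η → E}
    (hs : ∀ n, ND G C (s n) (flat fun k : Fin n => s k)) {a x : ι → E} {b : η → E}
    (hx : ∀ n, Conj G C (Sum.elim x (s n)) (Sum.elim a b)) : ND G C a b := by
  classical
  wlog hCb : C ⊆ Set.range b generalizing η
  · have hCη : #(C ⊕ η) < κ := U.mk_sum_lt hC hη
    refine ND.comp_right U hC hCη hη (this hCη
      (s := fun n => Sum.elim (Subtype.val : C → E) (s n)) (b := Sum.elim Subtype.val b)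
      (fun n => ?_) (fun n => ?_) (by simp)) Sum.inr
    · have := ND.normal (hs n) (c := (Subtype.val : C → E)) (by simp)
      rcases n with _ | n
      · exact nd_self (by rintro _ ⟨p, _⟩; exact p.1.elim0)
      · refine ND.mono U hC (U.mk_sum_lt hC (U.mk_fin_prod_lt _ hη))
          (U.mk_fin_prod_lt _ hCη) this subset_rfl ?_
        rintro _ ⟨⟨k, i | i⟩, rfl⟩
        · exact ⟨Sum.inl i, rfl⟩
        · exact ⟨Sum.inr (k, i), rfl⟩
    · obtain ⟨g, hg, hgC, hgx⟩ := hx n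
      refine ⟨g, hg, hgC, ?_⟩
      rintro (i | i | i)
      · exact hgx (Sum.inl i)
      · exact hgC _ i.2
      · exact hgx (Sum.inr i)
  by_contra hnd
  obtain ⟨n, F, H, r, hr, hr0, hno⟩ := U.exists_witness hι hη hCb hnd
  obtain ⟨N, hN⟩ := U.exists_no_chain hU hno
  have hr0' : r 0 = fun j => b (H j) := funext hr0
  -- Over the `k`-th entry there is a copy of the sequence `r` that is indiscernible over the later
  -- entries.
  have : ∀ k, ∃ t : ℕ → ULift.{u} ℕ → E, Conj G C (flat t) (flat r) ∧
      (t 0 = fun j => s k (H j)) ∧ Indisc G (C ∪ Set.range (flat fun l => s (k + 1 + l))) t := by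
    intro k
    obtain ⟨g, hg, hgC, hgs⟩ := (hx k).inr.symm
    have ht0 : (fun j => g (r 0 j)) = fun j => s k (H j) := by
      funext j
      rw [hr0', hgs]
    obtain ⟨a', ⟨g', hg', hgC', hga⟩, hi⟩ := ND.exists_indisc' U hC (U.mk_nat_prod_lt hη)
      U.mk_omega_lt (hr.smul_fix hg hgC) ht0
      (ND.comp_right U hC hη U.mk_omega_lt (U.nd_tail hC hη hs k) H)
    have hi' := hi.smul hg'
    rw [Set.image_union, Set.EqOn.image_eq (f₂ := id) (fun c hc => hgC' c hc), Set.image_id,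
      ← Set.range_comp, show g' ∘ a' = _ from funext fun i => hga (Sum.inl i)] at hi'
    refine ⟨_, ?_, ?_, hi'⟩
    · exact Conj.symm ⟨g' * g, G.mul_mem hg' hg, fun c hc => by simp [hgC c hc, hgC' c hc],
        fun _ => rfl⟩
    · funext j
      exact (congrArg g' (congrFun ht0 j)).trans (hga (Sum.inr j))
  choose t htr ht0 hti using this
  refine hN ⟨fun i => x (F i), fun i => t (N - 1 - i), fun i hi => ⟨?_, ?_, (hti _).mono ?_⟩⟩
  · have := ((hx (N - 1 - i)).sum_map F H).mono (Set.empty_subset C)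
    simp only [ht0]
    rw [hr0']
    exact this
  · exact (htr _).mono (Set.empty_subset _)
  · rintro _ ⟨⟨l, m⟩, rfl⟩
    refine Or.inr ⟨(i - 1 - l, H m), ?_⟩
    have h1 : N - 1 - i + 1 + (i - 1 - l) = N - 1 - l := by omega
    simp only [flat, ht0, h1]

/-- Every tuple starts an indiscernible sequence in which each entry is independent from the
earlier ones. -/
theorem exists_morley (hU : U.Stable) (hC : #C < κ) (hη : #η < κ) (b : η → E) :
    ∃ s : ℕ → η → E, Indisc G C s ∧ s 0 = b ∧
      ∀ n, ND G C (s n) (flat fun k : Fin n => s k) := by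
  obtain ⟨lam, hlam, hex⟩ := U.extraction (σ := max #C #η) (max_lt hC hη)
  let X := lam.ord.ToType
  have hX : #X = lam := mk_ord_toType _
  obtain ⟨t, ht⟩ := exists_wf_seq (X := X) (α := η → E)
    (fun x p v => Conj G C v b ∧ ND G C v (flat p)) (fun x p => U.exists_conj_nd hU hC hη
      (U.mk_prod_lt ((mk_subtype_le _).trans_lt (by rwa [hX])) hη) b (flat p))
  obtain ⟨s, hs, hst⟩ := hex C η (le_max_left _ _) (le_max_right _ _) X hX.ge t
  have hs0 : Conj G C (s 0) b := by
    obtain ⟨f, hf, h⟩ := hst 1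
    have : Conj G C (s 0) (t (f 0)) := h.comp (fun j => ((0 : Fin 1), j))
    exact this.trans (ht _).1
  obtain ⟨g, hg, hgC, hgs⟩ := hs0
  refine ⟨fun n i => g (s n i), hs.smul_fix hg hgC, funext hgs, fun n => ?_⟩
  obtain ⟨f, hf, h⟩ := hst (n + 1)
  have h1 : ND G C (t (f (Fin.last n))) (flat fun k : Fin n => t (f k.castSucc)) :=
    ND.mono U hC (U.mk_prod_lt ((mk_subtype_le _).trans_lt (by rwa [hX])) hη)
      (U.mk_fin_prod_lt n hη) (ht (f (Fin.last n))).2 subset_rfl (by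
        rintro _ ⟨p, rfl⟩
        exact ⟨(⟨f p.1.castSucc, hf (Fin.castSucc_lt_last _)⟩, p.2), rfl⟩)
  have h2 : Conj G C (Sum.elim (t (f (Fin.last n))) (flat fun k : Fin n => t (f k.castSucc)))
      (Sum.elim (s n) (flat fun k : Fin n => s k)) := by
    have := h.symm.comp (Sum.elim (fun i => (Fin.last n, i))
      (fun p : Fin n × η => (p.1.castSucc, p.2)))
    convert this using 2 <;> · rename_i p; rcases p with p | p <;> rfl
  exact h1.of_conj (h2.trans (conj_sum_elim hg hgC _ _))

/-- Extension: take an independent sequence starting at `b` and `d`, and move `a` over `b` so that the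
sequence becomes indiscernible over it. -/
theorem ND.exists_extend (hU : U.Stable) (hC : #C < κ) (hι : #ι < κ) (hη : #η < κ) (hθ : #θ < κ)
    {a : ι → E} {b : η → E} (h : ND G C a b) (d : θ → E) :
    ∃ d' : θ → E, Conj G C (Sum.elim b d') (Sum.elim b d) ∧ ND G C a (Sum.elim b d') := by
  obtain ⟨s, hs, hs0, hnd⟩ := U.exists_morley hU hC (U.mk_sum_lt hη hθ) (Sum.elim b d)
  have hb : (fun i => s 0 (Sum.inl i)) = b := by rw [hs0]; rfl
  obtain ⟨a', ha', hi⟩ := ND.exists_indisc U hC hι (U.mk_sum_lt hη hθ) hη Sum.inl hs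
    (a := a) (by rwa [hb])
  rw [hb] at ha'
  have h1 : ND G C a' (Sum.elim b d) := by
    refine U.nd_of_seq hU hC hι (U.mk_sum_lt hη hθ) hnd (x := a') fun n => ?_
    rw [← hs0]
    exact conj_sum_iff'.2 (hi.conj n 0)
  obtain ⟨g, hg, hgC, hga⟩ := ha'
  have h2 := conj_sum_elim (C := C) hg hgC a' (Sum.elim b d)
  have h3 : (fun i => g (a' i)) = a := funext fun i => hga (Sum.inl i)
  have h4 : (fun i => g (Sum.elim b d i)) = Sum.elim b fun i => g (d i) := by
    funext i
    rcases i with i | i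
    · exact hga (Sum.inr i)
    · rfl
  rw [h3, h4] at h2
  exact ⟨fun i => g (d i), h2.inr.symm, h1.of_conj h2⟩

/-- Symmetry: by extension there is an independent sequence of realisations of the type of `a`
over `b`, along which the independence of `b` may be tested. -/
theorem ND.symm (hU : U.Stable) (hC : #C < κ) (hι : #ι < κ) (hη : #η < κ) {a : ι → E}
    {b : η → E} (h : ND G C a b) : ND G C b a := by
  have hθ : ∀ n : ℕ, #({y // y < n} × ι) < κ := fun n =>
    (mk_le_of_injective (f := fun p : {y // y < n} × ι => (p.1.1, p.2)) (by
      rintro ⟨⟨k, _⟩, i⟩ ⟨⟨l, _⟩, j⟩ h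
      obtain ⟨rfl, rfl⟩ := Prod.ext_iff.1 h
      rfl)).trans_lt (U.mk_nat_prod_lt hι)
  obtain ⟨s, hs⟩ := exists_wf_seq (X := ℕ) (α := ι → E)
    (fun n p v => Conj G C (Sum.elim b v) (Sum.elim b a) ∧ ND G C v (flat p)) (fun n p => by
      obtain ⟨d, ⟨g, hg, hgC, hgb⟩, hnd⟩ := ND.exists_extend U hU hC hι hη (hθ n) h (flat p)
      refine ⟨fun i => g (a i), ⟨g⁻¹, G.inv_mem hg, fun c hc => ?_, ?_⟩, ?_⟩
      · rw [Equiv.Perm.inv_eq_iff_eq, hgC c hc]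
      · rintro (i | i)
        · simp only [Sum.elim_inl]
          rw [Equiv.Perm.inv_eq_iff_eq]
          exact (hgb (Sum.inl i)).symm
        · simp
      · refine (ND.comp_right U hC (U.mk_sum_lt hη (hθ n)) (hθ n) hnd Sum.inr).of_conj
          ⟨g, hg, hgC, ?_⟩
        rintro (i | i)
        · rfl
        · exact hgb (Sum.inr i))
  refine U.nd_of_seq hU hC hη hι (s := s) (x := b) (fun n => ?_) fun n => (hs n).1
  refine ND.mono U hC (hθ n) (U.mk_fin_prod_lt n hι) (hs n).2 subset_rfl ?_
  rintro _ ⟨p, rfl⟩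
  exact ⟨(⟨p.1, p.1.2⟩, p.2), rfl⟩

theorem DI.symm (hU : U.Stable) {A B : Set E} (hC : #C < κ) (hA : #A < κ) (hB : #B < κ)
    (h : DI G A C B) : DI G B C A :=
  ND.symm U hU hC hA hB h

theorem DI.trans (hU : U.Stable) {A B C' : Set E} (hC' : #C' < κ) (hA : #A < κ)
    (hB : #B < κ) (hCC' : C ⊆ C') (h : DI G A C C') (h' : DI G A C' B) : DI G A C B := by
  have hC : #C < κ := (mk_le_mk_of_subset hCC').trans_lt hC'
  have h1 := DI.left_trans U hC hC' hB hA (DI.symm U hU hC hA hC' h) (by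
    rw [Set.union_eq_self_of_subset_left hCC']
    exact DI.symm U hU hC' hA hB h')
  exact DI.mono U hC (U.mk_union_lt hC' hB)
    (DI.symm U hU hC (U.mk_union_lt hC' hB) hA h1) subset_rfl Set.subset_union_right

/-- Local character: a set containing a maximal chain of instances of dividing for each label is a
base. -/
theorem exists_localCharacter (hU : U.Stable) {μ : Cardinal.{u}} (hμ : μ < κ) : ∃ ν < κ,
    ∀ A C : Set E, #A < μ → #C < κ → ∃ C' ⊆ C, #C' < ν ∧ DI G A C' C := by
  classical
  obtain ⟨ν, hν, hlab⟩ := U.exists_labels hμ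
  refine ⟨Order.succ (max ℵ₀ ν), U.inacc.isStrongLimit.isSuccLimit.succ_lt
    (max_lt U.aleph0_lt hν), fun A C hA hC => ?_⟩
  obtain ⟨Ξ, lab, hΞ, hbad, hfit⟩ := hlab A hA.le
  -- A chain of maximal length among those with first entries in `C`.
  have hmax : ∀ ξ, ∃ D ⊆ C, #D ≤ ℵ₀ ∧ ∀ s, (lab ξ).Fits G (Subtype.val : A → E) s →
      Indisc G D s → ¬ ∀ j, s 0 j ∈ C := by
    intro ξ
    let P (N : ℕ) := ∃ s : ℕ → ℕ → ULift.{u} ℕ → E, ∀ i < N,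
      (lab ξ).Fits G (Subtype.val : A → E) (s i) ∧
      Indisc G (Set.range fun p : Fin i × ULift.{u} ℕ => s p.1 0 p.2) (s i) ∧ ∀ j, s i 0 j ∈ C
    have hex : ∃ N, ¬ P N := by
      obtain ⟨N, hN⟩ := Label.exists_no_chain U hU (hbad ξ)
      exact ⟨N, fun ⟨s, hs⟩ => hN ⟨_, s, fun i hi => ⟨(hs i hi).1, (hs i hi).2.1⟩⟩⟩
    obtain ⟨N, hN⟩ : ∃ N, Nat.find hex = N + 1 := Nat.exists_eq_succ_of_ne_zero fun h0 => by
      have := Nat.find_spec hex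
      rw [h0] at this
      exact this ⟨fun _ => (lab ξ).r, by simp⟩
    have hPN : P N := by
      by_contra h
      have := Nat.find_min' hex h
      omega
    have hPN' : ¬ P (N + 1) := hN ▸ Nat.find_spec hex
    obtain ⟨s, hs⟩ := hPN
    refine ⟨Set.range fun p : Fin N × ULift.{u} ℕ => s p.1 0 p.2, ?_, (Set.countable_range _).le_aleph0,
      fun s' h1 h2 h3 => hPN' ⟨Function.update s N s', fun i hi => ?_⟩⟩
    · rintro _ ⟨p, rfl⟩
      exact (hs p.1 p.1.2).2.2 _
    · have hlow : (fun p : Fin i × ULift.{u} ℕ => Function.update s N s' p.1 0 p.2) =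
          fun p : Fin i × ULift.{u} ℕ => s p.1 0 p.2 := by
        funext p
        rw [Function.update_of_ne (by omega)]
      rw [hlow]
      rcases Nat.lt_succ_iff_lt_or_eq.1 hi with h | rfl
      · rw [Function.update_of_ne h.ne]
        exact hs i h
      · rw [Function.update_self]
        exact ⟨h1, h2, h3⟩
  choose D hDC hD hDs using hmax
  refine ⟨⋃ ξ, D ξ, Set.iUnion_subset hDC, Order.lt_succ_of_le (mk_iUnion_le_of_le D
    (le_max_left _ _) (hΞ.trans (le_max_right _ _)) fun ξ => (hD ξ).trans (le_max_left _ _)), ?_⟩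
  by_contra hnd
  obtain ⟨n, F, H, s, hs, hs0, hno⟩ := U.exists_witness (hA.trans hμ) hC
    (by simpa using hDC) hnd
  obtain ⟨ξ, hξ⟩ := hfit _ s n F hno
  exact hDs ξ s hξ (hs.mono (Set.subset_iUnion D ξ)) fun j => by
    rw [hs0]
    exact (H j).2

/-- Tuples with the same Lascar strong type over `C` that are jointly independent from `b` have
the same type over `b`. -/
theorem conj_of_eqvGen (hU : U.Stable) (hC : #C < κ) (hι : #ι < κ) (hη : #η < κ) {a a' : ι → E}
    {b : η → E} (hL : Relation.EqvGen (LStep G C) a a') (h : ND G C b (Sum.elim a a')) :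
    Conj G (C ∪ Set.range b) a a' := by
  -- The Lascar path is moved to a path between the same tuples that is independent from `b`.
  obtain ⟨n, p, rfl, rfl, hp⟩ := exists_path hL
  obtain ⟨q, hq, hnd⟩ := ND.exists_extend U hU hC hη (U.mk_sum_lt hι hι) (U.mk_nat_prod_lt hι) h
    (flat p)
  have hstep : ∀ i j, LStep G C (p i) (p j) →
      Conj G (C ∪ Set.range b) (fun k => q (i, k)) (fun k => q (j, k)) := by
    intro i j hij
    obtain ⟨s, hs, h0, h1⟩ := hij.conj (b := fun k => q (i, k)) (b' := fun k => q (j, k)) (by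
      have := hq.symm.comp (Sum.elim (fun k => Sum.inr (i, k)) fun k => Sum.inr (j, k))
      convert this using 2 <;> · rename_i k; rcases k with k | k <;> rfl)
    rw [← h0, ← h1]
    refine U.conj_of_nd_pair hU hC hι hη hs (ND.mono U hC
      (U.mk_sum_lt (U.mk_sum_lt hι hι) (U.mk_nat_prod_lt hι)) (U.mk_sum_lt hι hι) hnd
      subset_rfl ?_)
    rintro _ ⟨k | k, rfl⟩
    · exact ⟨Sum.inr (i, k), by simp [h0]⟩
    · exact ⟨Sum.inr (j, k), by simp [h1]⟩
  have hpath : ∀ i ≤ n, Conj G (C ∪ Set.range b) (fun k => q (0, k)) (fun k => q (i, k)) := by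
    intro i
    induction i with
    | zero => exact fun _ => Conj.refl _
    | succ i ih =>
      intro hi
      refine (ih (by omega)).trans ?_
      rcases hp i (by omega) with h | h
      · exact hstep _ _ h
      · exact (hstep _ _ h).symm
  obtain ⟨g, hg, hgC, hgq⟩ := hq.symm
  have hend : ∀ k, q (0, k) = p 0 k ∧ q (n, k) = p n k := fun k =>
    ⟨(hgq (Sum.inr (0, k))).symm.trans (hgq (Sum.inl (Sum.inl k))),
      (hgq (Sum.inr (n, k))).symm.trans (hgq (Sum.inl (Sum.inr k)))⟩
  simpa only [(hend _).1, (hend _).2] using hpath n le_rfl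

/-- Stationarity: both tuples are compared with a third one that is independent from everything. -/
theorem conj_of_lascar (hU : U.Stable) {B : Set E} (hC : #C < κ) (hι : #ι < κ) (hB : #B < κ)
    {a a' : ι → E} (hL : ∀ x y : ι → E, Conj G C x y → Relation.EqvGen (LStep G C) x y)
    (h : DI G (Set.range a) C B) (h' : DI G (Set.range a') C B) (haa' : Conj G C a a') :
    Conj G (C ∪ B) a a' := by
  let b : B → E := Subtype.val
  have hb : Set.range b = B := Subtype.range_val
  obtain ⟨x, hx, hnd⟩ := U.exists_conj_nd hU hC hι (η := B ⊕ (ι ⊕ ι))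
    (U.mk_sum_lt hB (U.mk_sum_lt hι hι)) a (Sum.elim b (Sum.elim a a'))
  have key : ∀ y : ι → E, Conj G C x y → DI G (Set.range y) C B →
      Set.range y ⊆ Set.range a ∪ Set.range a' → Conj G (C ∪ B) x y := by
    intro y hxy hy hsub
    have hBy : #(B ∪ Set.range y : Set E) < κ := U.mk_union_lt hB (mk_range_lt hι y)
    have h1 : DI G (Set.range x) C (B ∪ Set.range y) := by
      rw [U.nd_iff hC (U.mk_sum_lt hB (U.mk_sum_lt hι hι))] at hnd
      refine DI.mono U hC (mk_range_lt (U.mk_sum_lt hB (U.mk_sum_lt hι hι)) _) hnd subset_rfl ?_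
      rw [Set.Sum.elim_range, Set.Sum.elim_range, hb]
      exact Set.union_subset_union_right _ hsub
    have h2 : DI G (Set.range y ∪ Set.range x) C B := DI.left_trans U hC (mk_range_lt hι y)
      (mk_range_lt hι x) hB hy (DI.mono U (U.mk_union_lt hC (mk_range_lt hι y)) hBy
        (DI.base h1 Set.subset_union_left (Set.union_subset_union_right _ Set.subset_union_right))
        subset_rfl Set.subset_union_left)
    have h3 : ND G C b (Sum.elim x y) := by
      rw [U.nd_iff hC (U.mk_sum_lt hι hι), Set.Sum.elim_range, hb, Set.union_comm]
      exact DI.symm U hU hC (U.mk_union_lt (mk_range_lt hι y) (mk_range_lt hι x)) hB h2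
    rw [← hb]
    exact U.conj_of_eqvGen hU hC hι hB (hL _ _ hxy) h3
  exact (key a hx h Set.subset_union_left).symm.trans
    (key a' (hx.trans haa') h' Set.subset_union_right)

end Presentation

/-! ### Saturated sets of parameters -/

/-- The tuple `e` followed by the sequence `w`. -/
def consSeq {α : Type*} (e : α) (w : ℕ → α) : ℕ → α
  | 0 => e
  | n + 1 => w n

namespace Presentation

variable {E : Type u} {G : Subgroup (Equiv.Perm E)} {κ : Cardinal.{u}} (U : Presentation G κ)

/-- Countable types over subsets of `N` of size at most `lam` are realised in `N`. -/
def Good (G : Subgroup (Equiv.Perm E)) (lam : Cardinal.{u}) (N : Set E) : Prop :=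
  ∀ A ⊆ N, #A ≤ lam → ∀ e : ULift.{u} ℕ → E, ∃ e' : ULift.{u} ℕ → E,
    (∀ k, e' k ∈ N) ∧ Conj G A e' e

theorem Good.exists_conj {lam : Cardinal.{u}} {N : Set E} (h : Good G lam N) {A : Set E}
    (hA : A ⊆ N) (hAl : #A ≤ lam) {ι : Type u} [Finite ι] (e : ι → E) :
    ∃ e' : ι → E, (∀ k, e' k ∈ N) ∧ Conj G A e' e := by
  rcases isEmpty_or_nonempty ι with hι | hι
  · exact ⟨e, fun k => isEmptyElim k, Conj.refl _⟩
  · obtain ⟨f, hf⟩ : ∃ f : ι → ULift.{u} ℕ, Function.Injective f := by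
      obtain ⟨n, ⟨g⟩⟩ := Finite.exists_equiv_fin ι
      exact ⟨fun i => ⟨g i⟩, fun i j hij => g.injective (Fin.ext (congrArg ULift.down hij))⟩
    obtain ⟨e', he', hc⟩ := h A hA hAl fun k => e (Function.invFun f k)
    refine ⟨fun i => e' (f i), fun i => he' _, ?_⟩
    have := hc.comp f
    simpa only [Function.leftInverse_invFun hf _] using this

include U

/-- Every set lies in a saturated set of controlled size: close off under realisations of types. -/
theorem exists_good {lam ρ : Cardinal.{u}} (hlam : ℵ₀ ≤ lam) (hκ : lam < κ) (hρ : ρ ^ lam ≤ ρ)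
    (h2 : 2 ^ max #U.F lam ≤ ρ) {B : Set E} (hB : #B ≤ ρ) :
    ∃ N, B ⊆ N ∧ #N ≤ ρ ∧ Good G lam N := by
  classical
  have hinst : ∀ A : Set E, #A ≤ lam → #(Set (U.Inst (ULift.{u} ℕ ⊕ A))) ≤ ρ := by
    intro A hA
    rw [mk_set]
    refine (power_le_power_left two_ne_zero ((U.mk_inst_le _).trans ?_)).trans h2
    refine max_le (hlam.trans (le_max_right _ _)) (max_le (le_max_left _ _)
      (le_trans ?_ (le_max_right _ _)))
    rw [mk_sum, lift_id, lift_id, mk_uLift, mk_nat, lift_aleph0]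
    exact add_le_of_le hlam hlam hA
  have hlamρ : lam ≤ ρ := (le_max_right _ _).trans ((cantor _).le.trans h2)
  have hch : ∀ (A : Set E) (q : Set (U.Inst (ULift.{u} ℕ ⊕ A))), ∃ D : Set E, #D ≤ ℵ₀ ∧
      ∀ e : ULift.{u} ℕ → E, U.tpOver A e = q →
        ∃ e' : ULift.{u} ℕ → E, U.tpOver A e' = q ∧ ∀ k, e' k ∈ D := by
    intro A q
    by_cases h : ∃ e : ULift.{u} ℕ → E, U.tpOver A e = q
    · obtain ⟨e, he⟩ := h
      exact ⟨Set.range e, (Set.countable_range _).le_aleph0, fun _ _ => ⟨e, he, fun k => ⟨k, rfl⟩⟩⟩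
    · exact ⟨∅, by simp, fun e he => absurd ⟨e, he⟩ h⟩
  choose D hD hDe using hch
  obtain ⟨N, hBN, hN, hcl⟩ := exists_closed hlam hρ
    (le_trans (by exact_mod_cast (natCast_lt_aleph0 (n := 2)).le) (hlam.trans hlamρ)) B hB
    (fun A => ⋃ q, D A q) fun A hA => mk_iUnion_le_of_le _ (hlam.trans hlamρ) (hinst A hA)
      fun q => (hD A q).trans (hlam.trans hlamρ)
  refine ⟨N, hBN, hN, fun A hA hAl e => ?_⟩
  obtain ⟨e', he', hk⟩ := hDe A _ e rfl
  exact ⟨e', fun k => hcl A hA hAl (Set.mem_iUnion.2 ⟨_, hk k⟩),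
    (U.conj_iff_tpOver (hAl.trans_lt hκ) U.mk_omega_lt).2 he'⟩

omit U in
/-- A sequence that is conjugate, with `e` on top, to an initial segment of itself, can be turned
around to start with `e`. -/
theorem indisc_consSeq {ι : Type u} {C C₁ : Set E} (hC : C ⊆ C₁) {e : ι → E}
    (heC : Set.range e ⊆ C₁) {s : ℕ → ι → E} {r : (ULift.{u} ℕ)ᵒᵈ → ι → E} (hr : SameEM G C₁ r s)
    (he : ∀ n, Conj G C (Sum.elim (flat fun k : Fin n => s k) e)
      (Sum.elim (flat fun k : Fin n => s k) (s n))) :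
    Indisc G C (consSeq e fun n => r (OrderDual.toDual ⟨n⟩)) := by
  suffices ∀ (n : ℕ) (f : Fin n → ℕ), StrictMono f →
      Conj G C (flat fun k => consSeq e (fun n => r (OrderDual.toDual ⟨n⟩)) (f k))
        (flat fun k : Fin n => s k.rev) from
    fun n f g hf hg => (this n f hf).trans (this n g hg).symm
  have hpos : ∀ (n : ℕ) (f : Fin n → ℕ), StrictMono f →
      Conj G C₁ (flat fun k => r (OrderDual.toDual ⟨f k⟩)) (flat fun k : Fin n => s k.rev) := by
    intro n f hf
    have := (hr n (fun k => OrderDual.toDual ⟨f k.rev⟩) Fin.val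
      (fun k l hkl => by
        rw [OrderDual.toDual_lt_toDual]
        exact hf (Fin.rev_lt_rev.2 hkl)) Fin.val_strictMono).comp
      (fun p : Fin n × ι => (p.1.rev, p.2))
    simpa only [flat, Fin.rev_rev] using this
  intro n f hf
  rcases n with _ | n
  · exact ⟨1, G.one_mem, fun _ _ => rfl, fun p => p.1.elim0⟩
  by_cases h0 : f 0 = 0
  · have hsucc : ∀ k : Fin n, f k.succ = f k.succ - 1 + 1 := fun k => by
      have := hf (Fin.succ_pos k)
      omega
    obtain ⟨g, hg, hgC, hgr⟩ := hpos n (fun k => f k.succ - 1) fun k l hkl => by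
      have := hf (Fin.succ_lt_succ_iff.2 hkl)
      have := hsucc k
      have := hsucc l
      simp only
      omega
    obtain ⟨g', hg', hgC', hgs⟩ := he n
    refine ⟨g' * g, G.mul_mem hg' hg, fun c hc => by simp [hgC c (hC hc), hgC' c hc], ?_⟩
    rintro ⟨k, i⟩
    simp only [flat, Equiv.Perm.mul_apply]
    refine Fin.cases ?_ (fun k => ?_) k
    · rw [h0]
      simp only [consSeq]
      rw [hgC _ (heC ⟨i, rfl⟩), Fin.rev_zero, Fin.val_last]
      exact hgs (Sum.inr i)
    · rw [hsucc k]
      simp only [consSeq]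
      have h1 := hgr (k, i)
      simp only [flat] at h1
      rw [h1, Fin.rev_succ, Fin.val_castSucc]
      exact hgs (Sum.inl (k.rev, i))
  · have hsucc : ∀ k, f k = f k - 1 + 1 := fun k => by
      have := hf.monotone (Fin.zero_le k)
      omega
    have := (hpos (n + 1) (fun k => f k - 1) fun k l hkl => by
      have := hf hkl
      have := hsucc k
      have := hsucc l
      simp only
      omega).mono hC
    convert this using 1
    funext p
    simp only [flat]
    rw [hsucc p.1]
    rfl

/-- Two finite tuples of the same type over a saturated set `N` can be put in front of a common
sequence, with indiscernible results over a given finite subset. The sequence is extracted from a long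
sequence of realisations in `N` of the common type over the earlier entries, and then reversed. -/
theorem exists_consSeq_finite : ∃ lam < κ, ∀ N : Set E, Good G lam N →
    ∀ (ι : Type u) [Finite ι] (N₀ : Finset E), ↑N₀ ⊆ N → ∀ e e' : ι → E, Conj G N e e' →
      ∃ w : ℕ → ι → E, Indisc G N₀ (consSeq e w) ∧ Indisc G N₀ (consSeq e' w) := by
  obtain ⟨lam₀, hlam₀, hex⟩ := U.extraction U.aleph0_lt
  refine ⟨max ℵ₀ lam₀, max_lt U.aleph0_lt hlam₀, fun N hN ι _ N₀ hN₀ e e' hee' => ?_⟩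
  let X := (max ℵ₀ lam₀).ord.ToType
  have hX : #X = max ℵ₀ lam₀ := mk_ord_toType _
  have hι : #ι ≤ ℵ₀ := (lt_aleph0_of_finite ι).le
  obtain ⟨z, hz⟩ := exists_wf_seq (X := X) (α := {v : ι → E // ∀ k, v k ∈ N})
    (fun x p v => Conj G (N₀ ∪ Set.range (flat fun y => (p y).1)) v.1 e) (fun x p => by
      obtain ⟨v, hv, hve⟩ := hN.exists_conj (A := N₀ ∪ Set.range (flat fun y => (p y).1))
        (Set.union_subset hN₀ (by
          rintro _ ⟨q, rfl⟩
          exact (p q.1).2 q.2)) (by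
        refine mk_union_le_of_le (le_max_left _ _)
          ((Finset.finite_toSet N₀).lt_aleph0.le.trans (le_max_left _ _)) (mk_range_le.trans ?_)
        rw [mk_prod, lift_id, lift_id]
        exact mul_le_of_le (le_max_left _ _) ((mk_subtype_le _).trans hX.le)
          (hι.trans (le_max_left _ _))) e
      exact ⟨⟨v, hv⟩, hve⟩)
  let C₁ : Set E := N₀ ∪ Set.range (Sum.elim e e')
  have hC₁ : #C₁ ≤ ℵ₀ := by
    refine mk_union_le_of_le le_rfl (Finset.finite_toSet N₀).lt_aleph0.le (mk_range_le.trans ?_)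
    simp only [mk_sum, lift_id]
    exact add_le_of_le le_rfl hι hι
  obtain ⟨s, hs, hst⟩ := hex C₁ ι hC₁ hι X (hX ▸ le_max_right _ _) fun x => (z x).1
  obtain ⟨r, hr⟩ := U.stretch (hC₁.trans_lt U.aleph0_lt) (hι.trans_lt U.aleph0_lt) hs
    (ULift.{u} ℕ)ᵒᵈ U.mk_omega_lt
  have key : ∀ d : ι → E, Set.range d ⊆ C₁ → Conj G N e d → ∀ n,
      Conj G N₀ (Sum.elim (flat fun k : Fin n => s k) d)
        (Sum.elim (flat fun k : Fin n => s k) (s n)) := by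
    intro d hd hed n
    obtain ⟨f, hf, h⟩ := hst (n + 1)
    have h1 : Conj G N₀ (Sum.elim (flat fun k : Fin n => s k) d)
        (Sum.elim (flat fun k : Fin n => (z (f k.castSucc)).1) d) := by
      refine conj_sum_iff.2 ((h.comp (fun p : Fin n × ι => (p.1.castSucc, p.2))).mono ?_)
      exact Set.union_subset Set.subset_union_left hd
    have h2 : Conj G N₀ (Sum.elim (flat fun k : Fin n => (z (f k.castSucc)).1) d)
        (Sum.elim (flat fun k : Fin n => (z (f k.castSucc)).1) (z (f (Fin.last n))).1) := by
      refine conj_sum_iff'.2 (Conj.symm (Conj.trans ((hz (f (Fin.last n))).mono ?_)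
        (hed.mono (Set.union_subset hN₀ ?_))))
      · refine Set.union_subset_union_right _ ?_
        rintro _ ⟨p, rfl⟩
        exact ⟨(⟨f p.1.castSucc, hf (Fin.castSucc_lt_last _)⟩, p.2), rfl⟩
      · rintro _ ⟨p, rfl⟩
        exact (z _).2 _
    refine (h1.trans h2).trans (Conj.symm ?_)
    have := (h.mono (Set.subset_union_left (s := (N₀ : Set E)))).comp
      (Sum.elim (fun p : Fin n × ι => (p.1.castSucc, p.2)) fun i => (Fin.last n, i))
    convert this using 2 <;> · rename_i p; rcases p with p | p <;> rfl
  have heC : Set.range e ⊆ C₁ := by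
    rintro _ ⟨i, rfl⟩
    exact Or.inr ⟨Sum.inl i, rfl⟩
  have heC' : Set.range e' ⊆ C₁ := by
    rintro _ ⟨i, rfl⟩
    exact Or.inr ⟨Sum.inr i, rfl⟩
  exact ⟨fun n => r (OrderDual.toDual ⟨n⟩),
    indisc_consSeq Set.subset_union_left heC hr (key e heC (Conj.refl _)),
    indisc_consSeq Set.subset_union_left heC' hr (key e' heC' hee')⟩

/-- Over a sufficiently saturated set, tuples of the same type have the same Lascar strong type: by
compactness there is a sequence that can be continued by either of them in front. -/
theorem exists_lstep : ∃ lam < κ, ∀ N : Set E, Good G lam N → #N < κ →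
    ∀ (ι : Type u), #ι < κ → ∀ e e' : ι → E, Conj G N e e' →
      ∃ z, LStep G N e z ∧ LStep G N e' z := by
  classical
  obtain ⟨lam, hlam, hex⟩ := U.exists_consSeq_finite
  refine ⟨lam, hlam, fun N hN hNκ ι hι e e' hee' => ?_⟩
  let W (x : ℕ × ι → E) : ℕ → ι → E := fun n i => x (n, i)
  obtain ⟨x, hx⟩ := U.exists_of_closed (V := ℕ × ι) (J := Finset ι × Finset N)
    (U.mk_nat_prod_lt hι) (U.mk_prod_lt (U.mk_finset_lt hι) (U.mk_finset_lt hNκ))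
    (P := fun j x =>
      (Indisc G (Subtype.val '' (j.2 : Set N)) (fun n (i : j.1) => consSeq e (W x) n i) ∧
        ∀ i : j.1, U.srt (consSeq e (W x) 0 i) = U.srt (e i)) ∧
      (Indisc G (Subtype.val '' (j.2 : Set N)) (fun n (i : j.1) => consSeq e' (W x) n i) ∧
        ∀ i : j.1, U.srt (consSeq e' (W x) 0 i) = U.srt (e' i)))
    (fun j => by
      have hj : #(Subtype.val '' (j.2 : Set N)) < κ :=
        ((j.2.finite_toSet.image _).lt_aleph0).trans U.aleph0_lt
      have hj' : #j.1 < κ := (mk_subtype_le _).trans_lt hι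
      refine Closed.and ?_ ?_
      · refine U.closed_indisc hj hj' (fun i : j.1 => e i)
          (fun p => match p.1 with | 0 => Sum.inr (e p.2) | n + 1 => Sum.inl (n, p.2.1)) ?_
        rintro x (_ | n) i <;> rfl
      · refine U.closed_indisc hj hj' (fun i : j.1 => e' i)
          (fun p => match p.1 with | 0 => Sum.inr (e' p.2) | n + 1 => Sum.inl (n, p.2.1)) ?_
        rintro x (_ | n) i <;> rfl) (by
    intro J₀
    let F := J₀.biUnion Prod.fst
    let N₀ : Finset E := (J₀.biUnion Prod.snd).image Subtype.val
    obtain ⟨w, hw, hw'⟩ := hex N hN F N₀ (by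
      intro x hx
      obtain ⟨y, -, rfl⟩ := Finset.mem_image.1 hx
      exact y.2) (fun i => e i) (fun i => e' i) (hee'.comp _)
    refine ⟨fun p => if h : p.2 ∈ F then w p.1 ⟨p.2, h⟩ else e p.2, fun j hj => ?_⟩
    have hjF : ∀ i ∈ j.1, i ∈ F := fun i hi => Finset.mem_biUnion.2 ⟨j, hj, hi⟩
    have hjN : Subtype.val '' (j.2 : Set N) ⊆ (N₀ : Set E) := by
      rintro _ ⟨y, hy, rfl⟩
      exact Finset.mem_image_of_mem _ (Finset.mem_biUnion.2 ⟨j, hj, hy⟩)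
    have key : ∀ d : ι → E, Indisc G N₀ (consSeq (fun i : F => d i) w) →
        Indisc G (Subtype.val '' (j.2 : Set N)) (fun n (i : j.1) => consSeq d
          (W fun p => if h : p.2 ∈ F then w p.1 ⟨p.2, h⟩ else e p.2) n i) := by
      intro d hd
      have := (hd.mono hjN).comp (fun i : j.1 => (⟨i, hjF i i.2⟩ : F))
      convert this using 3 with n i
      rcases n with _ | n
      · rfl
      · exact dif_pos (hjF i i.2)
    exact ⟨⟨key e hw, fun _ => rfl⟩, ⟨key e' hw', fun _ => rfl⟩⟩)
  have key : ∀ d : ι → E, (∀ (F : Finset ι) (N₀ : Finset N), Indisc G (Subtype.val '' (N₀ : Set N))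
      (fun n (i : F) => consSeq d (W x) n i)) → Indisc G N (consSeq d (W x)) := by
    intro d hd n f g hf hg
    refine U.conj_of_finite hNκ (U.mk_fin_prod_lt n hι) fun S hS C₀ hC₀ hfin => ?_
    let F : Finset ι := (hS.image Prod.snd).toFinset
    let N₀ : Finset N := (hfin.preimage (f := (Subtype.val : N → E))
      Subtype.val_injective.injOn).toFinset
    have hN₀ : C₀ ⊆ Subtype.val '' (N₀ : Set N) := fun c hc =>
      ⟨⟨c, hC₀ hc⟩, by simpa [N₀] using hc, rfl⟩
    exact ((hd F N₀ n f g hf hg).mono hN₀).comp (fun p : S => (p.1.1,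
      (⟨p.1.2, (hS.image Prod.snd).mem_toFinset.2 ⟨p.1, p.2, rfl⟩⟩ : F)))
  exact ⟨W x 0, ⟨_, key e fun F N₀ => (hx (F, N₀)).1.1, rfl, rfl⟩,
    ⟨_, key e' fun F N₀ => (hx (F, N₀)).2.1, rfl, rfl⟩⟩

end Presentation

/-! ### Independence relations -/

namespace Presentation

variable {E : Type u} {G : Subgroup (Equiv.Perm E)} {κ : Cardinal.{u}} (U : Presentation G κ)

/-- Stable independence relations, in terms of the group `G`. -/
structure IsIndep (G : Subgroup (Equiv.Perm E)) (κ : Cardinal.{u})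
    (Ind : Set E → Set E → Set E → Prop) : Prop where
  invariance : ∀ g ∈ G, ∀ A B C : Set E, #A < κ → #B < κ → #C < κ →
    Ind A C B → Ind (g '' A) (g '' C) (g '' B)
  monotonicity : ∀ A B C A' B' : Set E, #A < κ → #B < κ → #C < κ →
    A' ⊆ A → B' ⊆ B → Ind A C B → Ind A' C B'
  normality : ∀ A B C : Set E, #A < κ → #B < κ → #C < κ → Ind A C B → Ind (C ∪ A) C (C ∪ B)
  existence : ∀ A C : Set E, #A < κ → #C < κ → Ind A C C
  full_existence : ∀ (A C : Set E) (η : Type u) (b : η → E), #A < κ → #C < κ → #η < κ →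
    ∃ b' : η → E, Conj G C b' b ∧ Ind A C (Set.range b')
  base_monotonicity : ∀ A B C C' : Set E, #A < κ → #B < κ → C ⊆ C' → C' ⊆ B →
    Ind A C B → Ind A C' B
  extension : ∀ (A B C : Set E) (η : Type u) (d : η → E), #A < κ → #B < κ → #C < κ → #η < κ →
    Ind A C B → ∃ d' : η → E, Conj G (C ∪ B) d' d ∧ Ind A C (B ∪ Set.range d')
  symmetry : ∀ A B C : Set E, #A < κ → #B < κ → #C < κ → Ind A C B → Ind B C A
  transitivity : ∀ A B C C' : Set E, #A < κ → #B < κ → #C' < κ →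
    C ⊆ C' → Ind A C C' → Ind A C' B → Ind A C B
  finite_character : ∀ A B C : Set E, #A < κ → #B < κ → #C < κ →
    (∀ A' B' : Set E, A' ⊆ A → B' ⊆ B → A'.Finite → B'.Finite → Ind A' C B') → Ind A C B
  local_character : ∀ μ : Cardinal.{u}, μ < κ → ∃ ν : Cardinal.{u}, ν < κ ∧
    ∀ A C : Set E, #A < μ → #C < κ → ∃ C' ⊆ C, #C' < ν ∧ Ind A C' C
  stationarity : ∀ C : Set E, #C < κ → (∀ (ι : Type u) (a a' : ι → E), #ι < κ →
      Conj G C a a' → Relation.EqvGen (LStep G C) a a') →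
    ∀ (ι : Type u) (a a' : ι → E) (B : Set E), #ι < κ → #B < κ →
      Ind (Set.range a) C B → Ind (Set.range a') C B → Conj G C a a' → Conj G (C ∪ B) a a'

include U in
/-- In a stable theory dividing independence is a stable independence relation. -/
theorem isIndep_di (hU : U.Stable) : IsIndep G κ (DI G) where
  invariance g hg A B C _ _ _ h := DI.smul h hg
  monotonicity A B C A' B' _ hB hC hA' hB' h := DI.mono U hC hB h hA' hB'
  normality A B C _ hB hC h := DI.normal U hC hB h
  existence A C _ _ := nd_self (by simp)
  full_existence A C η b hA hC hη := by
    obtain ⟨b', hb', h⟩ := U.exists_conj_nd hU hC hη hA b (Subtype.val : A → E)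
    refine ⟨b', hb', ?_⟩
    rw [U.nd_iff hC hA, Subtype.range_val] at h
    exact DI.symm U hU hC (mk_range_lt hη b') hA h
  base_monotonicity A B C C' _ _ hC hC' h := DI.base h hC (hC'.trans Set.subset_union_right)
  extension A B C η d hA hB hC hη h := by
    obtain ⟨d', hd', hnd⟩ := ND.exists_extend U hU hC hA hB hη h d
    refine ⟨d', ?_, ?_⟩
    · have := conj_sum_iff'.1 hd'
      rwa [Subtype.range_val] at this
    · rw [U.nd_iff hC (U.mk_sum_lt hB hη), Set.Sum.elim_range] at hnd
      simpa using hnd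
  symmetry A B C hA hB hC h := DI.symm U hU hC hA hB h
  transitivity A B C C' hA hB hC' hC h h' := DI.trans U hU hC' hA hB hC h h'
  finite_character A B C hA hB hC h := by
    refine U.nd_of_finite hC hA hB fun F H => ?_
    rw [U.nd_iff hC ((mk_subtype_le _).trans_lt hB)]
    exact h _ _ (by rintro _ ⟨x, rfl⟩; exact x.1.2) (by rintro _ ⟨x, rfl⟩; exact x.1.2)
      (Set.finite_range _) (Set.finite_range _)
  local_character μ hμ := U.exists_localCharacter hU hμ
  stationarity C hC hL ι a a' B hι hB h h' haa' :=
    U.conj_of_lascar hU hC hι hB (fun x y => hL ι x y hι) h h' haa'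

variable {U} {Ind : Set E → Set E → Set E → Prop}

/-- Invariance, for tuples. -/
theorem IsIndep.of_conj (h : IsIndep G κ Ind) {ι η : Type*} {C : Set E} (hC : #C < κ)
    {a a' : ι → E} {b b' : η → E} (ha : #(Set.range a) < κ) (hb : #(Set.range b) < κ)
    (hI : Ind (Set.range a) C (Set.range b)) (hc : Conj G C (Sum.elim a b) (Sum.elim a' b')) :
    Ind (Set.range a') C (Set.range b') := by
  obtain ⟨g, hg, hgC, hgab⟩ := hc
  have := h.invariance g hg _ _ _ ha hb hC hI
  rwa [← Set.range_comp, ← Set.range_comp, Set.EqOn.image_eq (f₂ := id) (fun c hc => hgC c hc),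
    Set.image_id, show g ∘ a = a' from funext fun i => hgab (Sum.inl i),
    show g ∘ b = b' from funext fun i => hgab (Sum.inr i)] at this

variable (U)
include U

/-- Saturated sets satisfy the hypothesis of stationarity. -/
theorem exists_stationary : ∃ lam < κ, ∀ Ind, IsIndep G κ Ind → ∀ N : Set E, Good G lam N →
    #N < κ → ∀ (ι : Type u) (a a' : ι → E) (B : Set E), #ι < κ → #B < κ →
      Ind (Set.range a) N B → Ind (Set.range a') N B → Conj G N a a' → Conj G (N ∪ B) a a' := by
  obtain ⟨lam, hlam, hst⟩ := U.exists_lstep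
  refine ⟨lam, hlam, fun Ind h N hN hNκ => h.stationarity N hNκ fun ι a a' hι haa' => ?_⟩
  obtain ⟨z, hz, hz'⟩ := hst N hN hNκ ι hι a a' haa'
  exact (Relation.EqvGen.rel _ _ hz).trans _ _ _ ((Relation.EqvGen.rel _ _ hz').symm _ _)

/-- Every small set is contained in a small saturated set. -/
theorem exists_good_lt {lam : Cardinal.{u}} (hlam : lam < κ) {B : Set E} (hB : #B < κ) :
    ∃ N, B ⊆ N ∧ #N < κ ∧ Good G lam N := by
  let lam' := max ℵ₀ lam
  let ρ : Cardinal.{u} := 2 ^ max (max #U.F lam') #B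
  have hlam' : lam' < κ := max_lt U.aleph0_lt hlam
  have hinf : ℵ₀ ≤ max (max #U.F lam') #B :=
    (le_max_left ℵ₀ lam).trans ((le_max_right _ _).trans (le_max_left _ _))
  obtain ⟨N, hBN, hN, hg⟩ := U.exists_good (lam := lam') (ρ := ρ) (le_max_left _ _) hlam' (by
    rw [← power_mul]
    exact power_le_power_left two_ne_zero (mul_le_of_le hinf le_rfl
      ((le_max_right _ _).trans (le_max_left _ _))))
    (power_le_power_left two_ne_zero (le_max_left _ _)) (B := B)
    ((le_max_right _ _).trans (cantor _).le)
  exact ⟨N, hBN, hN.trans_lt (U.two_power_lt (max_lt (max_lt U.card_F hlam') hB)),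
    fun A hA hAl => hg A hA (hAl.trans (le_max_right _ _))⟩

/-- Every stable independence relation implies dividing independence. -/
theorem IsIndep.di (h : IsIndep G κ Ind) {A B C : Set E} (hA : #A < κ) (hB : #B < κ)
    (hC : #C < κ) (hI : Ind A C B) : DI G A C B := by
  obtain ⟨lam, hlam, hst⟩ := U.exists_stationary
  obtain ⟨N, hCN, hN, hNg⟩ := U.exists_good_lt hlam hC
  intro s hs hsb
  obtain ⟨t, ht, hti⟩ := U.exists_indisc_union hC hN hB hs
  -- A conjugate of `A` that is independent from `N` and the whole sequence `t`.
  have ht0 : Conj G C (Subtype.val : B → E) (t 0) :=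
    (hsb 0).symm.trans (ht.comp (fun j => ((0 : ℕ), j))).symm
  obtain ⟨x₁, hx₁⟩ := (ht0.exists_extend (Subtype.val : A → E))
  have hI₁ : Ind (Set.range x₁) C (Set.range (t 0)) := by
    refine h.of_conj hC (a := (Subtype.val : A → E)) (b := (Subtype.val : B → E)) (by simpa)
      (by simpa) (by simpa) ?_
    have := hx₁.comp (Sum.swap : A ⊕ B → B ⊕ A)
    convert this using 2 <;> · rename_i p; rcases p with p | p <;> rfl
  let d : N ⊕ (ℕ × B) → E := Sum.elim Subtype.val (flat t)
  have hη : #(N ⊕ (ℕ × B)) < κ := U.mk_sum_lt hN (U.mk_nat_prod_lt hB)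
  obtain ⟨d', hd', hI₂⟩ := h.extension _ _ C _ d (mk_range_lt hA x₁) (mk_range_lt hB (t 0)) hC hη
    hI₁
  obtain ⟨g, hg, hgC, hgd⟩ := hd'
  have hgt : ∀ j, g (t 0 j) = t 0 j := fun j => hgC _ (Or.inr ⟨j, rfl⟩)
  have hgC' : ∀ c ∈ C, g c = c := fun c hc => hgC _ (Or.inl hc)
  let x : A → E := fun i => g (x₁ i)
  have hI₃ : Ind (Set.range x) C (Set.range d) := by
    refine h.of_conj hC (a := x₁) (b := d') (mk_range_lt hA x₁) (mk_range_lt hη d')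
      (h.monotonicity _ _ _ _ _ (mk_range_lt hA x₁) (U.mk_union_lt (mk_range_lt hB (t 0))
        (mk_range_lt hη d')) hC subset_rfl Set.subset_union_right hI₂) ⟨g, hg, hgC', ?_⟩
    rintro (i | i)
    · rfl
    · exact hgd i
  have hxt : Conj G C (Sum.elim x (t 0)) (Sum.elim (Subtype.val : A → E) (Subtype.val : B → E)) := by
    have h1 : Conj G C (Sum.elim x (t 0)) (Sum.elim x₁ (t 0)) := by
      refine Conj.symm ⟨g, hg, hgC', ?_⟩
      rintro (i | i)
      · rfl
      · exact hgt i
    refine h1.trans ?_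
    have := hx₁.symm.comp (Sum.swap : A ⊕ B → B ⊕ A)
    convert this using 2 <;> · rename_i p; rcases p with p | p <;> rfl
  have hNd : N ⊆ Set.range d := fun c hc => ⟨Sum.inl ⟨c, hc⟩, rfl⟩
  -- Stationarity over `N` applies to the entries of `t`.
  have htn : ∀ n, Conj G (N ∪ Set.range x) (t n) (t 0) := by
    have hI₄ : ∀ n, Ind (Set.range (t n)) N (Set.range x) := by
      intro n
      refine h.symmetry _ _ _ (mk_range_lt hA x) (mk_range_lt hB _) hN
        (h.monotonicity _ _ _ _ _ (mk_range_lt hA x) (mk_range_lt hη d) hN subset_rfl ?_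
          (h.base_monotonicity _ _ C N (mk_range_lt hA x) (mk_range_lt hη d) hCN hNd hI₃))
      rintro _ ⟨j, rfl⟩
      exact ⟨Sum.inr (n, j), rfl⟩
    exact fun n => hst Ind h N hNg hN _ _ _ _ hB (mk_range_lt hA x) (hI₄ n) (hI₄ 0)
      ((hti.conj n 0).mono Set.subset_union_right)
  obtain ⟨k, hk, hkC, hkt⟩ := ht
  refine ⟨fun i => k (x i), fun n => ?_⟩
  have h1 := conj_sum_elim (C := C) hk hkC x (t n)
  rw [show (fun i => k (t n i)) = s n from funext fun i => hkt (n, i)] at h1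
  exact (h1.symm.trans (conj_sum_iff'.2 ((htn n).mono
    (Set.union_subset_union_left _ hCN)))).trans hxt

/-- Dividing independence implies every stable independence relation. -/
theorem IsIndep.of_di (h : IsIndep G κ Ind) {A B C : Set E} (hA : #A < κ) (hB : #B < κ)
    (hC : #C < κ) (hD : DI G A C B) : Ind A C B := by
  obtain ⟨lam, hlam, hex⟩ := U.extraction (σ := max #C #B) (max_lt hC hB)
  let X := lam.ord.ToType
  have hX : #X < κ := by rwa [mk_ord_toType]
  let b : B → E := Subtype.val
  -- A long sequence of copies of `B`, each independent from the earlier ones, and an indiscernible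
  -- sequence extracted from it.
  obtain ⟨t₀, ht₀⟩ := exists_wf_seq (X := X) (α := B → E)
    (fun x p v => Conj G C v b ∧ Ind (Set.range v) C (Set.range (flat p))) (fun x p => by
      have hp : #(Set.range (flat p)) < κ :=
        mk_range_lt (U.mk_prod_lt ((mk_subtype_le _).trans_lt hX) hB) _
      obtain ⟨v, hv, hI⟩ := h.full_existence (Set.range (flat p)) C B b hp hC hB
      exact ⟨v, hv, h.symmetry _ _ _ hp (mk_range_lt hB v) hC hI⟩)
  obtain ⟨s₁, hs₁, hst⟩ := hex C B (le_max_left _ _) (le_max_right _ _) X (mk_ord_toType _).ge t₀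
  have hs₁b : Conj G C (s₁ 0) b := by
    obtain ⟨f, hf, hc⟩ := hst 1
    have : Conj G C (s₁ 0) (t₀ (f 0)) := hc.comp (fun j => ((0 : Fin 1), j))
    exact this.trans (ht₀ _).1
  have hs₁I : ∀ n, Ind (Set.range (s₁ n)) C (Set.range (flat fun k : Fin n => s₁ k)) := by
    intro n
    obtain ⟨f, hf, hc⟩ := hst (n + 1)
    have hfl : #(Set.range (flat fun y : {y // y < f (Fin.last n)} => t₀ y)) < κ :=
      mk_range_lt (U.mk_prod_lt ((mk_subtype_le _).trans_lt hX) hB) _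
    refine h.of_conj hC (a := t₀ (f (Fin.last n))) (b := flat fun k : Fin n => t₀ (f k.castSucc))
      (mk_range_lt hB _) (mk_range_lt (U.mk_fin_prod_lt n hB) _)
      (h.monotonicity _ _ _ _ _ (mk_range_lt hB _) hfl hC subset_rfl ?_ (ht₀ _).2) ?_
    · rintro _ ⟨p, rfl⟩
      exact ⟨(⟨f p.1.castSucc, hf (Fin.castSucc_lt_last _)⟩, p.2), rfl⟩
    · have := hc.symm.comp (Sum.elim (fun i => (Fin.last n, i))
        (fun p : Fin n × B => (p.1.castSucc, p.2)))
      convert this using 2 <;> · rename_i p; rcases p with p | p <;> rfl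
  obtain ⟨x₁, hx₁⟩ := hs₁b.symm.exists_extend (Subtype.val : A → E)
  have hx₁' : Conj G C (Sum.elim (Subtype.val : A → E) b) (Sum.elim x₁ (s₁ 0)) := by
    have := hx₁.comp (Sum.swap : A ⊕ B → B ⊕ A)
    convert this using 2 <;> · rename_i p; rcases p with p | p <;> rfl
  obtain ⟨a', ha', hi⟩ := ND.exists_indisc' U hC hA hB hs₁ rfl (hD.of_conj hx₁')
  -- By local character, `a'` is independent over an initial segment of a long sequence.
  obtain ⟨ν, hν, hloc⟩ := h.local_character (Order.succ #A)
    (U.inacc.isStrongLimit.isSuccLimit.succ_lt hA)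
  let W := (Order.succ (max ℵ₀ ν)).ord.ToType
  have hW : #W < κ := by
    rw [mk_ord_toType]
    exact U.inacc.isStrongLimit.isSuccLimit.succ_lt (max_lt U.aleph0_lt hν)
  have ha'κ : #(Set.range a') < κ := mk_range_lt hA a'
  obtain ⟨t, ht⟩ := U.stretch (U.mk_union_lt hC ha'κ) hB hi W hW
  have hflat : ∀ i : W, #(Set.range (flat fun y : {y // y < i} => t y)) < κ := fun i =>
    mk_range_lt (U.mk_prod_lt ((mk_subtype_le _).trans_lt hW) hB) _
  have htκ : ∀ i, #(Set.range (t i)) < κ := fun i => mk_range_lt hB _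
  have htI : ∀ i : W, Ind (Set.range (t i)) C (Set.range (flat fun y : {y // y < i} => t y)) := by
    classical
    intro i
    refine h.finite_character _ _ _ (htκ i) (hflat i) hC fun A' B' hA' hB' _ hfin => ?_
    choose p hp using fun c : B' => hB' c.2
    have := hfin.fintype
    let S : Finset W := insert i (Finset.univ.image fun c => (p c).1.1)
    let f := S.orderEmbOfFin rfl
    have hfS : ∀ w ∈ S, ∃ k, f k = w := fun w hw => by
      have : w ∈ Set.range f := by
        rw [Finset.range_orderEmbOfFin]
        exact hw
      exact this
    obtain ⟨k₀, hk₀⟩ := hfS i (Finset.mem_insert_self _ _)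
    have hc := (ht _ f Fin.val f.strictMono Fin.val_strictMono).mono
      (Set.subset_union_left (s := C))
    have h1 := h.of_conj hC (a := s₁ k₀) (b := flat fun k : Fin k₀ => s₁ k)
      (a' := t (f k₀)) (b' := flat fun k : Fin k₀ => t (f ⟨k, k.2.trans k₀.2⟩))
      (mk_range_lt hB _) (mk_range_lt (U.mk_fin_prod_lt _ hB) _) (hs₁I k₀) (by
        have := hc.symm.comp (Sum.elim (fun i => (k₀, i))
          (fun p : Fin k₀ × B => (⟨p.1, p.1.2.trans k₀.2⟩, p.2)))
        convert this using 2 <;> · rename_i p; rcases p with p | p <;> rfl)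
    rw [hk₀] at h1
    refine h.monotonicity _ _ _ _ _ (htκ i) (mk_range_lt (U.mk_fin_prod_lt _ hB) _) hC hA' ?_ h1
    intro c hcB
    obtain ⟨k, hk⟩ := hfS (p ⟨c, hcB⟩).1.1
      (Finset.mem_insert_of_mem (Finset.mem_image_of_mem _ (Finset.mem_univ _)))
    have hkk : k < k₀ := by
      rw [← f.lt_iff_lt, hk, hk₀]
      exact (p ⟨c, hcB⟩).1.2
    exact ⟨(⟨k, hkk⟩, (p ⟨c, hcB⟩).2), (congrFun (congrArg t hk) _).trans (hp ⟨c, hcB⟩)⟩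
  obtain ⟨C', hC'sub, hC'ν, hI⟩ := hloc (Set.range a') (C ∪ Set.range (flat t))
    (Order.lt_succ_of_le mk_range_le) (U.mk_union_lt hC (mk_range_lt (U.mk_prod_lt hW hB) _))
  obtain ⟨i, hi'⟩ : ∃ i : W, C' ⊆ C ∪ Set.range (flat fun y : {y // y < i} => t y) := by
    have hcof : Order.cof W = Order.succ (max ℵ₀ ν) := by
      rw [Ordinal.cof_toType, (isRegular_succ (le_max_left _ _)).cof_ord]
    have hWne : Nonempty W := by
      rw [← mk_ne_zero_iff, mk_ord_toType]
      exact (succ_pos _).ne'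
    have : ∀ c : C', ∃ w : W, (c : E) ∈ C ∪ Set.range (t w) := by
      intro c
      rcases hC'sub c.2 with hc | ⟨p, hp⟩
      · exact ⟨hWne.some, Or.inl hc⟩
      · exact ⟨p.1, Or.inr ⟨p.2, hp⟩⟩
    choose w hw using this
    have hnc : ¬ IsCofinal (Set.range w) := by
      intro hc
      have := (Order.cof_le hc).trans (mk_range_le.trans hC'ν.le)
      rw [hcof] at this
      exact (Order.lt_succ_of_le (le_max_right ℵ₀ ν)).not_ge this
    simp only [IsCofinal, not_forall, not_exists, not_and, not_le] at hnc
    obtain ⟨v, hv⟩ := hnc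
    refine ⟨v, fun c hc => ?_⟩
    rcases hw ⟨c, hc⟩ with h1 | ⟨j, hj⟩
    · exact Or.inl h1
    · exact Or.inr ⟨(⟨w ⟨c, hc⟩, hv _ ⟨⟨c, hc⟩, rfl⟩⟩, j), hj⟩
  have hDκ : #(C ∪ Set.range (flat fun y : {y // y < i} => t y) : Set E) < κ :=
    U.mk_union_lt hC (hflat i)
  have hTκ : #(C ∪ Set.range (flat t) : Set E) < κ :=
    U.mk_union_lt hC (mk_range_lt (U.mk_prod_lt hW hB) _)
  have h1 : Ind (Set.range a') (C ∪ Set.range (flat fun y : {y // y < i} => t y))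
      (Set.range (t i)) := by
    refine h.monotonicity _ _ _ _ _ ha'κ hTκ hDκ subset_rfl ?_
      (h.base_monotonicity _ _ _ _ ha'κ hTκ hi' (Set.union_subset_union_right _ ?_) hI)
    · rintro _ ⟨j, rfl⟩
      exact Or.inr ⟨(i, j), rfl⟩
    · rintro _ ⟨p, rfl⟩
      exact ⟨(p.1, p.2), rfl⟩
  have h2 : Ind (Set.range (t i)) C (C ∪ Set.range (flat fun y : {y // y < i} => t y)) :=
    h.monotonicity _ _ _ _ _ (U.mk_union_lt hC (htκ i)) hDκ hC Set.subset_union_right subset_rfl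
      (h.normality _ _ _ (htκ i) (hflat i) hC (htI i))
  have h3 : Ind (Set.range a') C (Set.range (t i)) := h.symmetry _ _ _ (htκ i) ha'κ hC
    (h.transitivity _ _ _ _ (htκ i) ha'κ hDκ Set.subset_union_left h2
      (h.symmetry _ _ _ ha'κ (htκ i) hDκ h1))
  have hti : Conj G (C ∪ Set.range a') (t i) (s₁ 0) := (ht 1 (fun _ => i) (fun _ => 0)
    (Subsingleton.strictMono _) (Subsingleton.strictMono _)).comp (fun j => ((0 : Fin 1), j))
  have := h.of_conj hC ha'κ (htκ i) h3
    (((conj_sum_iff'.2 hti).trans ha').trans hx₁'.symm)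
  simpa [b] using this

/-- A theory with a stable independence relation is stable: over a suitably closed set `S`, every type
is determined by its restriction to a saturated subset of size at most `ρ`. -/
theorem IsIndep.stable (h : IsIndep G κ Ind) : U.Stable := by
  classical
  obtain ⟨lam₀, hlam₀, hst⟩ := U.exists_stationary
  obtain ⟨ν, hν, hloc⟩ := h.local_character ℵ₀ U.aleph0_lt
  let lam := max ℵ₀ lam₀
  have hlam : lam < κ := max_lt U.aleph0_lt hlam₀
  let ρ₀ := max (max #U.F lam) ν
  have hρ₀inf : ℵ₀ ≤ ρ₀ := (le_max_left ℵ₀ lam₀).trans ((le_max_right _ _).trans (le_max_left _ _))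
  have hρ₀ : ρ₀ < κ := max_lt (max_lt U.card_F hlam) hν
  -- Sets of size at most `ρ` lie in saturated sets of size at most `ρ`.
  let ρ : Cardinal.{u} := 2 ^ ρ₀
  have hρ : ρ < κ := U.two_power_lt hρ₀
  have hρ₀ρ : ρ₀ ≤ ρ := (cantor _).le
  have hρinf : ℵ₀ ≤ ρ := hρ₀inf.trans hρ₀ρ
  have hgood : ∀ B : Set E, #B ≤ ρ → ∃ N, B ⊆ N ∧ #N ≤ ρ ∧ Good G lam N := fun B hB =>
    U.exists_good (le_max_left _ _) hlam (by
      rw [← power_mul]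
      exact power_le_power_left two_ne_zero (mul_le_of_le hρ₀inf le_rfl
        ((le_max_right _ _).trans (le_max_left _ _))))
      (power_le_power_left two_ne_zero (le_max_left _ _)) hB
  choose! Nf hNf using hgood
  let τ : Cardinal.{u} := 2 ^ ρ
  have hτ : τ < κ := U.two_power_lt hρ
  have hρτ : ρ ≤ τ := (cantor _).le
  have hτρ : τ ^ ρ ≤ τ := by
    rw [← power_mul]
    exact power_le_power_left two_ne_zero (mul_le_of_le hρinf le_rfl le_rfl)
  refine ⟨τ, hρinf.trans hρτ, hτ, fun B hB n X a hsrt ha => ?_⟩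
  obtain ⟨S, hBS, hS, hcl⟩ := exists_closed hρinf hτρ
    (le_trans (by exact_mod_cast (natCast_lt_aleph0 (n := 2)).le) (hρinf.trans hρτ)) B hB Nf
    fun A hA => (hNf A hA).2.1.trans hρτ
  have hSκ : #S < κ := hS.trans_lt hτ
  -- Every type over `S` is determined by its restriction to one of few sets.
  have : ∀ x, ∃ C' ⊆ S, #C' ≤ ρ ∧ Ind (Set.range (a x)) (Nf C') S := by
    intro x
    obtain ⟨C', hC', hC'ν, hI⟩ := hloc (Set.range (a x)) S (Set.finite_range _).lt_aleph0 hSκ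
    have hC'ρ : #C' ≤ ρ := hC'ν.le.trans ((le_max_right _ _).trans hρ₀ρ)
    exact ⟨C', hC', hC'ρ, h.base_monotonicity _ _ _ _
      ((Set.finite_range _).lt_aleph0.trans U.aleph0_lt) hSκ (hNf C' hC'ρ).1 (hcl C' hC' hC'ρ) hI⟩
  choose C' hC' hC'ρ hI using this
  let Y := Σ D : {D : Set E // D ⊆ S ∧ #D ≤ ρ}, Set (U.Inst (ULift.{u} (Fin n) ⊕ Nf D.1))
  have hY : #Y ≤ τ := by
    rw [mk_sigma]
    refine (sum_le_sum _ (fun _ => τ) fun D => ?_).trans ?_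
    · rw [mk_set]
      refine power_le_power_left two_ne_zero ((U.mk_inst_le _).trans (max_le hρinf (max_le
        ((le_max_left _ _).trans ((le_max_left _ _).trans hρ₀ρ)) ?_)))
      rw [mk_sum, lift_id, lift_id, mk_uLift, mk_fin, lift_natCast]
      exact add_le_of_le hρinf (natCast_lt_aleph0.le.trans hρinf) (hNf D.1 D.2.2).2.1
    · rw [sum_const']
      refine mul_le_of_le (hρinf.trans hρτ) ?_ le_rfl
      refine (mk_bounded_subset_le S ρ).trans ?_
      exact (power_le_power_right (max_le hS (hρinf.trans hρτ))).trans hτρ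
  refine (mk_le_of_injective (f := fun x => (⟨⟨C' x, hC' x, hC'ρ x⟩,
    U.tpOver (Nf (C' x)) fun k : ULift.{u} (Fin n) => a x k.down⟩ : Y)) ?_).trans hY
  intro x y hxy
  obtain ⟨h1, h2⟩ := Sigma.mk.inj_iff.1 hxy
  have h1' : C' x = C' y := congrArg Subtype.val h1
  have hNκ : #(Nf (C' x)) < κ := (hNf _ (hC'ρ x)).2.1.trans_lt hρ
  have heq : ∀ D D' : Set E, D = D' → ∀ v w : ULift.{u} (Fin n) → E,
      U.tpOver (Nf D) v ≍ U.tpOver (Nf D') w → U.tpOver (Nf D) v = U.tpOver (Nf D) w := by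
    rintro D _ rfl v w h
    exact eq_of_heq h
  have h3 := heq _ _ h1' _ _ h2
  have h4 := (U.conj_iff_tpOver hNκ U.mk_fin_lt).2 h3
  have hrange : ∀ z, Set.range (fun k : ULift.{u} (Fin n) => a z k.down) = Set.range (a z) :=
    fun z => Equiv.ulift.surjective.range_comp (a z)
  have h5 := hst Ind h _ (fun A hA hAl => (hNf _ (hC'ρ x)).2.2 A hA
    (hAl.trans (le_max_right _ _))) hNκ _ _ _ S U.mk_fin_lt hSκ
    (by rw [hrange]; exact hI x) (by rw [hrange, h1']; exact hI y) h4
  exact ha x y ((h5.mono (hBS.trans Set.subset_union_right)).comp fun k => ⟨k⟩)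

end Presentation

variable {L : Signature.{u}}

/-! ### Renaming variables -/

namespace Term

variable {V W : Type u} {σ : V → L.Srt} {τ : W → L.Srt}

/-- Renaming the variables of a term. -/
def rename (f : V → W) (hf : ∀ v, τ (f v) = σ v) : ∀ {s : L.Srt}, Term σ s → Term τ s
  | _, .var v => hf v ▸ .var (f v)
  | _, .app g ts => .app g fun i => (ts i).rename f hf

theorem eval_rename {f : V → W} (hf : ∀ v, τ (f v) = σ v) {M : Str L} {a : ∀ v, M.carrier (σ v)}
    {b : ∀ w, M.carrier (τ w)} (h : ∀ v, (⟨_, b (f v)⟩ : M.Elt) = ⟨_, a v⟩) {s : L.Srt}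
    (t : Term σ s) : (t.rename f hf).eval M b = t.eval M a := by
  induction t with
  | var v =>
    have key : ∀ (w : W) (s : L.Srt) (hs : τ w = s) (m : M.carrier s),
        (⟨_, b w⟩ : M.Elt) = ⟨s, m⟩ → (hs ▸ var w : Term τ s).eval M b = m := by
      rintro w _ rfl m hm
      exact eq_of_heq (Sigma.mk.inj_iff.1 hm).2
    exact key _ _ _ _ (h v)
  | app g ts ih => exact congrArg (M.fn g) (funext ih)

/-- Only finitely many variables occur in a term. -/
theorem exists_finset {Γ : List L.Srt} {s : L.Srt} (t : Term (Sum.elim σ Γ.get) s) :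
    ∃ S : Finset V, ∀ S', S ⊆ S' → ∃ t' : Term (Sum.elim (fun v : S' => σ v) Γ.get) s,
      ∀ (M : Str L) (a : ∀ v, M.carrier (σ v)) (x : ∀ i, M.carrier (Γ.get i)),
        t'.eval M (M.env (fun v : S' => a v) x) = t.eval M (M.env a x) := by
  classical
  induction t with
  | var v =>
    rcases v with v | i
    · refine ⟨{v}, fun S' h => ?_⟩
      let w : S' ⊕ Fin Γ.length := Sum.inl ⟨v, h (Finset.mem_singleton_self v)⟩
      exact ⟨(.var w : Term (Sum.elim (fun v : S' => σ v) Γ.get) _), fun M a x => rfl⟩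
    · exact ⟨∅, fun S' _ => ⟨(.var (Sum.inr i) : Term (Sum.elim (fun v : S' => σ v) Γ.get) _),
        fun M a x => rfl⟩⟩
  | app g ts ih =>
    choose S hS using ih
    refine ⟨Finset.univ.biUnion S, fun S' h => ?_⟩
    choose t' ht' using fun i => hS i S'
      ((Finset.subset_biUnion_of_mem S (Finset.mem_univ i)).trans h)
    exact ⟨.app g t', fun M a x => congrArg (M.fn g) (funext fun i => ht' i M a x)⟩

end Term

namespace PosFormula

variable {V W : Type u} {σ : V → L.Srt} {τ : W → L.Srt}

/-- The renaming `f` under a quantifier. -/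
def liftVar (s : L.Srt) {Γ Δ : List L.Srt} (f : V ⊕ Fin Γ.length → W ⊕ Fin Δ.length) :
    V ⊕ Fin (s :: Γ).length → W ⊕ Fin (s :: Δ).length
  | .inl v => (f (.inl v)).map id Fin.succ
  | .inr ⟨0, _⟩ => .inr ⟨0, Nat.succ_pos _⟩
  | .inr ⟨k + 1, h⟩ => (f (.inr ⟨k, Nat.lt_of_succ_lt_succ h⟩)).map id Fin.succ

theorem sum_elim_map_succ (s : L.Srt) {Δ : List L.Srt} (w : W ⊕ Fin Δ.length) :
    Sum.elim τ (s :: Δ).get (w.map id Fin.succ) = Sum.elim τ Δ.get w := by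
  rcases w with w | j <;> rfl

theorem liftVar_srt (s : L.Srt) {Γ Δ : List L.Srt} {f : V ⊕ Fin Γ.length → W ⊕ Fin Δ.length}
    (hf : ∀ v, Sum.elim τ Δ.get (f v) = Sum.elim σ Γ.get v) (v : V ⊕ Fin (s :: Γ).length) :
    Sum.elim τ (s :: Δ).get (liftVar s f v) = Sum.elim σ (s :: Γ).get v := by
  rcases v with v | ⟨_ | k, hk⟩
  · exact (sum_elim_map_succ s _).trans (hf _)
  · rfl
  · exact (sum_elim_map_succ s _).trans (hf (.inr ⟨k, Nat.lt_of_succ_lt_succ hk⟩))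

/-- Renaming the free variables of a formula. -/
def rename : ∀ {Γ Δ : List L.Srt} (f : V ⊕ Fin Γ.length → W ⊕ Fin Δ.length),
    (∀ v, Sum.elim τ Δ.get (f v) = Sum.elim σ Γ.get v) → PosFormula σ Γ → PosFormula τ Δ
  | _, _, _, _, .top => .top
  | _, _, _, _, .bot => .bot
  | _, _, f, hf, .eq t₁ t₂ => .eq (t₁.rename f hf) (t₂.rename f hf)
  | _, _, f, hf, .rel R ts => .rel R fun i => (ts i).rename f hf
  | _, _, f, hf, .and φ ψ => .and (φ.rename f hf) (ψ.rename f hf)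
  | _, _, f, hf, .or φ ψ => .or (φ.rename f hf) (ψ.rename f hf)
  | _, _, f, hf, .ex (s := s) φ => .ex (φ.rename (liftVar s f) (liftVar_srt s hf))

theorem env_push_succ {M : Str L} {Δ : List L.Srt} {s : L.Srt} (b : ∀ w, M.carrier (τ w))
    (y : ∀ i, M.carrier (Δ.get i)) (m : M.carrier s) (w : W ⊕ Fin Δ.length) :
    (⟨_, M.env b (M.push m y) (w.map id Fin.succ)⟩ : M.Elt) = ⟨_, M.env b y w⟩ := by
  rcases w with w | j <;> rfl

theorem realize_rename {Γ Δ : List L.Srt} {f : V ⊕ Fin Γ.length → W ⊕ Fin Δ.length}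
    (hf : ∀ v, Sum.elim τ Δ.get (f v) = Sum.elim σ Γ.get v) {M : Str L}
    {a : ∀ v, M.carrier (σ v)} {b : ∀ w, M.carrier (τ w)} {x : ∀ i, M.carrier (Γ.get i)}
    {y : ∀ i, M.carrier (Δ.get i)}
    (h : ∀ v, (⟨_, M.env b y (f v)⟩ : M.Elt) = ⟨_, M.env a x v⟩) (φ : PosFormula σ Γ) :
    (φ.rename f hf).Realize M b y ↔ φ.Realize M a x := by
  induction φ generalizing Δ with
  | top => exact Iff.rfl
  | bot => exact Iff.rfl
  | eq t₁ t₂ =>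
    simp only [rename, Realize]
    rw [Term.eval_rename hf h, Term.eval_rename hf h]
  | rel R ts =>
    simp only [rename, Realize]
    simp only [Term.eval_rename hf h]
  | and φ ψ ih₁ ih₂ => exact and_congr (ih₁ hf h) (ih₂ hf h)
  | or φ ψ ih₁ ih₂ => exact or_congr (ih₁ hf h) (ih₂ hf h)
  | ex φ ih =>
    refine exists_congr fun m => ih (liftVar_srt _ hf) ?_
    rintro (v | ⟨_ | k, hk⟩)
    · exact (env_push_succ b y m _).trans (h _)
    · rfl
    · exact (env_push_succ b y m _).trans (h (.inr ⟨k, Nat.lt_of_succ_lt_succ hk⟩))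

/-- Only finitely many variables occur in a formula. -/
theorem exists_finset {Γ : List L.Srt} (φ : PosFormula σ Γ) :
    ∃ S : Finset V, ∀ S', S ⊆ S' → ∃ φ' : PosFormula (fun v : S' => σ v) Γ,
      ∀ (M : Str L) (a : ∀ v, M.carrier (σ v)) (x : ∀ i, M.carrier (Γ.get i)),
        φ'.Realize M (fun v : S' => a v) x ↔ φ.Realize M a x := by
  classical
  induction φ with
  | top => exact ⟨∅, fun S' _ => ⟨.top, fun _ _ _ => Iff.rfl⟩⟩
  | bot => exact ⟨∅, fun S' _ => ⟨.bot, fun _ _ _ => Iff.rfl⟩⟩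
  | eq t₁ t₂ =>
    obtain ⟨S₁, h₁⟩ := t₁.exists_finset
    obtain ⟨S₂, h₂⟩ := t₂.exists_finset
    refine ⟨S₁ ∪ S₂, fun S' h => ?_⟩
    obtain ⟨t₁', h₁⟩ := h₁ S' (Finset.subset_union_left.trans h)
    obtain ⟨t₂', h₂⟩ := h₂ S' (Finset.subset_union_right.trans h)
    refine ⟨.eq t₁' t₂', fun M a x => ?_⟩
    simp only [Realize, h₁, h₂]
  | rel R ts =>
    choose S hS using fun i => (ts i).exists_finset
    refine ⟨Finset.univ.biUnion S, fun S' h => ?_⟩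
    choose t' ht' using fun i => hS i S'
      ((Finset.subset_biUnion_of_mem S (Finset.mem_univ i)).trans h)
    refine ⟨.rel R t', fun M a x => ?_⟩
    simp only [Realize, ht']
  | and φ ψ ih₁ ih₂ =>
    obtain ⟨S₁, h₁⟩ := ih₁
    obtain ⟨S₂, h₂⟩ := ih₂
    refine ⟨S₁ ∪ S₂, fun S' h => ?_⟩
    obtain ⟨φ', h₁⟩ := h₁ S' (Finset.subset_union_left.trans h)
    obtain ⟨ψ', h₂⟩ := h₂ S' (Finset.subset_union_right.trans h)
    exact ⟨.and φ' ψ', fun M a x => and_congr (h₁ M a x) (h₂ M a x)⟩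
  | or φ ψ ih₁ ih₂ =>
    obtain ⟨S₁, h₁⟩ := ih₁
    obtain ⟨S₂, h₂⟩ := ih₂
    refine ⟨S₁ ∪ S₂, fun S' h => ?_⟩
    obtain ⟨φ', h₁⟩ := h₁ S' (Finset.subset_union_left.trans h)
    obtain ⟨ψ', h₂⟩ := h₂ S' (Finset.subset_union_right.trans h)
    exact ⟨.or φ' ψ', fun M a x => or_congr (h₁ M a x) (h₂ M a x)⟩
  | ex φ ih =>
    obtain ⟨S, h⟩ := ih
    refine ⟨S, fun S' hS => ?_⟩
    obtain ⟨φ', h⟩ := h S' hS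
    exact ⟨.ex φ', fun M a x => exists_congr fun m => h M a _⟩

end PosFormula

/-! ### The number of formulas -/

namespace Term

variable {V : Type u} {σ : V → L.Srt}

/-- Terms as well-founded trees. -/
def toTree : ∀ {s : L.Srt}, Term σ s →
    WType (Sum.elim (fun _ : V => Fin 0) fun f : L.Fn => Fin (L.dom f).length)
  | _, .var v => ⟨Sum.inl v, fun i => i.elim0⟩
  | _, .app f ts => ⟨Sum.inr f, fun i => (ts i).toTree⟩

theorem toTree_injective {s s' : L.Srt} (t : Term σ s) (t' : Term σ s')
    (h : t.toTree = t'.toTree) : (⟨s, t⟩ : Σ s, Term σ s) = ⟨s', t'⟩ := by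
  induction t generalizing s' with
  | var v =>
    cases t' <;> simp only [toTree] at h <;> injection h with h1 h2 <;> cases h1
    rfl
  | app f ts ih =>
    cases t' <;> simp only [toTree] at h <;> injection h with h1 h2 <;> cases h1
    next ts' =>
    have : ts = ts' := funext fun i =>
      eq_of_heq (Sigma.mk.inj_iff.1 (ih i (ts' i) (congrFun (eq_of_heq h2) i))).2
    rw [this]

theorem mk_lt {κ : Cardinal.{u}} (hκ : ℵ₀ < κ) (hFn : #L.Fn < κ) (hV : #V < κ) (s : L.Srt) :
    #(Term σ s) < κ := by
  have : ∀ a, Finite (Sum.elim (fun _ : V => Fin 0) (fun f : L.Fn => Fin (L.dom f).length) a) := by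
    rintro (a | a)
    · exact inferInstanceAs (Finite (Fin 0))
    · exact inferInstanceAs (Finite (Fin (L.dom a).length))
  refine (mk_le_of_injective (f := fun t : Term σ s => t.toTree) fun t t' h =>
    eq_of_heq (Sigma.mk.inj_iff.1 (toTree_injective t t' h)).2).trans_lt ?_
  refine WType.cardinalMk_le_max_aleph0_of_finite'.trans_lt (max_lt ?_ hκ)
  simp only [mk_sum, lift_id, lift_uzero]
  exact add_lt_of_lt hκ.le hV hFn

end Term

namespace PosFormula

variable {V : Type u} {σ : V → L.Srt}

/-- The nodes of the tree of a formula. -/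
inductive Node (σ : V → L.Srt) : Type u
  | top (Γ : List L.Srt)
  | bot (Γ : List L.Srt)
  | eq (Γ : List L.Srt) (s : L.Srt) (t₁ t₂ : Term (Sum.elim σ Γ.get) s)
  | rel (Γ : List L.Srt) (R : L.Rel) (ts : ∀ i, Term (Sum.elim σ Γ.get) ((L.arity R).get i))
  | and (Γ : List L.Srt)
  | or (Γ : List L.Srt)
  | ex (Γ : List L.Srt) (s : L.Srt)

/-- The number of immediate subformulas. -/
def Node.arity : Node σ → ℕ
  | .top _ | .bot _ | .eq _ _ _ _ | .rel _ _ _ => 0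
  | .and _ | .or _ => 2
  | .ex _ _ => 1

/-- Formulas as well-founded trees. -/
def toTree : ∀ {Γ : List L.Srt}, PosFormula σ Γ → WType fun n : Node σ => Fin n.arity
  | Γ, .top => ⟨.top Γ, fun i => i.elim0⟩
  | Γ, .bot => ⟨.bot Γ, fun i => i.elim0⟩
  | Γ, .eq t₁ t₂ => ⟨.eq Γ _ t₁ t₂, fun i => i.elim0⟩
  | Γ, .rel R ts => ⟨.rel Γ R ts, fun i => i.elim0⟩
  | Γ, .and φ ψ => ⟨.and Γ, fun i : Fin 2 => if i = 0 then φ.toTree else ψ.toTree⟩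
  | Γ, .or φ ψ => ⟨.or Γ, fun i : Fin 2 => if i = 0 then φ.toTree else ψ.toTree⟩
  | Γ, .ex (s := s) φ => ⟨.ex Γ s, fun _ : Fin 1 => φ.toTree⟩

theorem toTree_injective {Γ Γ' : List L.Srt} (φ : PosFormula σ Γ) (φ' : PosFormula σ Γ')
    (h : φ.toTree = φ'.toTree) : (⟨Γ, φ⟩ : Σ Γ, PosFormula σ Γ) = ⟨Γ', φ'⟩ := by
  induction φ generalizing Γ' with
  | top =>
    cases φ' <;> simp only [toTree] at h <;> injection h with h1 h2 <;> cases h1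
    rfl
  | bot =>
    cases φ' <;> simp only [toTree] at h <;> injection h with h1 h2 <;> cases h1
    rfl
  | eq t₁ t₂ =>
    cases φ' <;> simp only [toTree] at h <;> injection h with h1 h2 <;> cases h1
    rfl
  | rel R ts =>
    cases φ' <;> simp only [toTree] at h <;> injection h with h1 h2 <;> cases h1
    rfl
  | and φ ψ ih₁ ih₂ =>
    cases φ' <;> simp only [toTree] at h <;> injection h with h1 h2 <;> cases h1
    have h3 := ih₁ _ (congrFun h2 (0 : Fin 2))
    have h4 := ih₂ _ (congrFun h2 (1 : Fin 2))
    rw [eq_of_heq (Sigma.mk.inj_iff.1 h3).2, eq_of_heq (Sigma.mk.inj_iff.1 h4).2]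
  | or φ ψ ih₁ ih₂ =>
    cases φ' <;> simp only [toTree] at h <;> injection h with h1 h2 <;> cases h1
    have h3 := ih₁ _ (congrFun h2 (0 : Fin 2))
    have h4 := ih₂ _ (congrFun h2 (1 : Fin 2))
    rw [eq_of_heq (Sigma.mk.inj_iff.1 h3).2, eq_of_heq (Sigma.mk.inj_iff.1 h4).2]
  | ex φ ih =>
    cases φ' <;> simp only [toTree] at h <;> injection h with h1 h2 <;> cases h1
    have h3 := ih _ (congrFun h2 (0 : Fin 1))
    rw [eq_of_heq (Sigma.mk.inj_iff.1 h3).2]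

/-- Nodes as tuples of their data. -/
def Node.toSum : Node σ → List L.Srt × (ULift.{u} (Fin 4) ⊕ L.Srt ⊕
    (Σ Γ : List L.Srt, Σ s, Term (Sum.elim σ Γ.get) s × Term (Sum.elim σ Γ.get) s) ⊕
    (Σ Γ : List L.Srt, Σ R : L.Rel, ∀ i, Term (Sum.elim σ Γ.get) ((L.arity R).get i)))
  | .top Γ => (Γ, .inl ⟨0⟩)
  | .bot Γ => (Γ, .inl ⟨1⟩)
  | .and Γ => (Γ, .inl ⟨2⟩)
  | .or Γ => (Γ, .inl ⟨3⟩)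
  | .ex Γ s => (Γ, .inr (.inl s))
  | .eq Γ s t₁ t₂ => (Γ, .inr (.inr (.inl ⟨Γ, s, t₁, t₂⟩)))
  | .rel Γ R ts => (Γ, .inr (.inr (.inr ⟨Γ, R, ts⟩)))

theorem Node.toSum_injective : Function.Injective (Node.toSum (σ := σ)) := by
  intro n n' h
  cases n <;> cases n' <;> simp_all [Node.toSum]
  all_goals
    obtain ⟨rfl, h⟩ := h
    cases eq_of_heq h
    simp

theorem mk_sigma_lt {κ : Cardinal.{u}} (hκ : κ.IsInaccessible) (hSrt : #L.Srt < κ)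
    (hFn : #L.Fn < κ) (hRel : #L.Rel < κ) (hV : #V < κ) : #(Σ Γ, PosFormula σ Γ) < κ := by
  have hω : ℵ₀ < κ := hκ.aleph0_lt
  have hlist : #(List L.Srt) < κ := (mk_list_le_max _).trans_lt (max_lt hω hSrt)
  have hterm : ∀ (Γ : List L.Srt) s, #(Term (Sum.elim σ Γ.get) s) < κ := fun Γ s =>
    Term.mk_lt hω hFn (by
      rw [mk_sum, mk_fin, lift_natCast, lift_uzero]
      exact add_lt_of_lt hω.le hV (hκ.nat_lt _)) s
  have hnode : #(Node σ) < κ := by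
    refine (mk_le_of_injective Node.toSum_injective).trans_lt ?_
    simp only [mk_prod, mk_sum, lift_id]
    refine mul_lt_of_lt hω.le hlist (add_lt_of_lt hω.le ?_ (add_lt_of_lt hω.le hSrt
      (add_lt_of_lt hω.le ?_ ?_)))
    · exact (lt_aleph0_of_finite _).trans hω
    · rw [mk_sigma]
      refine sum_lt_of_isRegular hκ.isRegular hlist fun Γ => ?_
      rw [mk_sigma]
      refine sum_lt_of_isRegular hκ.isRegular hSrt fun s => ?_
      simp only [mk_prod, lift_id]
      exact mul_lt_of_lt hω.le (hterm Γ s) (hterm Γ s)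
    · rw [mk_sigma]
      refine sum_lt_of_isRegular hκ.isRegular hlist fun Γ => ?_
      rw [mk_sigma]
      refine sum_lt_of_isRegular hκ.isRegular hRel fun R => ?_
      refine (mk_le_of_injective (f := fun ts i => (⟨_, ts i⟩ : Σ s, Term (Sum.elim σ Γ.get) s))
        fun ts ts' h => funext fun i =>
          eq_of_heq (Sigma.mk.inj_iff.1 (congrFun h i)).2).trans_lt ?_
      rw [mk_arrow, mk_fin, lift_natCast, lift_uzero]
      refine power_nat_le_max.trans_lt (max_lt ?_ hω)
      rw [mk_sigma]
      exact sum_lt_of_isRegular hκ.isRegular hSrt (hterm Γ)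
  refine (mk_le_of_injective (f := fun p : Σ Γ, PosFormula σ Γ => p.2.toTree)
    fun p q h => toTree_injective p.2 q.2 h).trans_lt ?_
  refine WType.cardinalMk_le_max_aleph0_of_finite'.trans_lt (max_lt ?_ hω)
  rwa [lift_uzero]

end PosFormula

/-! ### Monster models as permutation groups -/

/-- Automorphisms preserve the values of terms. -/
theorem Term.eval_aut {M : Str L} (e : Aut M) {V : Type u} {σ : V → L.Srt}
    (a : ∀ v, M.carrier (σ v)) {s : L.Srt} (t : Term σ s) :
    t.eval M (fun v => e.toEquiv _ (a v)) = e.toEquiv _ (t.eval M a) := by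
  induction t with
  | var v => rfl
  | app f ts ih => exact (congrArg (M.fn f) (funext ih)).trans (e.map_fn f _).symm

/-- Automorphisms preserve the truth of formulas. -/
theorem PosFormula.realize_aut {M : Str L} (e : Aut M) {V : Type u} {σ : V → L.Srt}
    (a : ∀ v, M.carrier (σ v)) {Γ : List L.Srt} (φ : PosFormula σ Γ)
    (x : ∀ i, M.carrier (Γ.get i)) :
    φ.Realize M (fun v => e.toEquiv _ (a v)) (fun i => e.toEquiv _ (x i)) ↔ φ.Realize M a x := by
  have henv : ∀ {Γ : List L.Srt} (x : ∀ i, M.carrier (Γ.get i)),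
      (M.env (fun v => e.toEquiv _ (a v)) fun i => e.toEquiv _ (x i)) =
        fun v => e.toEquiv _ (M.env a x v) := by
    intro Γ x
    funext v
    rcases v with v | i <;> rfl
  induction φ with
  | top => exact Iff.rfl
  | bot => exact Iff.rfl
  | eq t₁ t₂ =>
    simp only [Realize, henv, Term.eval_aut]
    exact (e.toEquiv _).injective.eq_iff
  | rel R ts =>
    simp only [Realize, henv, Term.eval_aut]
    exact (e.map_rel R _).symm
  | and φ ψ ih₁ ih₂ => exact and_congr (ih₁ x) (ih₂ x)
  | or φ ψ ih₁ ih₂ => exact or_congr (ih₁ x) (ih₂ x)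
  | @ex Γ s φ ih =>
    have hpush : ∀ m : M.carrier s, M.push (e.toEquiv s m) (fun i => e.toEquiv _ (x i)) =
        fun i => e.toEquiv _ (M.push m x i) := by
      intro m
      funext i
      rcases i with ⟨_ | i, hi⟩ <;> rfl
    constructor
    · rintro ⟨m, hm⟩
      refine ⟨(e.toEquiv s).symm m, (ih _).1 ?_⟩
      rwa [← hpush, Equiv.apply_symm_apply]
    · rintro ⟨m, hm⟩
      refine ⟨e.toEquiv s m, ?_⟩
      rw [hpush]
      exact (ih _).2 hm

namespace Str

variable (M : Str L)

/-- The permutation of the elements given by an automorphism. -/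
def permOf {M : Str L} (e : Aut M) : Equiv.Perm M.Elt :=
  Equiv.sigmaCongrRight e.toEquiv

/-- The permutations of the elements that come from automorphisms. -/
def autGroup : Subgroup (Equiv.Perm M.Elt) where
  carrier := Set.range (permOf (M := M))
  mul_mem' := by
    rintro _ _ ⟨e, rfl⟩ ⟨e', rfl⟩
    refine ⟨⟨fun s => (e'.toEquiv s).trans (e.toEquiv s), fun f x => ?_, fun R x => ?_⟩, rfl⟩
    · simp only [Equiv.trans_apply, e'.map_fn, e.map_fn]
    · rw [e'.map_rel, e.map_rel]
      rfl
  one_mem' := ⟨⟨fun s => Equiv.refl _, fun f x => rfl, fun R x => Iff.rfl⟩, rfl⟩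
  inv_mem' := by
    rintro _ ⟨e, rfl⟩
    refine ⟨⟨fun s => (e.toEquiv s).symm, fun f x => ?_, fun R x => ?_⟩, rfl⟩
    · rw [Equiv.symm_apply_eq, e.map_fn]
      simp
    · have := e.map_rel R fun i => (e.toEquiv _).symm (x i)
      simp only [Equiv.apply_symm_apply] at this
      exact this.symm

variable {M}

/-- A tuple, with its sorts forgotten. -/
abbrev untype {ι : Type u} {σ : ι → L.Srt} (a : M.Tuple σ) : ι → M.Elt := fun i => ⟨σ i, a i⟩

theorem exists_untype {ι : Type*} {σ : ι → L.Srt} {b : ι → M.Elt} (h : ∀ i, (b i).1 = σ i) :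
    ∃ a : ∀ i, M.carrier (σ i), ∀ i, b i = ⟨σ i, a i⟩ := by
  have : ∀ i, ∃ m : M.carrier (σ i), b i = ⟨σ i, m⟩ := by
    intro i
    rw [← h i]
    exact ⟨(b i).2, rfl⟩
  exact ⟨fun i => (this i).choose, fun i => (this i).choose_spec⟩

/-- Satisfaction of formulas by tuples of elements of any sorts. -/
def Holds (M : Str L) (p : Σ Γ : List L.Srt, CtxFormula Γ) (b : Fin p.1.length → M.Elt) : Prop :=
  ∃ x : ∀ i, M.carrier (p.1.get i), (∀ i, b i = ⟨_, x i⟩) ∧ M.SatCtx p.2 x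

theorem holds_iff {p : Σ Γ : List L.Srt, CtxFormula Γ} {b : Fin p.1.length → M.Elt}
    {x : ∀ i, M.carrier (p.1.get i)} (h : ∀ i, b i = ⟨_, x i⟩) : M.Holds p b ↔ M.SatCtx p.2 x := by
  constructor
  · rintro ⟨y, hy, hs⟩
    have : x = y := funext fun i => eq_of_heq (Sigma.mk.inj_iff.1 ((h i).symm.trans (hy i))).2
    rwa [this]
  · exact fun hs => ⟨x, h, hs⟩

theorem holds_top {s : L.Srt} {m : M.Elt} : M.Holds ⟨[s], .top⟩ (fun _ => m) ↔ m.1 = s := by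
  constructor
  · rintro ⟨x, hx, -⟩
    exact congrArg Sigma.fst (hx ⟨0, Nat.succ_pos _⟩)
  · rintro rfl
    refine ⟨fun i => match i with | ⟨0, _⟩ => m.2, fun i => ?_, trivial⟩
    obtain ⟨_ | i, hi⟩ := i
    · rfl
    · exact absurd hi (by simp)

/-- Every formula is a formula in finitely many variables. -/
theorem exists_ctxFormula {V : Type u} {σ : V → L.Srt} (φ : Formula σ) :
    ∃ (p : Σ Γ : List L.Srt, CtxFormula Γ) (f : Fin p.1.length → V), ∀ (M : Str L)
      (a : M.Tuple σ), M.Sat φ a ↔ M.Holds p fun i => ⟨_, a (f i)⟩ := by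
  classical
  obtain ⟨S, hS⟩ := φ.exists_finset
  obtain ⟨φ', hφ'⟩ := hS S subset_rfl
  let e := S.equivFin
  let Γ : List L.Srt := List.ofFn fun i => σ (e.symm i)
  have hΓ : Γ.length = S.card := List.length_ofFn
  have hget : ∀ i, Γ.get i = σ (e.symm (i.cast hΓ)) := fun i => by simp [Γ]; rfl
  have hf : ∀ v : S ⊕ Fin ([] : List L.Srt).length,
      Sum.elim (PEmpty.elim : PEmpty.{u + 1} → L.Srt) Γ.get
        (Sum.elim (fun v => Sum.inr ((e v).cast hΓ.symm)) (fun i => i.elim0) v) =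
      Sum.elim (fun v : S => σ v) ([] : List L.Srt).get v := by
    rintro (v | i)
    · exact (hget _).trans (congrArg (fun w : S => σ w) (by simp))
    · exact i.elim0
  refine ⟨⟨Γ, φ'.rename _ hf⟩, fun i => e.symm (i.cast hΓ), fun M a => ?_⟩
  obtain ⟨x, hx⟩ := exists_untype (M := M)
    (b := fun i => ⟨_, a (e.symm (i.cast hΓ))⟩) (σ := Γ.get) fun i => (hget i).symm
  rw [holds_iff hx]
  refine (hφ' M a _).symm.trans (PosFormula.realize_rename hf ?_ φ').symm
  rintro (v | i)
  · exact (hx _).symm.trans (congrArg (fun w : S => (⟨σ w, a w⟩ : M.Elt)) (by simp))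
  · exact i.elim0

/-- Substituting variables in a formula in finitely many variables. -/
theorem exists_formula {V : Type u} (σ : V → L.Srt) (p : Σ Γ : List L.Srt, CtxFormula Γ)
    (f : Fin p.1.length → V) : ∃ φ : Formula σ, ∀ (M : Str L) (a : M.Tuple σ),
      M.Sat φ a ↔ M.Holds p fun i => ⟨_, a (f i)⟩ := by
  by_cases h : ∀ i, σ (f i) = p.1.get i
  · have hf : ∀ v : PEmpty.{u + 1} ⊕ Fin p.1.length, Sum.elim σ ([] : List L.Srt).get
        (Sum.elim (fun v => v.elim) (fun i => Sum.inl (f i)) v) =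
        Sum.elim (PEmpty.elim : PEmpty.{u + 1} → L.Srt) p.1.get v := by
      rintro (v | i)
      · exact v.elim
      · exact h i
    refine ⟨p.2.rename _ hf, fun M a => ?_⟩
    obtain ⟨x, hx⟩ := exists_untype (M := M) (b := fun i => ⟨_, a (f i)⟩) h
    rw [holds_iff hx]
    refine PosFormula.realize_rename hf ?_ p.2
    rintro (v | i)
    · exact v.elim
    · exact hx i
  · refine ⟨.bot, fun M a => ⟨False.elim, fun ⟨x, hx, _⟩ => h fun i => ?_⟩⟩
    exact congrArg Sigma.fst (hx i)

theorem holds_smul {g : Equiv.Perm M.Elt} (hg : g ∈ M.autGroup)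
    (p : Σ Γ : List L.Srt, CtxFormula Γ) (b : Fin p.1.length → M.Elt) (h : M.Holds p b) :
    M.Holds p fun i => g (b i) := by
  obtain ⟨e, rfl⟩ := hg
  obtain ⟨x, hx, hs⟩ := h
  refine ⟨fun i => e.toEquiv _ (x i), fun i => (congrArg _ (hx i)).trans rfl, ?_⟩
  have := (PosFormula.realize_aut e (fun v : PEmpty.{u + 1} => v.elim) p.2 x).2 hs
  have h0 : (fun v : PEmpty.{u + 1} => e.toEquiv (PEmpty.elim v) (v.elim)) = fun v => v.elim :=
    funext fun v => v.elim
  rwa [h0] at this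

end Str

namespace Str

variable {M : Str L}

theorem mk_join {ι η : Type u} {σ : ι → L.Srt} {τ : η → L.Srt} (a : M.Tuple σ) (b : M.Tuple τ)
    (k : ι ⊕ η) : (⟨_, M.join a b k⟩ : M.Elt) = Sum.elim (untype a) (untype b) k := by
  rcases k with i | j <;> rfl

theorem untype_join {ι η : Type u} {σ : ι → L.Srt} {τ : η → L.Srt} (a : M.Tuple σ)
    (b : M.Tuple τ) : untype (M.join a b) = Sum.elim (untype a) (untype b) :=
  funext (mk_join a b)

theorem tp_subset_iff {B : Set M.Elt} {ι : Type u} {σ : ι → L.Srt} {a a' : M.Tuple σ} :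
    M.tp B a ⊆ M.tp B a' ↔ ∀ (p : Σ Γ : List L.Srt, CtxFormula Γ) (f : Fin p.1.length → ι ⊕ B),
      M.Holds p (fun i => Sum.elim (untype a) Subtype.val (f i)) →
        M.Holds p (fun i => Sum.elim (untype a') Subtype.val (f i)) := by
  have key : ∀ (a : M.Tuple σ) (k : ι ⊕ B), (⟨_, M.join a (M.enum B) k⟩ : M.Elt) =
      Sum.elim (untype a) Subtype.val k := fun a k => mk_join a (M.enum B) k
  constructor
  · intro h p f hp
    obtain ⟨φ, hφ⟩ := exists_formula (Sum.elim σ (M.sorts B)) p f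
    have := @h φ ((hφ M _).2 (by simpa only [key] using hp))
    simpa only [key] using (hφ M _).1 this
  · intro h φ hφ
    obtain ⟨p, f, hpf⟩ := exists_ctxFormula φ
    have h1 := (hpf M _).1 hφ
    simp only [key] at h1
    have h2 := h p f h1
    refine (hpf M _).2 ?_
    simpa only [key] using h2

theorem equivOver_iff_holds {B : Set M.Elt} {ι : Type u} {σ : ι → L.Srt} {a a' : M.Tuple σ} :
    M.EquivOver B a a' ↔ ∀ (p : Σ Γ : List L.Srt, CtxFormula Γ) (f : Fin p.1.length → ι ⊕ B),
      M.Holds p (fun i => Sum.elim (untype a) Subtype.val (f i)) ↔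
        M.Holds p (fun i => Sum.elim (untype a') Subtype.val (f i)) := by
  refine Set.Subset.antisymm_iff.trans ((and_congr tp_subset_iff tp_subset_iff).trans ?_)
  exact ⟨fun h p f => ⟨h.1 p f, h.2 p f⟩, fun h => ⟨fun p f => (h p f).1, fun p f => (h p f).2⟩⟩

end Str

open Str

namespace IsMonster

variable {T : Theory L} {κ : Cardinal.{u}} {M : Str L}

/-- Homogeneity, for tuples of unspecified sorts: the sorts are determined by the formulas `⊤` in one
variable. -/
theorem exists_mem_autGroup (hM : IsMonster T κ M) {ι : Type u} (hι : #ι < κ) {b b' : ι → M.Elt}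
    (h : ∀ (p : Σ Γ : List L.Srt, CtxFormula Γ) (f : Fin p.1.length → ι),
      M.Holds p (fun i => b (f i)) ↔ M.Holds p (fun i => b' (f i))) :
    ∃ g ∈ M.autGroup, ∀ i, g (b i) = b' i := by
  have hs : ∀ i, (b' i).1 = (b i).1 := fun i =>
    holds_top.1 ((h ⟨[(b i).1], .top⟩ fun _ => i).1 (holds_top.2 rfl))
  obtain ⟨a', ha'⟩ := exists_untype hs
  have hE : M.EquivOver ∅ (fun i => (b i).2) a' := by
    rw [equivOver_iff_holds]
    intro p f
    have hf : ∀ k, ∃ i, f k = Sum.inl i := by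
      intro k
      rcases f k with i | e
      · exact ⟨i, rfl⟩
      · exact e.2.elim
    choose g hg using hf
    simp only [hg, Sum.elim_inl, untype, ← ha']
    exact h p g
  obtain ⟨e, he⟩ := hM.homogeneous ι _ _ _ hι hE
  refine ⟨permOf e, ⟨e, rfl⟩, fun i => ?_⟩
  rw [ha' i, ← he i]
  rfl

/-- Equality of types is conjugacy. -/
theorem equivOver_iff (hM : IsMonster T κ M) (hκ : κ.IsInaccessible) {B : Set M.Elt} (hB : #B < κ)
    {ι : Type u} (hι : #ι < κ) {σ : ι → L.Srt} {a a' : M.Tuple σ} :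
    M.EquivOver B a a' ↔ Conj M.autGroup B (untype a) (untype a') := by
  rw [equivOver_iff_holds]
  constructor
  · intro h
    obtain ⟨g, hg, h⟩ := hM.exists_mem_autGroup (ι := ι ⊕ B) (by
      simp only [mk_sum, lift_id]; exact add_lt_of_lt hκ.aleph0_lt.le hι hB) h
    exact ⟨g, hg, fun c hc => h (Sum.inr ⟨c, hc⟩), fun i => h (Sum.inl i)⟩
  · rintro ⟨g, hg, hfix, h⟩ p f
    have key : ∀ k : ι ⊕ B, g (Sum.elim (untype a) Subtype.val k) =
        Sum.elim (untype a') Subtype.val k := by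
      rintro (i | c)
      · exact h i
      · exact hfix _ c.2
    simp only [← key]
    refine ⟨holds_smul hg p _, fun h => ?_⟩
    simpa using holds_smul (M.autGroup.inv_mem hg) p _ h

theorem indiscernible_iff (hM : IsMonster T κ M) (hκ : κ.IsInaccessible) {B : Set M.Elt}
    (hB : #B < κ) {ι : Type u} (hι : #ι < κ) {σ : ι → L.Srt} {I : Type*} [LinearOrder I]
    {s : I → M.Tuple σ} :
    M.Indiscernible B s ↔ Indisc M.autGroup B fun i => untype (s i) := by
  refine forall_congr' fun n => forall_congr' fun f => forall_congr' fun g =>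
    imp_congr_right fun _ => imp_congr_right fun _ => hM.equivOver_iff hκ hB ?_
  rw [mk_prod, mk_fin, lift_natCast, lift_uzero]
  exact mul_lt_of_lt hκ.aleph0_lt.le (natCast_lt_aleph0.trans hκ.aleph0_lt) hι

/-- Saturation, for tuples of unspecified sorts: a variable that occurs in `S` has a sort that is
determined by its occurrences, and any other variable may be given any sort that is inhabited. -/
theorem holds_compact (hM : IsMonster T κ M) {ι : Type u} (hι : #ι < κ)
    (S : Set (Σ p : Σ Γ : List L.Srt, CtxFormula Γ, (Fin p.1.length → ι ⊕ M.Elt))) (hS : #S < κ)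
    (h : ∀ S₀ ⊆ S, S₀.Finite → ∃ a : ι → M.Elt, ∀ p ∈ S₀,
      M.Holds p.1 fun k => Sum.elim a id (p.2 k)) :
    ∃ a : ι → M.Elt, ∀ p ∈ S, M.Holds p.1 fun k => Sum.elim a id (p.2 k) := by
  classical
  -- every variable is given a sort, with an element of that sort
  have hc : ∀ i, ∃ c : M.Elt, ∀ p ∈ S, ∀ k, p.2 k = Sum.inl i → c.1 = p.1.1.get k := by
    intro i
    by_cases hi : ∃ p ∈ S, ∃ k, p.2 k = Sum.inl i
    · obtain ⟨p, hp, k, hk⟩ := hi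
      have hsrt : ∀ {a : ι → M.Elt} {q : Σ p : Σ Γ : List L.Srt, CtxFormula Γ,
          (Fin p.1.length → ι ⊕ M.Elt)} {j}, q.2 j = Sum.inl i →
          (M.Holds q.1 fun k => Sum.elim a id (q.2 k)) → (a i).1 = q.1.1.get j := by
        rintro a q j hj ⟨x, hx, -⟩
        have := hx j
        simp only [hj] at this
        exact congrArg Sigma.fst this
      obtain ⟨c, hc⟩ := h {p} (by simpa using hp) (Set.finite_singleton p)
      refine ⟨c i, fun q hq j hj => ?_⟩
      obtain ⟨a, ha⟩ := h {p, q} (by simp [Set.insert_subset_iff, hp, hq]) (Set.toFinite _)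
      rw [hsrt hk (hc p rfl), ← hsrt hk (ha p (by simp)), ← hsrt hj (ha q (by simp))]
    · obtain ⟨c, -⟩ := h ∅ (Set.empty_subset _) Set.finite_empty
      exact ⟨c i, fun p hp k hk => (hi ⟨p, hp, k, hk⟩).elim⟩
  choose c hc using hc
  choose F hF using fun p : Σ p : Σ Γ : List L.Srt, CtxFormula Γ, (Fin p.1.length → ι ⊕ M.Elt) =>
    exists_formula (Sum.elim (fun i => (c i).1) (M.sorts Set.univ)) p.1
      fun k => Sum.map id (fun m => ⟨m, trivial⟩) (p.2 k)
  have key : ∀ (a : M.Tuple fun i => (c i).1) p, M.Sat (F p) (M.join a (M.enum Set.univ)) ↔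
      M.Holds p.1 fun k => Sum.elim (untype a) id (p.2 k) := by
    intro a p
    rw [hF]
    refine iff_of_eq (congrArg _ (funext fun k => (mk_join _ _ _).trans ?_))
    rcases p.2 k with i | m <;> rfl
  obtain ⟨a, ha⟩ := hM.saturated ι (fun i => (c i).1) (F '' S) hι (mk_image_le.trans_lt hS) (by
    intro S₀ hS₀ hfin
    obtain ⟨S₁, hS₁, hfin₁, rfl⟩ : ∃ S₁ ⊆ S, S₁.Finite ∧ F '' S₁ = S₀ := by
      obtain ⟨S₁, hS₁, hbij⟩ := Set.SurjOn.exists_bijOn_subset (f := F) (s := S) (t := S₀) hS₀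
      exact ⟨S₁, hS₁, hbij.finite_iff_finite.2 hfin, hbij.image_eq⟩
    obtain ⟨a, ha⟩ := h S₁ hS₁ hfin₁
    obtain ⟨a', ha'⟩ := exists_untype (M := M) (b := fun i => if (a i).1 = (c i).1 then a i else c i)
      (σ := fun i => (c i).1) (by intro i; split_ifs with h <;> simp [h])
    refine ⟨a', ?_⟩
    rintro _ ⟨p, hp, rfl⟩
    rw [key]
    have hh := ha p hp
    obtain ⟨x, hx, -⟩ := id hh
    refine (iff_of_eq (congrArg _ (funext fun k => ?_))).2 hh
    rcases hpk : p.2 k with i | m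
    · have hk := hx k
      simp only [hpk] at hk
      have h1 : (a i).1 = p.1.1.get k := congrArg Sigma.fst hk
      exact (ha' i).symm.trans (if_pos (h1.trans (hc i p (hS₁ hp) k hpk).symm))
    · rfl)
  exact ⟨untype a, fun p hp => (key a p).1 (ha _ ⟨p, hp, rfl⟩)⟩

/-- Positive closedness, for tuples of unspecified sorts. When the sorts are wrong, the formula is
contradicted by `⊤` in one variable of the actual sort. -/
theorem holds_obstruct (hM : IsMonster T κ M) (p : Σ Γ : List L.Srt, CtxFormula Γ)
    (a : Fin p.1.length → M.Elt) (h : ¬ M.Holds p a) :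
    ∃ (q : Σ Γ : List L.Srt, CtxFormula Γ) (f : Fin q.1.length → Fin p.1.length),
      M.Holds q (fun i => a (f i)) ∧ ∀ b, M.Holds p b → ¬ M.Holds q fun i => b (f i) := by
  by_cases hs : ∀ i, (a i).1 = p.1.get i
  · obtain ⟨x, hx⟩ := exists_untype hs
    rw [holds_iff hx] at h
    obtain ⟨ψ, hψ, hx'⟩ := hM.pc.2 _ _ _ h
    refine ⟨⟨p.1, ψ⟩, id, (holds_iff (p := ⟨p.1, ψ⟩) hx).2 hx', ?_⟩
    rintro b ⟨y, hy, hs⟩ hb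
    exact hψ M hM.pc.1 ⟨y, hs, (holds_iff (p := ⟨p.1, ψ⟩) hy).1 hb⟩
  · push Not at hs
    obtain ⟨i, hi⟩ := hs
    refine ⟨⟨[(a i).1], .top⟩, fun _ => i, holds_top.2 rfl, ?_⟩
    rintro b ⟨y, hy, -⟩ hb
    exact hi ((holds_top.1 hb).symm.trans (congrArg Sigma.fst (hy i)))

/-- Thickness, for tuples of unspecified sorts. -/
theorem holds_thick (hM : IsMonster T κ M) (hκ : κ.IsInaccessible) (hthick : T.Thick) {ι : Type u}
    (hι : #ι < κ) (σ : ι → L.Srt) :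
    ∃ Θ : Set (Σ p : Σ Γ : List L.Srt, CtxFormula Γ, (Fin p.1.length → ℕ × ι)),
      ∀ s : ℕ → ι → M.Elt, (∀ p ∈ Θ, M.Holds p.1 fun k => flat s (p.2 k)) ↔
        (Indisc M.autGroup ∅ s ∧ ∀ i, (s 0 i).1 = σ i) := by
  obtain ⟨Θ, hΘ⟩ := hthick ι σ
  replace hΘ := hΘ M hM.pc
  choose P f hPf using fun φ : Formula (fun p : ℕ × ι => σ p.2) => exists_ctxFormula φ
  refine ⟨((fun φ => ⟨P φ, f φ⟩) '' Θ) ∪ Set.range fun x : ℕ × ι => ⟨⟨[σ x.2], .top⟩, fun _ => x⟩,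
    fun s => ?_⟩
  have typed : (∀ x : ℕ × ι, (s x.1 x.2).1 = σ x.2) → ((∀ φ ∈ Θ, M.Holds (P φ) fun k =>
      flat s (f φ k)) ↔ Indisc M.autGroup ∅ s) := by
    intro h
    obtain ⟨a, ha⟩ := exists_untype h
    have hs : s = fun n => untype fun i => a (n, i) := funext fun n => funext fun i => ha (n, i)
    rw [hs, ← hM.indiscernible_iff hκ (by simpa using hκ.pos) hι, hΘ]
    exact forall_congr' fun φ => imp_congr_right fun _ => (hPf φ M _).symm
  constructor
  · intro h
    have hs : ∀ x : ℕ × ι, (s x.1 x.2).1 = σ x.2 := fun x =>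
      holds_top.1 (h _ (Or.inr ⟨x, rfl⟩))
    exact ⟨(typed hs).1 fun φ hφ => h _ (Or.inl ⟨φ, hφ, rfl⟩), fun i => hs (0, i)⟩
  · rintro ⟨hi, h0⟩
    have hs : ∀ x : ℕ × ι, (s x.1 x.2).1 = σ x.2 := by
      rintro ⟨n, i⟩
      obtain ⟨g, ⟨e, rfl⟩, -, h⟩ := hi 1 (fun _ => 0) (fun _ => n) (Subsingleton.strictMono _)
        (Subsingleton.strictMono _)
      exact (congrArg Sigma.fst (h (0, i))).symm.trans (h0 i)
    rintro _ (⟨φ, hφ, rfl⟩ | ⟨x, rfl⟩)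
    · exact (typed hs).2 hi φ hφ
    · exact holds_top.2 (hs x)

/-- The presentation of the automorphism group of a monster model by the positive formulas. -/
def presentation (hM : IsMonster T κ M) (hκ : κ.IsInaccessible) (hthick : T.Thick)
    (hSrt : #L.Srt < κ) (hFn : #L.Fn < κ) (hRel : #L.Rel < κ) : Presentation M.autGroup κ where
  F := Σ Γ : List L.Srt, CtxFormula Γ
  ar p := p.1.length
  holds := M.Holds
  S := L.Srt
  srt := Sigma.fst
  inacc := hκ
  card_F := PosFormula.mk_sigma_lt hκ hSrt hFn hRel (by simpa using hκ.pos)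
  holds_smul _ hg p a h := holds_smul hg p a h
  srt_smul := by
    rintro _ ⟨e, rfl⟩ x
    rfl
  hom _ _ _ hι h := hM.exists_mem_autGroup hι h
  obstruct := hM.holds_obstruct
  compact _ hι S hS h := hM.holds_compact hι S hS h
  thick _ hι s₀ := hM.holds_thick hκ hthick hι fun i => (s₀ i).1

end IsMonster

/-! ### Typed and untyped notions -/

namespace Str

variable {M : Str L}

theorem untype_injective {ι : Type u} {σ : ι → L.Srt} :
    Function.Injective (untype : M.Tuple σ → ι → M.Elt) := fun _ _ h =>
  funext fun i => eq_of_heq (Sigma.mk.inj_iff.1 (congrFun h i)).2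

theorem exists_eq_untype {ι : Type u} {σ : ι → L.Srt} {b : ι → M.Elt} (h : ∀ i, (b i).1 = σ i) :
    ∃ a : M.Tuple σ, b = untype a := by
  obtain ⟨a, ha⟩ := exists_untype h
  exact ⟨a, funext ha⟩

theorem sort_eq_of_conj {ι : Type*} {C : Set M.Elt} {a b : ι → M.Elt}
    (h : Conj M.autGroup C a b) (i : ι) : (a i).1 = (b i).1 := by
  obtain ⟨_, ⟨e, rfl⟩, -, h⟩ := h
  rw [← h i]
  rfl

theorem sort_eq_of_indisc {ι : Type*} {C : Set M.Elt} {s : ℕ → ι → M.Elt}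
    (h : Indisc M.autGroup C s) (m n : ℕ) (i : ι) : (s m i).1 = (s n i).1 :=
  sort_eq_of_conj (h.conj m n) i

end Str

namespace IsMonster

variable {T : Theory L} {κ : Cardinal.{u}} {M : Str L}

/-- In a positively closed model, one inclusion between types is an equality. -/
theorem tp_subset_iff (hM : IsMonster T κ M) (hκ : κ.IsInaccessible) {B : Set M.Elt} (hB : #B < κ)
    {ι : Type u} (hι : #ι < κ) {σ : ι → L.Srt} {a a' : M.Tuple σ} :
    M.tp B a ⊆ M.tp B a' ↔ Conj M.autGroup B (untype a) (untype a') := by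
  rw [← hM.equivOver_iff hκ hB hι]
  refine ⟨fun h => h.antisymm ?_, fun h => Eq.subset h⟩
  rw [Str.tp_subset_iff] at h ⊢
  intro p f h'
  by_contra hn
  obtain ⟨q, g, hq, hno⟩ := hM.holds_obstruct p _ hn
  exact hno _ h' (h q (fun i => f (g i)) hq)

theorem dividingIndep_iff (hM : IsMonster T κ M) (hκ : κ.IsInaccessible) {A B C : Set M.Elt}
    (hA : #A < κ) (hB : #B < κ) (hC : #C < κ) :
    DividingIndep M A C B ↔ DI M.autGroup A C B := by
  have hAB : #(A ⊕ B) < κ := by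
    simp only [mk_sum, lift_id]
    exact add_lt_of_lt hκ.aleph0_lt.le hA hB
  have key : ∀ (x : M.Tuple (M.sorts A)) (y : M.Tuple (M.sorts B)),
      (∀ φ ∈ M.tp C (M.join (M.enum A) (M.enum B)), M.Sat φ (M.join (M.join x y) (M.enum C))) ↔
        Conj M.autGroup C (Sum.elim (untype x) (untype y))
          (Sum.elim (Subtype.val : A → M.Elt) (Subtype.val : B → M.Elt)) := by
    intro x y
    refine (hM.tp_subset_iff hκ hC hAB (a' := M.join x y)).trans ?_
    rw [untype_join, untype_join]
    exact ⟨Conj.symm, Conj.symm⟩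
  constructor
  · intro h s hs hsb
    have hsort : ∀ p : ℕ × B, (s p.1 p.2).1 = M.sorts B p.2 := fun p =>
      sort_eq_of_conj (hsb p.1) p.2
    obtain ⟨t, ht⟩ := exists_untype hsort
    have hst : ∀ n, s n = untype fun i => t (n, i) := fun n => funext fun i => ht (n, i)
    obtain ⟨x, hx⟩ := not_not.1 fun hno => h ⟨fun n i => t (n, i),
      (hM.indiscernible_iff hκ hC hB).2 (by simpa only [← hst] using hs),
      fun n => (hM.equivOver_iff hκ hC hB).2 (by rw [← hst]; exact hsb n), hno⟩
    refine ⟨untype x, fun n => ?_⟩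
    rw [hst]
    exact (key _ _).1 (hx n)
  · rintro h ⟨s, hs, hsb, hno⟩
    obtain ⟨x, hx⟩ := h (fun n => untype (s n)) ((hM.indiscernible_iff hκ hC hB).1 hs)
      fun n => (hM.equivOver_iff hκ hC hB).1 (hsb n)
    obtain ⟨x, rfl⟩ := exists_eq_untype (σ := M.sorts A) (b := x)
      fun i => sort_eq_of_conj (hx 0) (Sum.inl i)
    exact hno ⟨x, fun n => (key _ _).2 (hx n)⟩

/-- Stability, in terms of types over sets of at most `μ` elements of tuples indexed by `Fin n`. -/
theorem isStable_iff (hM : IsMonster T κ M) (hκ : κ.IsInaccessible) (U : Presentation M.autGroup κ)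
    (hU : ∀ x y, U.srt x = U.srt y ↔ x.1 = y.1) : IsStable κ M ↔ U.Stable := by
  refine exists_congr fun μ => and_congr_right fun _ => and_congr_right fun hμ => ?_
  constructor
  · intro h B hB n X a ha hinj
    rcases isEmpty_or_nonempty X with hX | ⟨⟨x₀⟩⟩
    · simp
    have hs : ∀ x, ∃ t : M.Tuple (fun i : ULift.{u} (Fin n) => (a x₀ i.down).1),
        (fun i => a x i.down) = untype t :=
      fun x => exists_eq_untype fun i => (hU _ _).1 (ha x x₀ i.down)
    choose t ht using hs
    refine (mk_le_of_injective (f := fun x => (⟨M.tp B (t x), t x, rfl⟩ :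
      TypeSpace M B fun i : ULift.{u} (Fin n) => (a x₀ i.down).1)) ?_).trans
      (h B hB _ _ inferInstance)
    intro x y hxy
    have := (hM.equivOver_iff hκ (hB.trans_lt hμ) ((lt_aleph0_of_finite _).trans hκ.aleph0_lt)).1
      (Subtype.ext_iff.1 hxy : M.tp B (t x) = M.tp B (t y))
    rw [← ht, ← ht] at this
    exact hinj x y (this.comp ULift.up)
  · intro h B hB ι σ hι
    obtain ⟨n, ⟨e⟩⟩ := Finite.exists_equiv_fin ι
    choose r hr using fun x : TypeSpace M B σ => x.2
    refine h B hB n (TypeSpace M B σ) (fun x i => untype (r x) (e.symm i))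
      (fun x y i => (hU _ _).2 rfl) fun x y hxy => ?_
    have h1 := hxy.comp e
    simp only [Equiv.symm_apply_apply] at h1
    have h2 : M.tp B (r x) = M.tp B (r y) := (hM.equivOver_iff hκ (hB.trans_lt hμ)
      ((lt_aleph0_of_finite _).trans hκ.aleph0_lt)).2 h1
    exact Subtype.ext (by rw [← hr, ← hr]; exact h2)

/-- Lascar strong types may be described by sequences indexed by `ℕ` and by neighbouring entries:
two entries of an indiscernible sequence are conjugate to the first two entries of a stretch. -/
theorem lascarEquiv_iff (hM : IsMonster T κ M) (U : Presentation M.autGroup κ) {C : Set M.Elt}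
    (hC : #C < κ) {ι : Type u} (hι : #ι < κ) {σ : ι → L.Srt} {a a' : M.Tuple σ} :
    LascarEquiv κ M C a a' ↔
      Relation.EqvGen (LStep M.autGroup C) (untype a) (untype a') := by
  have hκ := U.inacc
  constructor
  · intro h
    induction h with
    | refl => exact .refl _
    | tail _ h ih =>
      refine ih.trans _ _ _ ?_
      obtain ⟨I, _, s, hI, -, hs, ⟨i, rfl⟩, j, rfl⟩ := h
      rw [hM.indiscernible_iff hκ hC hι] at hs
      obtain ⟨t, ht⟩ := U.stretch hC hι hs (ULift.{u} ℕ) (by simpa using hκ.aleph0_lt)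
      have hstep : ∀ {i j : I}, i < j → LStep M.autGroup C (untype (s i)) (untype (s j)) := by
        intro i j hij
        have hmono : StrictMono (ULift.up : ℕ → ULift.{u} ℕ) := fun m n h => h
        have ht' : Indisc M.autGroup C t := ht.trans ht.symm
        refine LStep.conj ⟨_, ht'.reindex hmono, rfl, rfl⟩ ?_
        have h2 := ht 2 (fun k => ULift.up k) ![i, j] (hmono.comp Fin.val_strictMono) (by
          rw [Fin.strictMono_iff_lt_succ]
          intro k
          fin_cases k
          exact hij)
        have := h2.comp (Sum.elim (fun k => (0, k)) fun k : ι => (1, k))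
        convert this using 1 <;> funext k <;> rcases k with k | k <;> rfl
      rcases lt_trichotomy i j with hij | rfl | hij
      · exact .rel _ _ (hstep hij)
      · exact .refl _
      · exact .symm _ _ (.rel _ _ (hstep hij))
  · intro h
    have hsymm : Std.Symm (OnIndiscernible κ M C (σ := σ)) :=
      ⟨fun x y ⟨I, hI, s, h1, h2, h3, h4, h5⟩ => ⟨I, hI, s, h1, h2, h3, h5, h4⟩⟩
    have key : ∀ x y : ι → M.Elt, Relation.EqvGen (LStep M.autGroup C) x y →
        (∀ i, (x i).1 = (y i).1) ∧ ∀ a a' : M.Tuple σ, x = untype a → y = untype a' →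
          LascarEquiv κ M C a a' := by
      intro x y h
      induction h with
      | rel x y h =>
        obtain ⟨s, hs, rfl, rfl⟩ := h
        refine ⟨fun i => sort_eq_of_indisc hs _ _ i, fun a a' ha ha' => ?_⟩
        have hsort : ∀ n, ∃ t : M.Tuple σ, s n = untype t := fun n =>
          exists_eq_untype fun i => by rw [sort_eq_of_indisc hs n 0, ha]
        choose t ht using hsort
        refine .single ⟨ULift.{u} ℕ, inferInstance, fun n => t n.down, inferInstance,
          by simpa using hκ.aleph0_lt, ?_, ⟨⟨0⟩, ?_⟩, ⟨1⟩, ?_⟩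
        · rw [hM.indiscernible_iff hκ hC hι]
          simp only [← ht]
          intro n f g hf hg
          exact hs n (fun k => (f k).down) (fun k => (g k).down) (fun _ _ h => hf h)
            fun _ _ h => hg h
        · exact untype_injective ((ht 0).symm.trans ha)
        · exact untype_injective ((ht 1).symm.trans ha')
      | refl x =>
        refine ⟨fun _ => rfl, fun a a' ha ha' => ?_⟩
        rw [untype_injective (ha.symm.trans ha')]
        exact .refl
      | symm x y _ ih =>
        exact ⟨fun i => (ih.1 i).symm, fun a a' ha ha' =>
          Relation.ReflTransGen.stdSymm.symm _ _ (ih.2 a' a ha' ha)⟩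
      | trans x y z _ _ ih₁ ih₂ =>
        refine ⟨fun i => (ih₁.1 i).trans (ih₂.1 i), fun a a' ha ha' => ?_⟩
        obtain ⟨b, hb⟩ := exists_eq_untype (σ := σ) (b := y) fun i => by rw [← ih₁.1 i, ha]
        exact (ih₁.2 a b ha hb).trans (ih₂.2 b a' hb ha')
    exact (key _ _ h).2 a a' rfl rfl

theorem isStableIndep_iff (hM : IsMonster T κ M) (U : Presentation M.autGroup κ)
    {Ind : Set M.Elt → Set M.Elt → Set M.Elt → Prop} :
    IsStableIndep κ M Ind ↔ Presentation.IsIndep M.autGroup κ Ind := by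
  have hκ := U.inacc
  constructor
  · intro h
    refine ⟨?_, h.monotonicity, h.normality, h.existence, ?_, h.base_monotonicity, ?_, h.symmetry,
      h.transitivity, h.finite_character, h.local_character, ?_⟩
    · rintro _ ⟨e, rfl⟩
      exact h.invariance e
    · intro A C η b hA hC hη
      obtain ⟨b', hb', hI⟩ := h.full_existence A C η _ (fun i => (b i).2) hA hC hη
      exact ⟨untype b', (hM.equivOver_iff hκ hC hη).1 hb', hI⟩
    · intro A B C η d hA hB hC hη hI
      obtain ⟨d', hd', hI'⟩ := h.extension A B C η _ (fun i => (d i).2) hA hB hC hη hI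
      exact ⟨untype d', (hM.equivOver_iff hκ (U.mk_union_lt hC hB) hη).1 hd', hI'⟩
    · intro C hC hL ι a a' B hι hB hI hI' haa'
      obtain ⟨b', rfl⟩ := exists_eq_untype fun i => (sort_eq_of_conj haa' i).symm
      refine (hM.equivOver_iff hκ (U.mk_union_lt hC hB) hι).1
        (h.stationarity C hC ?_ ι _ (fun i => (a i).2) b' B hι hB hI hI'
          ((hM.equivOver_iff hκ hC hι).2 haa'))
      intro ι σ x y hι hxy
      exact (hM.lascarEquiv_iff U hC hι).2 (hL _ _ _ hι ((hM.equivOver_iff hκ hC hι).1 hxy))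
  · intro h
    refine ⟨?_, h.monotonicity, h.normality, h.existence, ?_, h.base_monotonicity, ?_, h.symmetry,
      h.transitivity, h.finite_character, h.local_character, ?_⟩
    · intro e
      exact h.invariance (permOf e) ⟨e, rfl⟩
    · intro A C η τ b hA hC hη
      obtain ⟨b', hb', hI⟩ := h.full_existence A C η (untype b) hA hC hη
      obtain ⟨b', rfl⟩ := exists_eq_untype (σ := τ) (b := b') (sort_eq_of_conj hb')
      exact ⟨b', (hM.equivOver_iff hκ hC hη).2 hb', hI⟩
    · intro A B C η τ d hA hB hC hη hI
      obtain ⟨d', hd', hI'⟩ := h.extension A B C η (untype d) hA hB hC hη hI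
      obtain ⟨d', rfl⟩ := exists_eq_untype (σ := τ) (b := d') (sort_eq_of_conj hd')
      exact ⟨d', (hM.equivOver_iff hκ (U.mk_union_lt hC hB) hη).2 hd', hI'⟩
    · intro C hC hL ι σ a a' B hι hB hI hI' haa'
      refine (hM.equivOver_iff hκ (U.mk_union_lt hC hB) hι).2
        (h.stationarity C hC ?_ ι _ _ B hι hB hI hI' ((hM.equivOver_iff hκ hC hι).1 haa'))
      intro ι x y hι hxy
      obtain ⟨y, rfl⟩ := exists_eq_untype fun i => (sort_eq_of_conj hxy i).symm
      exact (hM.lascarEquiv_iff U hC hι).1 (hL ι _ (fun i => (x i).2) y hι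
        ((hM.equivOver_iff hκ hC hι).2 hxy))

end IsMonster

end PosLogic

theorem mainTheorem2 (L : PosLogic.Signature.{u}) (T : PosLogic.Theory L)
    (hjcp : T.JCP) (hthick : T.Thick)
    (κ : Cardinal.{u}) (hκ : κ.IsInaccessible)
    (hSrt : #L.Srt < κ) (hFn : #L.Fn < κ) (hRel : #L.Rel < κ)
    (M : PosLogic.Str L) (hM : PosLogic.IsMonster T κ M) :
    (PosLogic.IsStable κ M ↔
      ∃ Ind : Set M.Elt → Set M.Elt → Set M.Elt → Prop, PosLogic.IsStableIndep κ M Ind) ∧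
    ∀ Ind : Set M.Elt → Set M.Elt → Set M.Elt → Prop, PosLogic.IsStableIndep κ M Ind →
      ∀ A B C : Set M.Elt, #A < κ → #B < κ → #C < κ →
        (Ind A C B ↔ PosLogic.DividingIndep M A C B) := by
  let U := hM.presentation hκ hthick hSrt hFn hRel
  have hstable : PosLogic.IsStable κ M ↔ U.Stable := hM.isStable_iff hκ U fun _ _ => Iff.rfl
  refine ⟨⟨fun h => ⟨_, (hM.isStableIndep_iff U).2 (U.isIndep_di (hstable.1 h))⟩, ?_⟩, ?_⟩
  · rintro ⟨Ind, h⟩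
    exact hstable.2 (((hM.isStableIndep_iff U).1 h).stable U)
  · intro Ind h A B C hA hB hC
    rw [hM.dividingIndep_iff hκ hA hB hC]
    have h' := (hM.isStableIndep_iff U).1 h
    exact ⟨h'.di U hA hB hC, h'.of_di U hA hB hC⟩
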